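/- Fix the angular velocity $\Omega=1$. For $b\in\mathbb R$ and $2\pi$-periodic functions $g,r:\mathbb R\to\mathbb R$ with $1+r>0$, consider the vortex sheet on the curve $z(\theta)=(1+r(\theta))(\cos\theta,\sin\theta)$ with strength $\gamma(\theta)=b+g(\theta)$. Write $P_0h=\frac1{2\pi}\int_{-\pi}^{\pi}h$ and $$D(\theta,\eta)=(1+r(\theta))^2+(1+r(\eta))^2-2(1+r(\theta))(1+r(\eta))\cos(\theta-\eta).$$ The sheet rotates uniformly with angular velocity $\Omega$ if $\mathcal F(b,g,r)=(\mathcal F_1,\mathcal F_2)=(0,0)$, where $$\mathcal F_1(\theta)=\mathrm{PV}\,\frac1{2\pi}\int_{-\pi}^{\pi} (b+g(\eta))\frac{\big(r'(\theta)\cos(\theta-\eta)-(1+r(\theta))\sin(\theta-\eta)\big)(1+r(\eta))-(1+r(\theta))r'(\theta)}{D(\theta,\eta)}\,d\eta+\Omega r'(\theta)(1+r(\theta)),$$ $\mathcal F_2=(I-P_0)\tilde{\mathcal F}_2$ and $$\tilde{\mathcal F}_2(\theta)=\frac{b+g(\theta)}{r'(\theta)^2+(1+r(\theta))^2}\left[\frac1{2\pi}\int_{-\pi}^{\pi}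 (b+g(\eta))\frac{(1+r(\theta))^2-\big(r'(\theta)\sin(\theta-\eta)+(1+r(\theta))\cos(\theta-\eta)\big)(1+r(\eta))}{D(\theta,\eta)}\,d\eta-\Omega(1+r(\theta))^2\right].$$ For $k\in\mathbb N$ and $c>0$ let $X^k_c$ be the space of functions $f$, analytic in the closed strip $|\mathrm{Im}\,z|\le c$, with an expansion $f(\theta)=\sum_{n\ge1}a_n\cos(2n\theta)$, $a_n\in\mathbb R$, and $$\|f\|_{X^k_c}^2=\sum_{\pm}\int_{-\pi}^{\pi}|f(\theta\pm ic)|^2+|\partial^kf(\theta\pm ic)|^2\,d\theta<\infty.$$ There is $c_0>0$ such that for every integer $k\ge3$, every $0<c<c_0$, and each of the two slopes $m=\pm\frac12$ (the solutions of $1-4m^2=0$) there are $\delta>0$ and a continuous curve $$(-\delta,\delta)\ni x\mapsto(b,g,r)=(2+x,g_x,r_x)\in\mathbb R\times X^k_c\times X^{k+1}_c$$ with $(g_0,r_0)=(0,0)$, such that for all $x\in(-\delta,\delta)$ one has $1+r_x>0$ and $\mathcal F(2+x,g_x,r_x)=(0,0)$, with $(g_x,r_x)\ne(0,0)$ for $x\neq0$.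 That is, the curve bifurcates from the circle with constant strength at $(b,g,r)=(2,0,0)$. Moreover $\frac1\pi\int_{-\pi}^{\pi}r_x(\theta)\cos(2\theta)\,d\theta=x\,(m+o(1))$ as $x\to0$; i.e. in the coordinates $x=b-2$ and $y=$ the $\cos(2\theta)$-coefficient of $r$, the two curves are tangent at the origin to the two lines of $x^2-4y^2=0$. -/

import Mathlib

open Set Filter Topology

noncomputable section

namespace VortexSheet

/-! ### Principal values of `2π`-periodic integrands -/

/-- The points of the period centred at `θ` at distance more than `ε` from `θ`. -/
def puncturedPeriod (θ ε : ℝ) : Set ℝ := {η | ε < |η - θ| ∧ |η - θ| ≤ Real.pi}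

/-- The mean over one period with the `ε`-neighbourhood of `θ` cut out. The period is centred at
the singularity `θ`; for a `2π`-periodic `h` this is the integral over the circle. -/
def truncMean (h : ℝ → ℝ) (θ ε : ℝ) : ℝ :=
  (2 * Real.pi)⁻¹ * ∫ η in puncturedPeriod θ ε, h η

/-- The principal value `PV ⨍ h(η) dη` with singularity at `η = θ`. -/
def pvMean (h : ℝ → ℝ) (θ : ℝ) : ℝ :=
  limUnder (𝓝[>] (0 : ℝ)) (truncMean h θ)

/-- The principal value of `h` at `θ` exists. -/
def PVExists (h : ℝ → ℝ) (θ : ℝ) : Prop :=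
  (∀ ε : ℝ, 0 < ε → MeasureTheory.IntegrableOn h (puncturedPeriod θ ε)) ∧
    ∃ L : ℝ, Tendsto (truncMean h θ) (𝓝[>] 0) (𝓝 L)

/-- The mean `P₀ h = (1/2π) ∫_{-π}^{π} h`. -/
def mean (h : ℝ → ℝ) : ℝ := (2 * Real.pi)⁻¹ * ∫ η in (-Real.pi)..Real.pi, h η

/-! ### The equations of a uniformly rotating vortex sheet

The sheet is the curve `z(θ) = (1 + r(θ)) (cos θ, sin θ)` with strength `γ(θ) = b + g(θ)`. -/

/-- `|z(θ) - z(η)|²`. -/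
def distSq (r : ℝ → ℝ) (θ η : ℝ) : ℝ :=
  (1 + r θ) ^ 2 + (1 + r η) ^ 2 - 2 * (1 + r θ) * (1 + r η) * Real.cos (θ - η)

/-- The integrand (in `η`) of the first component. -/
def kernel₁ (b : ℝ) (g r : ℝ → ℝ) (θ η : ℝ) : ℝ :=
  (b + g η) *
    (((deriv r θ * Real.cos (θ - η) - (1 + r θ) * Real.sin (θ - η)) * (1 + r η)
      - (1 + r θ) * deriv r θ) / distSq r θ η)

/-- The integrand (in `η`) of the second component; its singularity at `η = θ` is removable. -/
def kernel₂ (b : ℝ) (g r : ℝ → ℝ) (θ η : ℝ) : ℝ :=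
  (b + g η) *
    (((1 + r θ) ^ 2
      - (deriv r θ * Real.sin (θ - η) + (1 + r θ) * Real.cos (θ - η)) * (1 + r η))
        / distSq r θ η)

/-- The first component `𝓕₁`: the normal component of the velocity in the rotating frame. -/
def F₁ (Ω b : ℝ) (g r : ℝ → ℝ) (θ : ℝ) : ℝ :=
  pvMean (kernel₁ b g r θ) θ + Ω * deriv r θ * (1 + r θ)

/-- The tangential expression `𝓕̃₂`. -/
def F₂tilde (Ω b : ℝ) (g r : ℝ → ℝ) (θ : ℝ) : ℝ :=
  mean (kernel₂ b g r θ) * ((b + g θ) / (deriv r θ ^ 2 + (1 + r θ) ^ 2))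
    - Ω * (1 + r θ) ^ 2 * ((b + g θ) / (deriv r θ ^ 2 + (1 + r θ) ^ 2))

/-- The second component `𝓕₂ = (I - P₀) 𝓕̃₂`. -/
def F₂ (Ω b : ℝ) (g r : ℝ → ℝ) (θ : ℝ) : ℝ :=
  F₂tilde Ω b g r θ - mean (F₂tilde Ω b g r)

/-- `𝓕(b, g, r) = (0, 0)`, where the radius `1 + r` is positive (so that the sheet is a simple
closed curve) and all the integrals in `𝓕` exist. -/
structure IsSolution (Ω b : ℝ) (g r : ℝ → ℝ) : Prop where
  radius_pos : ∀ θ, 0 < 1 + r θ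
  pv_exists : ∀ θ, PVExists (kernel₁ b g r θ) θ
  integrable₂ : ∀ θ, IntervalIntegrable (kernel₂ b g r θ) MeasureTheory.volume
    (-Real.pi) Real.pi
  integrable_tilde : IntervalIntegrable (F₂tilde Ω b g r) MeasureTheory.volume
    (-Real.pi) Real.pi
  eq₁ : ∀ θ, F₁ Ω b g r θ = 0
  eq₂ : ∀ θ, F₂ Ω b g r θ = 0

/-! ### The analytic function spaces -/

/-- The closed strip `|Im z| ≤ c`. -/
def strip (c : ℝ) : Set ℂ := {z | |z.im| ≤ c}

/-- `θ ↦ |f(θ + iy)|² + |∂ᵏ f(θ + iy)|²`. -/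
def energyDensity (k : ℕ) (f : ℂ → ℂ) (y θ : ℝ) : ℝ :=
  ‖f (θ + y * Complex.I)‖ ^ 2 + ‖iteratedDeriv k f (θ + y * Complex.I)‖ ^ 2

/-- The square of the norm of the spaces below. -/
def stripNormSq (k : ℕ) (c : ℝ) (f : ℂ → ℂ) : ℝ :=
  (∫ θ in (-Real.pi)..Real.pi, energyDensity k f c θ) +
    ∫ θ in (-Real.pi)..Real.pi, energyDensity k f (-c) θ

/-- The space `X^k_c`: functions that are analytic in the closed strip `|Im z| ≤ c`, have an
expansion `f(θ) = ∑_{n ≥ 1} aₙ cos(2nθ)` with real coefficients, and satisfy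
`∑_± ∫_{-π}^{π} |f(θ ± ic)|² + |∂ᵏ f(θ ± ic)|² dθ < ∞`.
The coefficient with index `n : ℕ` below belongs to the mode `2(n + 1)`. -/
def X (k : ℕ) (c : ℝ) : Set (ℂ → ℂ) :=
  {f | AnalyticOnNhd ℂ f (strip c) ∧
    (∃ a : ℕ → ℝ, ∀ θ : ℝ,
      HasSum (fun n : ℕ => ((a n * Real.cos (2 * (n + 1) * θ) : ℝ) : ℂ)) (f θ)) ∧
    IntervalIntegrable (energyDensity k f c) MeasureTheory.volume (-Real.pi) Real.pi ∧
    IntervalIntegrable (energyDensity k f (-c)) MeasureTheory.volume (-Real.pi) Real.pi}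

/-- The restriction to the real line; elements of `X k c` are real there. -/
def onReal (f : ℂ → ℂ) (θ : ℝ) : ℝ := (f θ).re

/-- The coefficient of `cos(2θ)` in the Fourier expansion. -/
def modeTwo (f : ℝ → ℝ) : ℝ :=
  Real.pi⁻¹ * ∫ θ in (-Real.pi)..Real.pi, f θ * Real.cos (2 * θ)

end VortexSheet

end

/-!
Multiplication by `r' + i (1 + r)` combines the two components of the velocity of the sheet, and
turns `F₁ = 0` and `F₂ = 0` into one equation
`(b + g) (C - (1 + r)) = κ ((1 + r) + i r')` on the unit circle, where the constant `κ` is the mean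
value removed from `F₂` and `C` is the principal value of a Cauchy integral. In `ζ = e^{iθ}`, the
kernel of `C` is the Cauchy kernel of the circle divided by the divided difference of `ζ (1 + r)`.
In Wiener algebras of Laurent series with exponential weights the equation therefore involves only
products, one inverse and bounded linear maps, and all solutions extend to a complex strip.

At `b = 2` the linearization at the circle is not invertible. Put `b = 2 + s`,
`r = s (2 Y cos 2θ + s R)`, `g = s² G` and `κ = s (1 + s ν)`. Then the equation is divisible by
`s²`, and its `cos 2θ` mode even by `s³`. At `s = 0` the remaining system determines `ν`,
`G` and `R` in terms of `Y`, and its `cos 2θ` mode then reduces to `16 Y² = 1`, that is, to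
`1 - 4 m² = 0` for `m = 2 Y`. Both roots are simple, so the implicit function theorem gives one
branch through each of them.
-/

noncomputable section

open scoped NNReal

namespace VortexSheet

/-! ### Continuous linear maps on `ℓ¹` -/

/-- The real space `ℓ¹(ι)`. -/
abbrev L1 (ι : Type*) : Type _ := lp (fun _ : ι => ℝ) 1

namespace L1

variable {ι : Type*} {F : Type*} [NormedAddCommGroup F] [NormedSpace ℝ F]

theorem hasSum_abs (a : L1 ι) : HasSum (fun i => |a i|) ‖a‖ := by
  simpa using lp.hasSum_norm (p := 1) (by simp) a

theorem norm_smul_le_of_norm_le (a : L1 ι) {v : ι → F} {C : ℝ} (hv : ∀ i, ‖v i‖ ≤ C) (i : ι) :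
    ‖a i • v i‖ ≤ C * |a i| := by
  rw [norm_smul, Real.norm_eq_abs, mul_comm]
  exact mul_le_mul_of_nonneg_right (hv i) (abs_nonneg _)

theorem summable_smul [CompleteSpace F] (a : L1 ι) {v : ι → F} {C : ℝ} (hv : ∀ i, ‖v i‖ ≤ C) :
    Summable fun i => a i • v i :=
  .of_norm_bounded ((hasSum_abs a).summable.mul_left C) (norm_smul_le_of_norm_le a hv)

/-- The continuous linear map on `ℓ¹` with prescribed bounded values on the unit vectors. -/
def lift [CompleteSpace F] (v : ι → F) (C : ℝ) (hv : ∀ i, ‖v i‖ ≤ C) : L1 ι →L[ℝ] F :=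
  LinearMap.mkContinuous
    { toFun := fun a => ∑' i, a i • v i
      map_add' := fun a b => by
        rw [← (summable_smul a hv).tsum_add (summable_smul b hv)]
        exact tsum_congr fun i => add_smul (a i) (b i) (v i)
      map_smul' := fun c a => by
        rw [RingHom.id_apply, ← (summable_smul a hv).tsum_const_smul]
        exact tsum_congr fun i => mul_smul c (a i) (v i) } C fun a =>
    tsum_of_norm_bounded ((hasSum_abs a).mul_left C) (norm_smul_le_of_norm_le a hv)

theorem hasSum_lift [CompleteSpace F] {v : ι → F} {C : ℝ} (hv : ∀ i, ‖v i‖ ≤ C) (a : L1 ι) :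
    HasSum (fun i => a i • v i) (lift v C hv a) :=
  (summable_smul a hv).hasSum

/-- The coordinates on `ℓ¹`. -/
def coord (i : ι) : L1 ι →L[ℝ] ℝ := lp.evalCLM ℝ (fun _ => ℝ) 1 i

@[simp]
theorem coord_apply (i : ι) (a : L1 ι) : coord i a = a i := rfl

variable [DecidableEq ι]

/-- The unit vectors of `ℓ¹`. -/
abbrev unit (i : ι) : L1 ι := lp.single 1 i (1 : ℝ)

theorem unit_apply (i j : ι) : (unit i : L1 ι) j = if j = i then (1 : ℝ) else 0 := by
  rw [unit, lp.single_apply, Pi.single_apply]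

theorem norm_unit (i : ι) : ‖(unit i : L1 ι)‖ = 1 := by
  simp [unit, lp.norm_single]

@[simp]
theorem lift_unit [CompleteSpace F] {v : ι → F} {C : ℝ} (hv : ∀ i, ‖v i‖ ≤ C) (i : ι) :
    lift v C hv (unit i) = v i := by
  have h : HasSum (fun j => (unit i : L1 ι) j • v j) ((unit i : L1 ι) i • v i) :=
    hasSum_single i fun j hj => by rw [unit_apply, if_neg hj, zero_smul]
  rw [(hasSum_lift hv (unit i)).unique h, unit_apply, if_pos rfl, one_smul]

theorem hasSum_unit (a : L1 ι) : HasSum (fun i => a i • (unit i : L1 ι)) a := by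
  have h : (fun i => a i • (unit i : L1 ι)) = fun i => lp.single 1 i (a i) := by
    funext i
    rw [unit, ← lp.single_smul, smul_eq_mul, mul_one]
  rw [h]
  exact lp.hasSum_single (by simp) a

theorem hasSum_apply (T : L1 ι →L[ℝ] F) (a : L1 ι) :
    HasSum (fun i => a i • T (unit i)) (T a) := by
  simpa only [Function.comp_def, map_smul] using (hasSum_unit a).mapL T

theorem clm_ext {S T : L1 ι →L[ℝ] F} (h : ∀ i, S (unit i) = T (unit i)) : S = T :=
  lp.ext_continuousLinearMap (by simp) fun i => ContinuousLinearMap.ext_ring (h i)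

theorem norm_apply_le (T : L1 ι →L[ℝ] F) {C : ℝ} (h : ∀ i, ‖T (unit i)‖ ≤ C) (a : L1 ι) :
    ‖T a‖ ≤ C * ‖a‖ := by
  rw [← (hasSum_apply T a).tsum_eq]
  exact tsum_of_norm_bounded ((hasSum_abs a).mul_left C) (norm_smul_le_of_norm_le a h)

end L1

/-! ### Weighted convolution algebras -/

/-- A submultiplicative weight on an additive monoid, the datum of a Beurling algebra. -/
structure Weight (G : Type*) [AddCommMonoid G] where
  toFun : G → ℝ
  pos : ∀ k, 0 < toFun k
  add_le : ∀ k l, toFun (k + l) ≤ toFun k * toFun l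

instance {G : Type*} [AddCommMonoid G] : CoeFun (Weight G) fun _ => G → ℝ := ⟨Weight.toFun⟩

/-- The algebra of formal series `∑ aₖ Xᵏ`, `k ∈ G`, with `∑ |aₖ| w(k) < ∞`. The underlying element
of `ℓ¹` is the sequence `w(k) aₖ`. -/
def Wiener {G : Type*} [AddCommMonoid G] (_ : Weight G) : Type _ := L1 G

namespace Wiener

variable {G : Type*} [AddCommMonoid G] {w : Weight G}
variable {F : Type*} [NormedAddCommGroup F] [NormedSpace ℝ F]

instance : NormedAddCommGroup (Wiener w) := inferInstanceAs (NormedAddCommGroup (L1 G))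
instance : NormedSpace ℝ (Wiener w) := inferInstanceAs (NormedSpace ℝ (L1 G))
instance : CompleteSpace (Wiener w) := inferInstanceAs (CompleteSpace (L1 G))

/-- The identification of a weighted algebra with `ℓ¹`. -/
def toL1 (w : Weight G) : Wiener w ≃L[ℝ] L1 G := ContinuousLinearEquiv.refl ℝ (L1 G)

theorem norm_toL1 (a : Wiener w) : ‖toL1 w a‖ = ‖a‖ := rfl

/-- The coefficient of `Xᵏ`. -/
def coeff (k : G) : Wiener w →L[ℝ] ℝ :=
  (w k)⁻¹ • (L1.coord k ∘L (toL1 w : Wiener w →L[ℝ] L1 G))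

theorem coeff_apply (k : G) (a : Wiener w) : coeff k a = (w k)⁻¹ * toL1 w a k := rfl

theorem eq_zero_of_coeff {a : Wiener w} (h : ∀ k, coeff k a = 0) : a = 0 := by
  refine (toL1 w).injective (lp.ext (funext fun k => ?_))
  exact (mul_eq_zero.1 (h k)).resolve_left (inv_ne_zero (w.pos k).ne')

theorem summable_abs_coeff (hw : ∀ k, 1 ≤ w k) (a : Wiener w) :
    Summable fun k => |coeff k a| := by
  refine .of_nonneg_of_le (fun _ => abs_nonneg _) (fun k => ?_)
    (L1.hasSum_abs (toL1 w a)).summable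
  rw [coeff_apply, abs_mul, abs_of_pos (inv_pos.2 (w.pos k))]
  exact mul_le_of_le_one_left (abs_nonneg _) (inv_le_one_of_one_le₀ (hw k))

theorem norm_inv_smul_le {v : F} {C : ℝ} {k : G} (h : ‖v‖ ≤ C * w k) : ‖(w k)⁻¹ • v‖ ≤ C := by
  rwa [norm_smul, norm_inv, Real.norm_of_nonneg (w.pos k).le, inv_mul_le_iff₀ (w.pos k), mul_comm]

variable [DecidableEq G]

/-- The monomial `Xᵏ`. -/
def monomial (w : Weight G) (k : G) : Wiener w := (toL1 w).symm (w k • L1.unit k)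

theorem toL1_symm_unit (k : G) : (toL1 w).symm (L1.unit k) = (w k)⁻¹ • monomial w k := by
  rw [monomial, map_smul, inv_smul_smul₀ (w.pos k).ne']

theorem norm_monomial (k : G) : ‖monomial w k‖ = w k := by
  rw [monomial, ← norm_toL1, ContinuousLinearEquiv.apply_symm_apply, norm_smul, L1.norm_unit,
    mul_one, Real.norm_of_nonneg (w.pos k).le]

theorem coeff_monomial (k l : G) : coeff k (monomial w l) = if k = l then 1 else 0 := by
  have h : coeff k (monomial w l) = (w k)⁻¹ * (w l * (L1.unit l : L1 G) k) := rfl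
  rw [h, L1.unit_apply]
  split_ifs with hkl
  · rw [hkl, mul_one, inv_mul_cancel₀ (w.pos l).ne']
  · rw [mul_zero, mul_zero]

theorem hasSum_apply (T : Wiener w →L[ℝ] F) (a : Wiener w) :
    HasSum (fun k => coeff k a • T (monomial w k)) (T a) := by
  have h := L1.hasSum_apply (T ∘L ((toL1 w).symm : L1 G →L[ℝ] Wiener w)) (toL1 w a)
  simpa only [ContinuousLinearMap.comp_apply, ContinuousLinearEquiv.coe_coe, toL1_symm_unit,
    map_smul, ContinuousLinearEquiv.symm_apply_apply, smul_smul, mul_comm _ (w _)⁻¹,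
    ← coeff_apply] using h

theorem clm_ext {S T : Wiener w →L[ℝ] F} (h : ∀ k, S (monomial w k) = T (monomial w k)) :
    S = T := by
  ext a
  refine (hasSum_apply S a).unique ?_
  simpa only [h] using hasSum_apply T a

theorem norm_apply_le (T : Wiener w →L[ℝ] F) {C : ℝ} (h : ∀ k, ‖T (monomial w k)‖ ≤ C * w k)
    (a : Wiener w) : ‖T a‖ ≤ C * ‖a‖ := by
  refine L1.norm_apply_le (T ∘L ((toL1 w).symm : L1 G →L[ℝ] Wiener w)) (fun k => ?_) (toL1 w a)
  rw [ContinuousLinearMap.comp_apply, ContinuousLinearEquiv.coe_coe, toL1_symm_unit, map_smul]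
  exact norm_inv_smul_le (h k)

/-- The continuous linear map with prescribed values on the monomials. -/
def lift [CompleteSpace F] (v : G → F) (C : ℝ) (hv : ∀ k, ‖v k‖ ≤ C * w k) :
    Wiener w →L[ℝ] F :=
  L1.lift (fun k => (w k)⁻¹ • v k) C (fun k => norm_inv_smul_le (hv k)) ∘L
    (toL1 w : Wiener w →L[ℝ] L1 G)

@[simp]
theorem lift_monomial [CompleteSpace F] {v : G → F} {C : ℝ} (hv : ∀ k, ‖v k‖ ≤ C * w k) (k : G) :
    lift v C hv (monomial w k) = v k := by
  simp [lift, monomial, smul_inv_smul₀ (w.pos k).ne']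

/-- Multiplication as a continuous bilinear map. -/
def mulL (w : Weight G) : Wiener w →L[ℝ] Wiener w →L[ℝ] Wiener w :=
  lift (fun k => lift (fun l => monomial w (k + l)) (w k) fun l => by
      rw [norm_monomial]; exact w.add_le k l) 1 fun k => by
    rw [one_mul]
    refine ContinuousLinearMap.opNorm_le_bound _ (w.pos k).le fun a => ?_
    refine norm_apply_le _ (fun l => ?_) a
    rw [lift_monomial, norm_monomial]
    exact w.add_le k l

@[simp]
theorem mulL_monomial (k l : G) :
    mulL w (monomial w k) (monomial w l) = monomial w (k + l) := by
  simp [mulL]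

theorem norm_mulL_le (a b : Wiener w) : ‖mulL w a b‖ ≤ ‖a‖ * ‖b‖ := by
  have h_monomial (k : G) : ‖mulL w (monomial w k)‖ ≤ w k := by
    refine ContinuousLinearMap.opNorm_le_bound _ (w.pos k).le (norm_apply_le _ fun l => ?_)
    rw [mulL_monomial, norm_monomial]
    exact w.add_le k l
  have h : ‖mulL w a‖ ≤ 1 * ‖a‖ := norm_apply_le _ (fun k => by simpa using h_monomial k) a
  exact (mulL w a).le_of_opNorm_le (by rwa [one_mul] at h) b

theorem mulL_comm (a b : Wiener w) : mulL w a b = mulL w b a := by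
  have h : mulL w = (mulL w).flip :=
    clm_ext fun k => clm_ext fun l => by simp [add_comm]
  exact congr($h a b)

theorem mulL_assoc (a b c : Wiener w) : mulL w (mulL w a b) c = mulL w a (mulL w b c) := by
  have h₁ (k l : G) :
      mulL w (monomial w (k + l)) = mulL w (monomial w k) ∘L mulL w (monomial w l) :=
    clm_ext fun m => by simp [add_assoc]
  have h₂ (k : G) (c : Wiener w) :
      (mulL w).flip c ∘L mulL w (monomial w k) = mulL w (monomial w k) ∘L (mulL w).flip c :=
    clm_ext fun l => by simp [h₁]
  have h₃ : (mulL w).flip c ∘L (mulL w).flip b = (mulL w).flip (mulL w b c) :=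
    clm_ext fun k => by simpa using congr($(h₂ k c) b)
  simpa using congr($h₃ a)

theorem one_mulL (a : Wiener w) : mulL w (monomial w 0) a = a := by
  have h : mulL w (monomial w 0) = ContinuousLinearMap.id ℝ (Wiener w) :=
    clm_ext fun k => by simp
  rw [h, ContinuousLinearMap.id_apply]

instance : NormedCommRing (Wiener w) where
  __ := (inferInstance : NormedAddCommGroup (Wiener w))
  mul a b := mulL w a b
  one := monomial w 0
  left_distrib a b c := map_add (mulL w a) b c
  right_distrib a b c := congr($(map_add (mulL w) a b) c)
  zero_mul a := congr($(map_zero (mulL w)) a)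
  mul_zero a := map_zero (mulL w a)
  mul_assoc := mulL_assoc
  one_mul := one_mulL
  mul_one a := (mulL_comm a _).trans (one_mulL a)
  mul_comm := mulL_comm
  norm_mul_le := norm_mulL_le

theorem mul_def (a b : Wiener w) : a * b = mulL w a b := rfl

theorem one_def : (1 : Wiener w) = monomial w 0 := rfl

theorem monomial_mul_monomial (k l : G) : monomial w k * monomial w l = monomial w (k + l) :=
  mulL_monomial k l

instance : NormedAlgebra ℝ (Wiener w) where
  __ := Algebra.ofModule (R := ℝ) (A := Wiener w)
    (fun c a b => by simp [mul_def]) (fun c a b => by simp [mul_def])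
  norm_smul_le := norm_smul_le

theorem map_mul_of_monomial {R : Type*} [NormedCommRing R] [NormedAlgebra ℝ R]
    (T : Wiener w →L[ℝ] R)
    (h : ∀ k l, T (monomial w (k + l)) = T (monomial w k) * T (monomial w l)) (a b : Wiener w) :
    T (a * b) = T a * T b := by
  have h₁ (k : G) :
      T ∘L mulL w (monomial w k) = ContinuousLinearMap.mul ℝ R (T (monomial w k)) ∘L T :=
    clm_ext fun l => by simp [h]
  have h₂ : T ∘L (mulL w).flip b = (ContinuousLinearMap.mul ℝ R).flip (T b) ∘L T :=
    clm_ext fun k => by simpa [mul_comm] using congr($(h₁ k) b)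
  simpa [mul_def, mul_comm (T a)] using congr($h₂ a)

end Wiener

/-! ### Laurent series and the operators of the vortex sheet equation -/

/-- The pullback of a weight along an additive homomorphism. -/
def Weight.comap {G H : Type*} [AddCommMonoid G] [AddCommMonoid H] (w : Weight H) (f : G →+ H) :
    Weight G where
  toFun k := w (f k)
  pos k := w.pos (f k)
  add_le k l := by rw [map_add]; exact w.add_le _ _

/-- The weight `e^{σ|k|}` on `ℤ`. -/
def expWeight (σ : ℝ≥0) : Weight ℤ where
  toFun k := Real.exp σ ^ k.natAbs
  pos k := by positivity
  add_le k l := by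
    rw [← pow_add]
    exact pow_le_pow_right₀ (Real.one_le_exp σ.2) (Int.natAbs_add_le k l)

/-- The weight `e^{σ|k|}` on pairs `(k, j)`. -/
def expWeight₂ (σ : ℝ≥0) : Weight (ℤ × ℤ) := (expWeight σ).comap (AddMonoidHom.fst ℤ ℤ)

/-- Laurent series in `ξ = ζ²`, where `ζ = e^{iθ}`. For `σ > 0` they are `π`-periodic
functions of `θ` that are analytic in a strip around the real line. -/
abbrev Laurent (σ : ℝ≥0) : Type := Wiener (expWeight σ)

/-- Laurent series in `ξ = ζ²` and `t = w/ζ`, where `ζ = e^{iθ}` and `w = e^{iη}`. -/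
abbrev Laurent₂ (σ : ℝ≥0) : Type := Wiener (expWeight₂ σ)

variable {σ : ℝ≥0}

theorem expWeight_apply (k : ℤ) : expWeight σ k = Real.exp σ ^ k.natAbs := rfl

theorem expWeight₂_apply (k : ℤ × ℤ) : expWeight₂ σ k = Real.exp σ ^ k.1.natAbs := rfl

theorem one_le_expWeight (k : ℤ) : 1 ≤ expWeight σ k := one_le_pow₀ (Real.one_le_exp σ.2)

theorem one_le_expWeight₂ (k : ℤ × ℤ) : 1 ≤ expWeight₂ σ k := one_le_expWeight k.1

/-- The monomial `ξᵏ`. -/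
abbrev ξpow (k : ℤ) : Laurent σ := Wiener.monomial (expWeight σ) k

/-- The monomial `ξᵏ tʲ`. -/
abbrev ξtpow (k j : ℤ) : Laurent₂ σ := Wiener.monomial (expWeight₂ σ) (k, j)

theorem norm_ξpow (k : ℤ) : ‖(ξpow k : Laurent σ)‖ = Real.exp σ ^ k.natAbs :=
  Wiener.norm_monomial k

theorem norm_ξtpow (k j : ℤ) : ‖(ξtpow k j : Laurent₂ σ)‖ = Real.exp σ ^ k.natAbs :=
  Wiener.norm_monomial (k, j)

theorem ξtpow_mul_ξtpow (k j k' j' : ℤ) :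
    (ξtpow k j * ξtpow k' j' : Laurent₂ σ) = ξtpow (k + k') (j + j') :=
  Wiener.monomial_mul_monomial _ _

/-- The even function `ξⁿ + ξ⁻ⁿ = 2 cos(2nθ)`. -/
def evenMode (n : ℕ) : Laurent σ := ξpow n + ξpow (-n)

/-- The odd function `ξⁿ - ξ⁻ⁿ = 2i sin(2nθ)`. -/
def oddMode (n : ℕ) : Laurent σ := ξpow n - ξpow (-n)

theorem norm_evenMode_le (n : ℕ) : ‖(evenMode n : Laurent σ)‖ ≤ 2 * Real.exp σ ^ n := by
  refine (norm_add_le _ _).trans_eq ?_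
  rw [norm_ξpow, norm_ξpow, Int.natAbs_neg, Int.natAbs_natCast, two_mul]

theorem norm_oddMode_le (n : ℕ) : ‖(oddMode n : Laurent σ)‖ ≤ 2 * Real.exp σ ^ n := by
  refine (norm_sub_le _ _).trans_eq ?_
  rw [norm_ξpow, norm_ξpow, Int.natAbs_neg, Int.natAbs_natCast, two_mul]

/-- The divided difference `(r(ζ)ζ - r(w)w)/(ζ - w)` of `r = ξⁿ⁺¹ + ξ⁻ⁿ⁻¹`. -/
def divDiffMode (n : ℕ) : Laurent₂ σ :=
  ∑ j ∈ Finset.range (2 * n + 3), ξtpow (n + 1) j -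
    ∑ j ∈ Finset.range (2 * n + 1), ξtpow (-(n + 1)) (-(j + 1))

theorem norm_divDiffMode_le (n : ℕ) :
    ‖(divDiffMode n : Laurent₂ σ)‖ ≤ (4 * n + 4) * Real.exp σ ^ (n + 1) := by
  have h_pos : ‖∑ j ∈ Finset.range (2 * n + 3), (ξtpow (n + 1) j : Laurent₂ σ)‖ ≤
      (2 * n + 3) * Real.exp σ ^ (n + 1) := by
    refine (norm_sum_le_of_le _ fun j _ => (norm_ξtpow _ _).le).trans ?_
    rw [show (n + 1 : ℤ).natAbs = n + 1 by omega]
    simp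
  have h_neg : ‖∑ j ∈ Finset.range (2 * n + 1), (ξtpow (-(n + 1)) (-(j + 1)) : Laurent₂ σ)‖ ≤
      (2 * n + 1) * Real.exp σ ^ (n + 1) := by
    refine (norm_sum_le_of_le _ fun j _ => (norm_ξtpow _ _).le).trans ?_
    rw [show (-(n + 1) : ℤ).natAbs = n + 1 by omega]
    simp
  refine (norm_sub_le _ _).trans ((add_le_add h_pos h_neg).trans_eq ?_)
  ring

theorem norm_inv_exp_pow_smul_le {E : Type*} [NormedAddCommGroup E] [NormedSpace ℝ E] {x : E}
    {C : ℝ} {n : ℕ} (h : ‖x‖ ≤ C * Real.exp σ ^ n) : ‖(Real.exp σ ^ n)⁻¹ • x‖ ≤ C := by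
  rwa [norm_smul, norm_inv, norm_pow, Real.norm_of_nonneg (Real.exp_nonneg _),
    inv_mul_le_iff₀ (by positivity), mul_comm]

/-- The even series `∑ e^{-σ(k+1)} aₖ (ξᵏ⁺¹ + ξ⁻ᵏ⁻¹)`. -/
def evenSeries : L1 ℕ →L[ℝ] Laurent σ :=
  L1.lift (fun k => (Real.exp σ ^ (k + 1))⁻¹ • evenMode (k + 1)) 2 fun _ =>
    norm_inv_exp_pow_smul_le (norm_evenMode_le _)

/-- The index shift `k ↦ k + 1`. -/
def shift : L1 ℕ →L[ℝ] L1 ℕ :=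
  L1.lift (fun k => L1.unit (k + 1)) 1 fun _ => (L1.norm_unit _).le

/-- The index shift combined with division by `k + 1`. It makes `derivTail` and `divDiffTail`
bounded, so that no derivative is lost. -/
def shiftDiv : L1 ℕ →L[ℝ] L1 ℕ :=
  L1.lift (fun k => (k + 1 : ℝ)⁻¹ • L1.unit (k + 1)) 1 fun k => by
    rw [norm_smul, L1.norm_unit, mul_one, norm_inv, Real.norm_of_nonneg (by positivity)]
    exact inv_le_one_of_one_le₀ (by linarith [k.cast_nonneg (α := ℝ)])

/-- `ζ∂_ζ` of `evenSeries (shiftDiv u)`. -/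
def derivTail : L1 ℕ →L[ℝ] Laurent σ :=
  L1.lift
    (fun k => (Real.exp σ ^ (k + 2))⁻¹ • ((2 * (k + 2) / (k + 1) : ℝ) • oddMode (k + 2))) 8
    fun k => norm_inv_exp_pow_smul_le (by
      have h : (2 * (k + 2) / (k + 1) : ℝ) ≤ 4 := by
        rw [div_le_iff₀ (by positivity)]
        linarith [k.cast_nonneg (α := ℝ)]
      rw [norm_smul, Real.norm_of_nonneg (by positivity)]
      calc (2 * (k + 2) / (k + 1) : ℝ) * ‖oddMode (k + 2)‖ ≤ 4 * (2 * Real.exp σ ^ (k + 2)) := by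
            gcongr
            exact norm_oddMode_le _
        _ = 8 * Real.exp σ ^ (k + 2) := by ring)

/-- The divided difference of `evenSeries (shiftDiv u)`. -/
def divDiffTail : L1 ℕ →L[ℝ] Laurent₂ σ :=
  L1.lift (fun k => (Real.exp σ ^ (k + 2))⁻¹ • ((k + 1 : ℝ)⁻¹ • divDiffMode (k + 1))) 8
    fun k => norm_inv_exp_pow_smul_le (by
      rw [norm_smul, norm_inv, Real.norm_of_nonneg (by positivity), inv_mul_le_iff₀ (by positivity)]
      refine (norm_divDiffMode_le (k + 1)).trans ?_
      rw [← mul_assoc]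
      gcongr
      push_cast
      linarith [k.cast_nonneg (α := ℝ)])

/-- The substitution `f(ζ) ↦ f(w)`. -/
def subst : Laurent σ →L[ℝ] Laurent₂ σ :=
  Wiener.lift (fun k => ξtpow k (2 * k)) 1 fun k => by
    rw [norm_ξtpow, expWeight_apply, one_mul]

/-- The principal value of `(1/2π) ∫ h(ζ, w) ζ/(ζ - w) dη`. -/
def pvCauchy : Laurent₂ σ →L[ℝ] Laurent σ :=
  Wiener.lift (fun k => (if 1 ≤ k.2 then -1 / 2 else 1 / 2 : ℝ) • ξpow k.1) 1 fun k => by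
    rw [norm_smul, norm_ξpow, expWeight₂_apply]
    gcongr
    split_ifs <;> norm_num

theorem evenSeries_unit (k : ℕ) :
    (evenSeries (L1.unit k) : Laurent σ) = (Real.exp σ ^ (k + 1))⁻¹ • evenMode (k + 1) :=
  L1.lift_unit _ _

theorem shift_unit (k : ℕ) : shift (L1.unit k) = L1.unit (k + 1) := L1.lift_unit _ _

theorem shiftDiv_unit (k : ℕ) :
    shiftDiv (L1.unit k) = (k + 1 : ℝ)⁻¹ • (L1.unit (k + 1) : L1 ℕ) := L1.lift_unit _ _

theorem derivTail_unit (k : ℕ) : (derivTail (L1.unit k) : Laurent σ) =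
    (Real.exp σ ^ (k + 2))⁻¹ • ((2 * (k + 2) / (k + 1) : ℝ) • oddMode (k + 2)) :=
  L1.lift_unit _ _

theorem divDiffTail_unit (k : ℕ) : (divDiffTail (L1.unit k) : Laurent₂ σ) =
    (Real.exp σ ^ (k + 2))⁻¹ • ((k + 1 : ℝ)⁻¹ • divDiffMode (k + 1)) := L1.lift_unit _ _

theorem subst_ξpow (k : ℤ) : subst (ξpow k : Laurent σ) = ξtpow k (2 * k) :=
  Wiener.lift_monomial _ _

theorem pvCauchy_ξtpow (k j : ℤ) :
    pvCauchy (ξtpow k j : Laurent₂ σ) = (if 1 ≤ j then -1 / 2 else 1 / 2 : ℝ) • ξpow k :=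
  Wiener.lift_monomial _ (k, j)

theorem pvCauchy_one : pvCauchy (1 : Laurent₂ σ) = (1 / 2 : ℝ) • (1 : Laurent σ) :=
  pvCauchy_ξtpow 0 0

theorem pvCauchy_divDiffMode (n : ℕ) :
    pvCauchy (divDiffMode n : Laurent₂ σ) = -(n + 1 / 2 : ℝ) • evenMode (n + 1) := by
  have h_pos : ∑ j ∈ Finset.range (2 * n + 3), pvCauchy (ξtpow (n + 1) j : Laurent₂ σ) =
      (-(n + 1 / 2) : ℝ) • ξpow (n + 1) := by
    rw [Finset.sum_range_succ']
    simp only [pvCauchy_ξtpow, ← Finset.sum_smul, ← add_smul]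
    congr 1
    rw [Finset.sum_congr rfl (g := fun _ => (-1 / 2 : ℝ)) fun j _ => if_pos (by push_cast; omega)]
    simp
    ring
  have h_neg : ∑ j ∈ Finset.range (2 * n + 1),
      pvCauchy (ξtpow (-(n + 1)) (-(j + 1)) : Laurent₂ σ) = (n + 1 / 2 : ℝ) • ξpow (-(n + 1)) := by
    simp only [pvCauchy_ξtpow, ← Finset.sum_smul]
    congr 1
    rw [Finset.sum_congr rfl (g := fun _ => (1 / 2 : ℝ)) fun j _ => if_neg (by omega)]
    simp
    ring
  rw [divDiffMode, map_sub, map_sum, map_sum, evenMode, h_pos, h_neg]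
  push_cast
  module

theorem pvCauchy_divDiffTail (u : L1 ℕ) : pvCauchy (divDiffTail u : Laurent₂ σ) =
    -(evenSeries (shift u) + (1 / 2 : ℝ) • evenSeries (shiftDiv u)) := by
  have h : pvCauchy ∘L (divDiffTail : L1 ℕ →L[ℝ] Laurent₂ σ) =
      -(evenSeries ∘L shift + (1 / 2 : ℝ) • (evenSeries ∘L shiftDiv)) := by
    refine L1.clm_ext fun k => ?_
    simp only [ContinuousLinearMap.comp_apply, neg_apply, add_apply, smul_apply, divDiffTail_unit,
      shift_unit, shiftDiv_unit, map_smul, evenSeries_unit, pvCauchy_divDiffMode]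
    have : (k + 1 : ℝ) ≠ 0 := by positivity
    push_cast
    match_scalars
    field_simp
  exact congr($h u)

/-! ### The rescaled equation -/

/-- `2 cos 2θ`. -/
def cosTwo : Laurent σ := evenMode 1

/-- The rescaled radial perturbation `r/s = Y (ξ + ξ⁻¹) + s R`, where `R = evenSeries (shiftDiv u)`
has no mode `ξ + ξ⁻¹`. -/
def radius (s Y : ℝ) (u : L1 ℕ) : Laurent σ := Y • cosTwo + s • evenSeries (shiftDiv u)

/-- `ζ∂_ζ` of `radius s Y u`; thus `r' = i s` times it. -/
def radiusDeriv (s Y : ℝ) (u : L1 ℕ) : Laurent σ := (2 * Y) • oddMode 1 + s • derivTail u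

/-- The divided difference `(r(ζ)ζ - r(w)w)/(ζ - w)` of `r = radius s Y u`. -/
def divDiff (s Y : ℝ) (u : L1 ℕ) : Laurent₂ σ := Y • divDiffMode 0 + s • divDiffTail u

/-- The inverse of the divided difference of the curve `ζ(1 + r)`; it is `0` where that divided
difference is not invertible. -/
def divDiffInv (s Y : ℝ) (u : L1 ℕ) : Laurent₂ σ := Ring.inverse (1 + s • divDiff s Y u)

/-- The strength `2 + s + s² G` with `G = evenSeries g`, as a function of the variable of
integration. -/
def strength (s : ℝ) (g : L1 ℕ) : Laurent₂ σ := (2 + s) • 1 + s ^ 2 • subst (evenSeries g)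

/-- The numerator of the Cauchy kernel `ζ/(ζ - w)` in the velocity induced by the sheet. -/
def density (s Y : ℝ) (g u : L1 ℕ) : Laurent₂ σ := strength s g * divDiffInv s Y u

/-- The coefficient of `s²` in the tangential velocity relative to the rotation. -/
def velocityLeading (Y : ℝ) (g u : L1 ℕ) : Laurent σ :=
  (2 : ℝ) • evenSeries (shift u) + (Y / 2) • cosTwo + (2 * Y ^ 2) • pvCauchy (divDiffMode 0 ^ 2)
    + pvCauchy (subst (evenSeries g))

/-- The part of the tangential velocity beyond `s²`, divided by `s³`. -/
def velocityRemainder (s Y : ℝ) (g u : L1 ℕ) : Laurent σ :=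
  evenSeries (shift u) + (1 / 2 : ℝ) • evenSeries (shiftDiv u)
    + (4 * Y) • pvCauchy (divDiffMode 0 * divDiffTail u) + (2 * s) • pvCauchy (divDiffTail u ^ 2)
    + pvCauchy (divDiff s Y u ^ 2)
    - pvCauchy (subst (evenSeries g) * divDiff s Y u * divDiffInv s Y u)
    - (2 + s) • pvCauchy (divDiff s Y u ^ 3 * divDiffInv s Y u)

/-- The rescaled equation at `s = 0`; `ν` comes from the constant `s (1 + s ν)`, which is the mean
value subtracted in `F₂`. -/
def equationLeading (ν Y : ℝ) (g u : L1 ℕ) : Laurent σ :=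
  (4 : ℝ) • evenSeries (shift u) + (4 * Y ^ 2) • pvCauchy (divDiffMode 0 ^ 2)
    + (2 : ℝ) • pvCauchy (subst (evenSeries g)) + (1 / 2 - ν) • (1 : Laurent σ)
    + (2 * Y) • oddMode 1

/-- The terms of positive order in `s` of the rescaled equation, divided by `s`. -/
def equationRemainder (s ν Y : ℝ) (g u : L1 ℕ) : Laurent σ :=
  (2 : ℝ) • velocityRemainder s Y g u + velocityLeading Y g u + (1 / 2 : ℝ) • evenSeries g
    + s • (velocityRemainder s Y g u + evenSeries g * velocityLeading Y g u)
    + s ^ 2 • (evenSeries g * velocityRemainder s Y g u)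
    - (evenSeries (shiftDiv u) - derivTail u) - ν • (radius s Y u - radiusDeriv s Y u)

theorem mul_inverse_expansion {R : Type*} [CommRing R] [Algebra ℝ R] {Q G p : R} {s c : ℝ}
    (hp : (1 + s • Q) * p = 1) : (c • (1 : R) + s ^ 2 • G) * p =
      c • (1 : R) - (s * c) • Q + (s ^ 2 * c) • Q ^ 2 + s ^ 2 • G - (s ^ 3 * c) • (Q ^ 3 * p)
        - s ^ 3 • (G * Q * p) := by
  simp only [Algebra.smul_def, map_mul, map_pow] at hp ⊢
  linear_combination (algebraMap ℝ R c * (1 - algebraMap ℝ R s * Q + (algebraMap ℝ R s * Q) ^ 2) +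
    algebraMap ℝ R s ^ 2 * G) * hp

theorem pvCauchy_divDiff (s Y : ℝ) (u : L1 ℕ) : pvCauchy (divDiff s Y u : Laurent₂ σ) =
    -((Y / 2) • cosTwo + s • evenSeries (shift u) + (s / 2) • evenSeries (shiftDiv u)) := by
  rw [divDiff, map_add, map_smul, map_smul, pvCauchy_divDiffMode, pvCauchy_divDiffTail, cosTwo]
  push_cast
  module

theorem pvCauchy_divDiff_sq (s Y : ℝ) (u : L1 ℕ) : pvCauchy (divDiff s Y u ^ 2 : Laurent₂ σ) =
    Y ^ 2 • pvCauchy (divDiffMode 0 ^ 2) + (2 * s * Y) • pvCauchy (divDiffMode 0 * divDiffTail u) +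
      s ^ 2 • pvCauchy (divDiffTail u ^ 2) := by
  simp only [← map_smul, ← map_add]
  congr 1
  simp only [divDiff, Algebra.smul_def, map_mul, map_pow, map_ofNat]
  ring

theorem velocity_expansion {s Y : ℝ} {g u : L1 ℕ}
    (hu : IsUnit (1 + s • divDiff s Y u : Laurent₂ σ)) :
    pvCauchy (density s Y g u : Laurent₂ σ) = 1 + s • radius s Y u +
      s • ((1 / 2 : ℝ) • 1 + s • velocityLeading Y g u + s ^ 2 • velocityRemainder s Y g u) := by
  have hp : (1 + s • divDiff s Y u : Laurent₂ σ) * divDiffInv s Y u = 1 :=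
    Ring.mul_inverse_cancel _ hu
  rw [density, strength, mul_inverse_expansion hp]
  simp only [map_add, map_sub, map_smul, pvCauchy_one, pvCauchy_divDiff, velocityRemainder,
    velocityLeading, radius]
  rw [pvCauchy_divDiff_sq]
  module

theorem equation_expansion {s ν Y : ℝ} {g u : L1 ℕ}
    (hu : IsUnit (1 + s • divDiff s Y u : Laurent₂ σ)) :
    ((2 + s) • (1 : Laurent σ) + s ^ 2 • evenSeries g) *
        (pvCauchy (density s Y g u) - (1 + s • radius s Y u)) -
      (s * (1 + s * ν)) • (1 + s • radius s Y u - s • radiusDeriv s Y u) =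
    s ^ 2 • (equationLeading ν Y g u + s • equationRemainder s ν Y g u) := by
  have h_leading : (equationLeading ν Y g u : Laurent σ) =
      (2 : ℝ) • velocityLeading Y g u + (1 / 2 - ν) • (1 : Laurent σ) - Y • cosTwo
        + (2 * Y) • oddMode 1 := by
    rw [equationLeading, velocityLeading]
    module
  rw [velocity_expansion hu, h_leading, equationRemainder]
  generalize velocityLeading Y g u = M₁
  generalize velocityRemainder s Y g u = M₂
  rw [radius, radiusDeriv]
  generalize evenSeries (shiftDiv u) = R
  generalize evenSeries g = G
  generalize derivTail u = D
  simp only [Algebra.smul_def, map_mul, map_pow, map_add, map_sub, map_ofNat, map_one]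
  have h_half : algebraMap ℝ (Laurent σ) (1 / 2) * 2 = 1 := by
    rw [← map_ofNat (algebraMap ℝ (Laurent σ)) 2, ← map_mul]
    norm_num
  linear_combination algebraMap ℝ (Laurent σ) s * h_half

/-! ### Even and odd parts of a series -/

open Wiener (coeff)

theorem coeff_ξpow (k l : ℤ) : coeff k (ξpow l : Laurent σ) = if k = l then (1 : ℝ) else 0 :=
  Wiener.coeff_monomial k l

/-- The sum of the coefficients of `ξ` and `ξ⁻¹`. -/
def evenCoeffOne : Laurent σ →L[ℝ] ℝ := coeff 1 + coeff (-1)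

/-- The odd part, in normalized coordinates. -/
def oddPart : Laurent σ →L[ℝ] L1 ℕ :=
  Wiener.lift (fun k => (k.sign * Real.exp σ ^ k.natAbs : ℝ) • L1.unit (k.natAbs - 1)) 1
    fun k => by
      rw [norm_smul, L1.norm_unit, mul_one, norm_mul, expWeight_apply, norm_pow,
        Real.norm_of_nonneg (Real.exp_nonneg _)]
      gcongr
      rcases lt_trichotomy k 0 with h | h | h
      · simp [Int.sign_eq_neg_one_of_neg h]
      · simp [h]
      · simp [Int.sign_eq_one_of_pos h]

/-- The even part without the modes `0` and `±1`, in normalized coordinates. -/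
def evenTail : Laurent σ →L[ℝ] L1 ℕ :=
  Wiener.lift
    (fun k => (if 2 ≤ k.natAbs then Real.exp σ ^ k.natAbs else 0 : ℝ) • L1.unit (k.natAbs - 2)) 1
    fun k => by
      rw [norm_smul, L1.norm_unit, mul_one, expWeight_apply]
      split_ifs <;> simp [Real.exp_nonneg]

theorem oddPart_ξpow (k : ℤ) : oddPart (ξpow k : Laurent σ) =
    (k.sign * Real.exp σ ^ k.natAbs : ℝ) • L1.unit (k.natAbs - 1) := Wiener.lift_monomial _ _

theorem evenTail_ξpow (k : ℤ) : evenTail (ξpow k : Laurent σ) =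
    (if 2 ≤ k.natAbs then Real.exp σ ^ k.natAbs else 0 : ℝ) • L1.unit (k.natAbs - 2) :=
  Wiener.lift_monomial _ _

theorem oddPart_apply (a : Laurent σ) (n : ℕ) :
    oddPart a n = Real.exp σ ^ (n + 1) * (coeff (n + 1 : ℤ) a - coeff (-(n + 1) : ℤ) a) := by
  have h : L1.coord n ∘L (oddPart : Laurent σ →L[ℝ] L1 ℕ) =
      (Real.exp σ ^ (n + 1) : ℝ) • (coeff (n + 1 : ℤ) - coeff (-(n + 1) : ℤ)) := by
    refine Wiener.clm_ext fun k => ?_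
    change L1.coord n (oddPart (ξpow k)) = (Real.exp σ ^ (n + 1) : ℝ) *
      (coeff (n + 1 : ℤ) (ξpow k : Laurent σ) - coeff (-(n + 1) : ℤ) (ξpow k : Laurent σ))
    rw [oddPart_ξpow, map_smul, L1.coord_apply, L1.unit_apply, coeff_ξpow, coeff_ξpow, smul_eq_mul]
    rcases lt_trichotomy k 0 with h | rfl | h
    · rw [Int.sign_eq_neg_one_of_neg h, if_neg (show ¬ (n + 1 : ℤ) = k by omega)]
      by_cases h' : (-(n + 1) : ℤ) = k
      · rw [if_pos h', if_pos (by omega), show k.natAbs = n + 1 by omega]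
        simp
      · rw [if_neg h', if_neg (by omega)]
        simp
    · rw [if_neg (show ¬ (n + 1 : ℤ) = 0 by omega), if_neg (show ¬ (-(n + 1) : ℤ) = 0 by omega)]
      simp
    · rw [Int.sign_eq_one_of_pos h, if_neg (show ¬ (-(n + 1) : ℤ) = k by omega)]
      by_cases h' : (n + 1 : ℤ) = k
      · rw [if_pos h', if_pos (by omega), show k.natAbs = n + 1 by omega]
        simp
      · rw [if_neg h', if_neg (by omega)]
        simp
  exact congr($h a)

theorem evenTail_apply (a : Laurent σ) (n : ℕ) :
    evenTail a n = Real.exp σ ^ (n + 2) * (coeff (n + 2 : ℤ) a + coeff (-(n + 2) : ℤ) a) := by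
  have h : L1.coord n ∘L (evenTail : Laurent σ →L[ℝ] L1 ℕ) =
      (Real.exp σ ^ (n + 2) : ℝ) • (coeff (n + 2 : ℤ) + coeff (-(n + 2) : ℤ)) := by
    refine Wiener.clm_ext fun k => ?_
    change L1.coord n (evenTail (ξpow k)) = (Real.exp σ ^ (n + 2) : ℝ) *
      (coeff (n + 2 : ℤ) (ξpow k : Laurent σ) + coeff (-(n + 2) : ℤ) (ξpow k : Laurent σ))
    rw [evenTail_ξpow, map_smul, L1.coord_apply, L1.unit_apply, coeff_ξpow, coeff_ξpow,
      smul_eq_mul]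
    by_cases h₁ : k.natAbs = n + 2
    · obtain h₂ | h₂ : k = n + 2 ∨ k = -(n + 2) := by omega
      · rw [h₁, if_pos (by omega), if_pos (by omega), if_pos h₂.symm, if_neg (by omega)]
        simp
      · rw [h₁, if_pos (by omega), if_pos (by omega), if_neg (by omega), if_pos h₂.symm]
        simp
    · rw [if_neg (show ¬ (n + 2 : ℤ) = k by omega), if_neg (show ¬ (-(n + 2) : ℤ) = k by omega)]
      by_cases h₂ : 2 ≤ k.natAbs
      · rw [if_neg (show ¬ n = k.natAbs - 2 by omega)]
        simp
      · simp [h₂]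
  exact congr($h a)

theorem eq_zero_of_parts {a : Laurent σ} (h₀ : coeff 0 a = 0) (h₁ : evenCoeffOne a = 0)
    (h_odd : oddPart a = 0) (h_tail : evenTail a = 0) : a = 0 := by
  have h_sub (n : ℕ) : coeff (n + 1 : ℤ) a = coeff (-(n + 1) : ℤ) a := by
    have h := oddPart_apply a n
    rw [h_odd] at h
    simpa [sub_eq_zero] using h.symm
  have h_add (n : ℕ) : coeff (n + 1 : ℤ) a + coeff (-(n + 1) : ℤ) a = 0 := by
    rcases n with _ | n
    · simpa [evenCoeffOne] using h₁
    · have h := evenTail_apply a n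
      rw [h_tail] at h
      have h' : coeff (n + 2 : ℤ) a + coeff (-(n + 2) : ℤ) a = 0 := by simpa using h.symm
      push_cast
      rwa [show (n + 1 + 1 : ℤ) = n + 2 by ring]
  refine Wiener.eq_zero_of_coeff fun k => ?_
  rcases lt_trichotomy k 0 with h | rfl | h
  · obtain ⟨n, rfl⟩ : ∃ n : ℕ, k = -(n + 1 : ℤ) := ⟨k.natAbs - 1, by omega⟩
    linarith [h_sub n, h_add n]
  · exact h₀
  · obtain ⟨n, rfl⟩ : ∃ n : ℕ, k = (n + 1 : ℤ) := ⟨k.natAbs - 1, by omega⟩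
    linarith [h_sub n, h_add n]

theorem oddPart_oddMode (n : ℕ) : oddPart (oddMode (n + 1) : Laurent σ) =
    (2 * Real.exp σ ^ (n + 1) : ℝ) • (L1.unit n : L1 ℕ) := by
  rw [oddMode, map_sub, oddPart_ξpow, oddPart_ξpow, Int.sign_neg,
    Int.sign_eq_one_of_pos (by positivity), Int.natAbs_neg, Int.natAbs_natCast]
  simp only [Nat.add_sub_cancel]
  push_cast
  module

theorem oddPart_evenMode (n : ℕ) : oddPart (evenMode n : Laurent σ) = 0 := by
  rw [evenMode, map_add, oddPart_ξpow, oddPart_ξpow, Int.sign_neg, Int.natAbs_neg]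
  push_cast
  module

theorem evenTail_oddMode (n : ℕ) : evenTail (oddMode n : Laurent σ) = 0 := by
  rw [oddMode, map_sub, evenTail_ξpow, evenTail_ξpow, Int.natAbs_neg, sub_self]

theorem evenTail_evenMode (n : ℕ) : evenTail (evenMode (n + 2) : Laurent σ) =
    (2 * Real.exp σ ^ (n + 2) : ℝ) • (L1.unit n : L1 ℕ) := by
  rw [evenMode, map_add, evenTail_ξpow, evenTail_ξpow, Int.natAbs_neg, Int.natAbs_natCast,
    if_pos (by omega), Nat.add_sub_cancel]
  module

theorem coeff_neg_oddMode (k : ℤ) (n : ℕ) :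
    coeff (-k) (oddMode n : Laurent σ) = -coeff k (oddMode n : Laurent σ) := by
  simp only [oddMode, map_sub, coeff_ξpow, neg_sub, neg_inj,
    neg_eq_iff_eq_neg (b := (n : ℤ))]

theorem evenCoeffOne_oddMode (n : ℕ) : evenCoeffOne (oddMode n : Laurent σ) = 0 := by
  rw [evenCoeffOne, add_apply, coeff_neg_oddMode, add_neg_cancel]

theorem coeff_zero_oddMode (n : ℕ) : coeff 0 (oddMode n : Laurent σ) = 0 := by
  have h := coeff_neg_oddMode (σ := σ) 0 n
  rw [neg_zero] at h
  linarith

theorem coeff_zero_evenMode (n : ℕ) : coeff 0 (evenMode (n + 1) : Laurent σ) = 0 := by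
  rw [evenMode, map_add, coeff_ξpow, coeff_ξpow, if_neg (by omega), if_neg (by omega), add_zero]

theorem coeff_zero_evenSeries (a : L1 ℕ) : coeff 0 (evenSeries a : Laurent σ) = 0 := by
  have h : (coeff 0 : Laurent σ →L[ℝ] ℝ) ∘L evenSeries = 0 := L1.clm_ext fun k => by
    simp [evenSeries_unit, coeff_zero_evenMode]
  exact congr($h a)

theorem evenCoeffOne_evenSeries (a : L1 ℕ) :
    evenCoeffOne (evenSeries a : Laurent σ) = 2 * (Real.exp σ)⁻¹ * a 0 := by
  have h : (evenCoeffOne : Laurent σ →L[ℝ] ℝ) ∘L evenSeries =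
      (2 * (Real.exp σ)⁻¹) • L1.coord 0 := by
    refine L1.clm_ext fun k => ?_
    simp only [ContinuousLinearMap.comp_apply, evenSeries_unit, map_smul, evenCoeffOne, evenMode,
      add_apply, map_add, coeff_ξpow, L1.coord_apply, L1.unit_apply, smul_apply, smul_eq_mul]
    rcases k with _ | k
    · norm_num
      ring
    · rw [if_neg (by omega), if_neg (by omega), if_neg (by omega), if_neg (by omega),
        if_neg (by omega)]
      simp
  exact congr($h a)

theorem oddPart_evenSeries (a : L1 ℕ) : oddPart (evenSeries a : Laurent σ) = 0 := by
  have h : (oddPart : Laurent σ →L[ℝ] L1 ℕ) ∘L evenSeries = 0 := L1.clm_ext fun k => by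
    simp [evenSeries_unit, oddPart_evenMode]
  exact congr($h a)

theorem shift_apply_zero (u : L1 ℕ) : shift u 0 = 0 := by
  have h : L1.coord 0 ∘L shift = 0 := L1.clm_ext fun k => by
    rw [ContinuousLinearMap.comp_apply, shift_unit, L1.coord_apply, L1.unit_apply]
    simp
  exact congr($h u)

theorem shiftDiv_apply_zero (u : L1 ℕ) : shiftDiv u 0 = 0 := by
  have h : L1.coord 0 ∘L shiftDiv = 0 := L1.clm_ext fun k => by
    rw [ContinuousLinearMap.comp_apply, shiftDiv_unit, map_smul, L1.coord_apply, L1.unit_apply]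
    simp
  exact congr($h u)

theorem evenTail_evenSeries_shift (u : L1 ℕ) :
    evenTail (evenSeries (shift u) : Laurent σ) = (2 : ℝ) • u := by
  have h : (evenTail : Laurent σ →L[ℝ] L1 ℕ) ∘L evenSeries ∘L shift =
      (2 : ℝ) • ContinuousLinearMap.id ℝ (L1 ℕ) := L1.clm_ext fun k => by
    simp only [ContinuousLinearMap.comp_apply, shift_unit, evenSeries_unit, map_smul,
      evenTail_evenMode, smul_apply, ContinuousLinearMap.id_apply, smul_smul]
    congr 1
    field_simp
  exact congr($h u)

theorem evenCoeffOne_derivTail (u : L1 ℕ) : evenCoeffOne (derivTail u : Laurent σ) = 0 := by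
  have h : (evenCoeffOne : Laurent σ →L[ℝ] ℝ) ∘L derivTail = 0 := L1.clm_ext fun k => by
    simp [derivTail_unit, evenCoeffOne_oddMode]
  exact congr($h u)

/-! ### The rescaled equation at `s = 0` -/

theorem divDiffMode_zero :
    (divDiffMode 0 : Laurent₂ σ) = ξtpow 1 0 + ξtpow 1 1 + ξtpow 1 2 - ξtpow (-1) (-1) := by
  simp [divDiffMode, Finset.sum_range_succ]

theorem divDiffMode_one : (divDiffMode 1 : Laurent₂ σ) =
    ξtpow 2 0 + ξtpow 2 1 + ξtpow 2 2 + ξtpow 2 3 + ξtpow 2 4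
      - (ξtpow (-2) (-1) + ξtpow (-2) (-2) + ξtpow (-2) (-3)) := by
  simp [divDiffMode, Finset.sum_range_succ]

theorem pvCauchy_divDiffMode_zero_sq : pvCauchy (divDiffMode 0 ^ 2 : Laurent₂ σ) =
    (-7 / 2 : ℝ) • ξpow 2 - (1 : Laurent σ) + (1 / 2 : ℝ) • ξpow (-2) := by
  rw [Wiener.one_def, divDiffMode_zero, pow_two]
  simp only [mul_add, add_mul, mul_sub, sub_mul, ξtpow_mul_ξtpow, map_add, map_sub, pvCauchy_ξtpow]
  norm_num
  module

theorem pvCauchy_subst_evenSeries_unit (k : ℕ) :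
    pvCauchy (subst (evenSeries (L1.unit k) : Laurent σ)) =
      -((1 / 2 : ℝ) • (Real.exp σ ^ (k + 1))⁻¹ • oddMode (k + 1)) := by
  rw [evenSeries_unit, map_smul, map_smul, evenMode, map_add, map_add, subst_ξpow, subst_ξpow,
    pvCauchy_ξtpow, pvCauchy_ξtpow, if_pos (by push_cast; omega), if_neg (by push_cast; omega),
    oddMode]
  module

theorem coeff_zero_pvCauchy_subst (g : L1 ℕ) :
    coeff 0 (pvCauchy (subst (evenSeries g : Laurent σ))) = 0 := by
  have h : (coeff 0 : Laurent σ →L[ℝ] ℝ) ∘L pvCauchy ∘L subst ∘L evenSeries = 0 :=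
    L1.clm_ext fun k => by simp [pvCauchy_subst_evenSeries_unit, coeff_zero_oddMode]
  exact congr($h g)

theorem evenCoeffOne_pvCauchy_subst (g : L1 ℕ) :
    evenCoeffOne (pvCauchy (subst (evenSeries g : Laurent σ))) = 0 := by
  have h : (evenCoeffOne : Laurent σ →L[ℝ] ℝ) ∘L pvCauchy ∘L subst ∘L evenSeries = 0 :=
    L1.clm_ext fun k => by simp [pvCauchy_subst_evenSeries_unit, evenCoeffOne_oddMode]
  exact congr($h g)

theorem evenTail_pvCauchy_subst (g : L1 ℕ) :
    evenTail (pvCauchy (subst (evenSeries g : Laurent σ))) = 0 := by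
  have h : (evenTail : Laurent σ →L[ℝ] L1 ℕ) ∘L pvCauchy ∘L subst ∘L evenSeries = 0 :=
    L1.clm_ext fun k => by simp [pvCauchy_subst_evenSeries_unit, evenTail_oddMode]
  exact congr($h g)

theorem oddPart_pvCauchy_subst (g : L1 ℕ) :
    oddPart (pvCauchy (subst (evenSeries g : Laurent σ))) = -g := by
  have h : (oddPart : Laurent σ →L[ℝ] L1 ℕ) ∘L pvCauchy ∘L subst ∘L evenSeries =
      -ContinuousLinearMap.id ℝ (L1 ℕ) := L1.clm_ext fun k => by
    simp only [ContinuousLinearMap.comp_apply, pvCauchy_subst_evenSeries_unit, map_neg, map_smul,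
      oddPart_oddMode, neg_apply, ContinuousLinearMap.id_apply, smul_smul]
    rw [show 1 / 2 * (Real.exp σ ^ (k + 1))⁻¹ * (2 * Real.exp σ ^ (k + 1)) = 1 by field_simp,
      one_smul]
  exact congr($h g)

theorem coeff_zero_equationLeading (ν Y : ℝ) (g u : L1 ℕ) :
    coeff 0 (equationLeading ν Y g u : Laurent σ) = 1 / 2 - ν - 4 * Y ^ 2 := by
  simp only [equationLeading, map_add, map_smul, coeff_zero_evenSeries, coeff_zero_pvCauchy_subst,
    coeff_zero_oddMode, pvCauchy_divDiffMode_zero_sq, map_sub, Wiener.one_def, coeff_ξpow]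
  norm_num
  ring

theorem evenCoeffOne_equationLeading (ν Y : ℝ) (g u : L1 ℕ) :
    evenCoeffOne (equationLeading ν Y g u : Laurent σ) = 0 := by
  simp only [equationLeading, map_add, map_smul, evenCoeffOne_evenSeries, shift_apply_zero,
    evenCoeffOne_pvCauchy_subst, evenCoeffOne_oddMode, pvCauchy_divDiffMode_zero_sq, map_sub,
    Wiener.one_def]
  simp [evenCoeffOne, coeff_ξpow]

theorem oddPart_equationLeading (ν Y : ℝ) (g u : L1 ℕ) :
    oddPart (equationLeading ν Y g u : Laurent σ) = -((2 : ℝ) • g)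
      + (4 * Real.exp σ * Y) • (L1.unit 0 : L1 ℕ) - (16 * (Real.exp σ * Y) ^ 2) • L1.unit 1 := by
  simp only [equationLeading, map_add, map_smul, oddPart_evenSeries, oddPart_pvCauchy_subst,
    oddPart_oddMode, pvCauchy_divDiffMode_zero_sq, map_sub, Wiener.one_def, oddPart_ξpow,
    Int.sign_neg, show Int.sign 2 = 1 from rfl]
  norm_num
  module

theorem evenTail_equationLeading (ν Y : ℝ) (g u : L1 ℕ) :
    evenTail (equationLeading ν Y g u : Laurent σ) =
      (8 : ℝ) • u - (12 * (Real.exp σ * Y) ^ 2) • (L1.unit 0 : L1 ℕ) := by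
  simp only [equationLeading, map_add, map_smul, evenTail_evenSeries_shift,
    evenTail_pvCauchy_subst, evenTail_oddMode, pvCauchy_divDiffMode_zero_sq, map_sub,
    Wiener.one_def, evenTail_ξpow]
  norm_num
  module

theorem evenCoeffOne_pvCauchy_ξtpow (k j : ℤ) :
    evenCoeffOne (pvCauchy (ξtpow k j : Laurent₂ σ)) =
      (if 1 ≤ j then -1 / 2 else 1 / 2) * (if k = 1 ∨ k = -1 then 1 else 0) := by
  rw [pvCauchy_ξtpow, map_smul, evenCoeffOne, add_apply, coeff_ξpow, coeff_ξpow, smul_eq_mul]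
  congr 1
  split_ifs <;> first | omega | norm_num

theorem evenCoeffOne_pvCauchy_ξtpow_mul_divDiffMode {k j : ℤ} (hk : k = 1 ∨ k = -1) {n : ℕ}
    (hn : 2 ≤ n) : evenCoeffOne (pvCauchy (ξtpow k j * divDiffMode n : Laurent₂ σ)) = 0 := by
  rw [divDiffMode, mul_sub, Finset.mul_sum, Finset.mul_sum, map_sub, map_sub, map_sum, map_sum,
    map_sum, map_sum, Finset.sum_eq_zero, Finset.sum_eq_zero, sub_zero]
  all_goals
    intro i _
    rw [ξtpow_mul_ξtpow, evenCoeffOne_pvCauchy_ξtpow, if_neg (show ¬ (_ ∨ _) by omega), mul_zero]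

theorem evenCoeffOne_pvCauchy_divDiffMode_mul_divDiffTail (u : L1 ℕ) :
    evenCoeffOne (pvCauchy (divDiffMode 0 * divDiffTail u : Laurent₂ σ)) =
      -3 * (Real.exp σ ^ 2)⁻¹ * u 0 := by
  have h : (evenCoeffOne : Laurent σ →L[ℝ] ℝ) ∘L pvCauchy ∘L
      ContinuousLinearMap.mul ℝ (Laurent₂ σ) (divDiffMode 0) ∘L divDiffTail =
      (-3 * (Real.exp σ ^ 2)⁻¹) • L1.coord 0 := by
    refine L1.clm_ext fun k => ?_
    simp only [ContinuousLinearMap.comp_apply, divDiffTail_unit, map_smul, smul_apply,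
      L1.coord_apply, L1.unit_apply, ContinuousLinearMap.mul_apply']
    rcases k with _ | k
    · rw [divDiffMode_zero, zero_add, divDiffMode_one]
      simp only [mul_add, add_mul, mul_sub, sub_mul, ξtpow_mul_ξtpow, map_add, map_sub,
        evenCoeffOne_pvCauchy_ξtpow]
      norm_num
      ring
    · have h_mode {i j : ℤ} (hi : i = 1 ∨ i = -1) :
          evenCoeffOne (pvCauchy (ξtpow i j * divDiffMode (k + 1 + 1) : Laurent₂ σ)) = 0 :=
        evenCoeffOne_pvCauchy_ξtpow_mul_divDiffMode hi (by omega)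
      rw [divDiffMode_zero, sub_mul, add_mul, add_mul]
      simp only [map_sub, map_add, h_mode (Or.inl rfl), h_mode (Or.inr rfl)]
      simp
  exact congr($h u)

theorem evenCoeffOne_pvCauchy_subst_mul_divDiffMode (g : L1 ℕ) :
    evenCoeffOne (pvCauchy (subst (evenSeries g : Laurent σ) * divDiffMode 0)) =
      2 * (Real.exp σ ^ 2)⁻¹ * g 1 := by
  have h : (evenCoeffOne : Laurent σ →L[ℝ] ℝ) ∘L pvCauchy ∘L
      (ContinuousLinearMap.mul ℝ (Laurent₂ σ)).flip (divDiffMode 0) ∘L subst ∘L evenSeries =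
      (2 * (Real.exp σ ^ 2)⁻¹) • L1.coord 1 := by
    refine L1.clm_ext fun k => ?_
    simp only [ContinuousLinearMap.comp_apply, evenSeries_unit, map_smul, smul_apply,
      L1.coord_apply, L1.unit_apply, ContinuousLinearMap.mul_apply',
      ContinuousLinearMap.flip_apply, evenMode, map_add, subst_ξpow, divDiffMode_zero]
    simp only [mul_add, mul_sub, ξtpow_mul_ξtpow, map_add, map_sub, evenCoeffOne_pvCauchy_ξtpow]
    rcases k with _ | _ | k
    · norm_num
    · norm_num
      ring
    · have h_pos (a : ℤ) (ha : a = 1 ∨ a = -1) :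
          (if ((k + 1 + 1 + 1 : ℕ) : ℤ) + a = 1 ∨ ((k + 1 + 1 + 1 : ℕ) : ℤ) + a = -1
            then (1 : ℝ) else 0) = 0 := if_neg (by omega)
      have h_neg (a : ℤ) (ha : a = 1 ∨ a = -1) :
          (if -((k + 1 + 1 + 1 : ℕ) : ℤ) + a = 1 ∨ -((k + 1 + 1 + 1 : ℕ) : ℤ) + a = -1
            then (1 : ℝ) else 0) = 0 := if_neg (by omega)
      rw [h_pos 1 (by simp), h_pos (-1) (by simp), h_neg 1 (by simp), h_neg (-1) (by simp)]
      simp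
  exact congr($h g)

theorem evenCoeffOne_pvCauchy_divDiffMode_cube :
    evenCoeffOne (pvCauchy (divDiffMode 0 ^ 3 : Laurent₂ σ)) = 9 := by
  rw [divDiffMode_zero, pow_three]
  simp only [mul_add, add_mul, mul_sub, sub_mul, ξtpow_mul_ξtpow, map_add, map_sub,
    evenCoeffOne_pvCauchy_ξtpow]
  norm_num

theorem evenCoeffOne_equationRemainder_zero (ν Y : ℝ) (g u : L1 ℕ) :
    evenCoeffOne (equationRemainder 0 ν Y g u : Laurent σ) =
      -24 * (Real.exp σ ^ 2)⁻¹ * Y * u 0 - 4 * (Real.exp σ ^ 2)⁻¹ * Y * g 1 - 36 * Y ^ 3 + Y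
        + (Real.exp σ)⁻¹ * g 0 - 2 * ν * Y := by
  have h_cosTwo : evenCoeffOne (cosTwo : Laurent σ) = 2 := by
    simp [evenCoeffOne, cosTwo, evenMode, coeff_ξpow]
    norm_num
  have h_sq : evenCoeffOne (pvCauchy (divDiffMode 0 ^ 2 : Laurent₂ σ)) = 0 := by
    rw [pvCauchy_divDiffMode_zero_sq, Wiener.one_def]
    simp [evenCoeffOne, coeff_ξpow]
  have h_inv : (divDiffInv 0 Y u : Laurent₂ σ) = 1 := by simp [divDiffInv]
  have h_divDiff : (divDiff 0 Y u : Laurent₂ σ) = Y • divDiffMode 0 := by simp [divDiff]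
  simp only [equationRemainder, velocityRemainder, velocityLeading, radius, radiusDeriv, h_inv,
    h_divDiff, mul_one, zero_smul, smul_pow, mul_smul_comm, map_add, map_sub, map_smul,
    evenCoeffOne_evenSeries, shift_apply_zero, shiftDiv_apply_zero,
    evenCoeffOne_pvCauchy_divDiffMode_mul_divDiffTail, evenCoeffOne_pvCauchy_subst_mul_divDiffMode,
    evenCoeffOne_pvCauchy_divDiffMode_cube, evenCoeffOne_pvCauchy_subst, evenCoeffOne_derivTail,
    evenCoeffOne_oddMode, h_cosTwo, h_sq, smul_eq_mul, mul_zero, map_zero, zero_pow, ne_eq,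
    OfNat.ofNat_ne_zero, not_false_eq_true]
  ring

/-! ### The implicit function theorem -/

/-- The unknowns `(ν, Y, g, u)` of the rescaled equation. -/
abbrev Unknown : Type := ℝ × ℝ × L1 ℕ × L1 ℕ

/-- The rescaled equation in coordinates. Since the `cos 2θ` mode of the leading part vanishes, this
mode is divided by `s` once more. -/
def rescaled (σ : ℝ≥0) (x : ℝ × Unknown) : Unknown :=
  let L : Laurent σ := equationLeading x.2.1 x.2.2.1 x.2.2.2.1 x.2.2.2.2
  let R := equationRemainder x.1 x.2.1 x.2.2.1 x.2.2.2.1 x.2.2.2.2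
  (coeff 0 (L + x.1 • R), evenCoeffOne R, oddPart (L + x.1 • R), evenTail (L + x.1 • R))

theorem equationLeading_add_equationRemainder_eq_zero {s ν Y : ℝ} {g u : L1 ℕ}
    (h : rescaled σ (s, ν, Y, g, u) = 0) :
    (equationLeading ν Y g u + s • equationRemainder s ν Y g u : Laurent σ) = 0 := by
  simp only [rescaled, Prod.mk_eq_zero] at h
  obtain ⟨h₀, h₁, h_odd, h_tail⟩ := h
  refine eq_zero_of_parts h₀ ?_ h_odd h_tail
  rw [map_add, map_smul, h₁, evenCoeffOne_equationLeading, smul_zero, add_zero]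

theorem rescaled_zero (ν Y : ℝ) (g u : L1 ℕ) : rescaled σ (0, ν, Y, g, u) =
    (1 / 2 - ν - 4 * Y ^ 2,
      -24 * (Real.exp σ ^ 2)⁻¹ * Y * u 0 - 4 * (Real.exp σ ^ 2)⁻¹ * Y * g 1 - 36 * Y ^ 3 + Y
        + (Real.exp σ)⁻¹ * g 0 - 2 * ν * Y,
      -((2 : ℝ) • g) + (4 * Real.exp σ * Y) • (L1.unit 0 : L1 ℕ)
        - (16 * (Real.exp σ * Y) ^ 2) • L1.unit 1,
      (8 : ℝ) • u - (12 * (Real.exp σ * Y) ^ 2) • L1.unit 0) := by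
  simp only [rescaled, zero_smul, add_zero, coeff_zero_equationLeading,
    evenCoeffOne_equationRemainder_zero, oddPart_equationLeading, evenTail_equationLeading]

theorem contDiffAt_rescaled (U : Unknown) : ContDiffAt ℝ 1 (rescaled σ) (0, U) := by
  have h_inv : ContDiffAt ℝ 1
      (fun x : ℝ × Unknown => (divDiffInv x.1 x.2.2.1 x.2.2.2.2 : Laurent₂ σ)) (0, U) := by
    refine ContDiffAt.comp (g := Ring.inverse) (0, U) ?_ ?_
    · simpa using contDiffAt_ringInverse ℝ (1 : (Laurent₂ σ)ˣ)
    · unfold divDiff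
      fun_prop
  have h_divDiff : ContDiffAt ℝ 1
      (fun x : ℝ × Unknown => (divDiff x.1 x.2.2.1 x.2.2.2.2 : Laurent₂ σ)) (0, U) := by
    unfold divDiff
    fun_prop
  have h_leading : ContDiffAt ℝ 1 (fun x : ℝ × Unknown =>
      (equationLeading x.2.1 x.2.2.1 x.2.2.2.1 x.2.2.2.2 : Laurent σ)) (0, U) := by
    unfold equationLeading
    fun_prop
  have h_velocityLeading : ContDiffAt ℝ 1 (fun x : ℝ × Unknown =>
      (velocityLeading x.2.2.1 x.2.2.2.1 x.2.2.2.2 : Laurent σ)) (0, U) := by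
    unfold velocityLeading
    fun_prop
  have h_velocityRemainder : ContDiffAt ℝ 1 (fun x : ℝ × Unknown =>
      (velocityRemainder x.1 x.2.2.1 x.2.2.2.1 x.2.2.2.2 : Laurent σ)) (0, U) := by
    unfold velocityRemainder
    fun_prop
  have h_remainder : ContDiffAt ℝ 1 (fun x : ℝ × Unknown =>
      (equationRemainder x.1 x.2.1 x.2.2.1 x.2.2.2.1 x.2.2.2.2 : Laurent σ)) (0, U) := by
    unfold equationRemainder radius radiusDeriv
    fun_prop
  have h_sum := h_leading.add (contDiffAt_fst.smul h_remainder)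
  exact ((coeff 0).contDiff.contDiffAt.comp _ h_sum).prodMk
    ((evenCoeffOne.contDiff.contDiffAt.comp _ h_remainder).prodMk
      ((oddPart.contDiff.contDiffAt.comp _ h_sum).prodMk
        (evenTail.contDiff.contDiffAt.comp _ h_sum)))

/-- The point from which the branch with slope `2Y` emanates. -/
def basePoint (σ : ℝ≥0) (Y : ℝ) : Unknown :=
  (1 / 4, Y, (2 * Real.exp σ * Y) • (L1.unit 0 : L1 ℕ) - (Real.exp σ ^ 2 / 2) • L1.unit 1,
    (3 / 32 * Real.exp σ ^ 2) • L1.unit 0)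

theorem rescaled_basePoint {Y : ℝ} (hY : 16 * Y ^ 2 = 1) :
    rescaled σ (0, basePoint σ Y) = 0 := by
  have h_sq : Y ^ 2 = 1 / 16 := by linarith
  have h_cube : Y ^ 3 = Y / 16 := by rw [pow_succ, h_sq]; ring
  rw [basePoint, rescaled_zero]
  simp only [Prod.mk_eq_zero, mul_pow, h_sq, h_cube]
  refine ⟨by norm_num, ?_, by module, by module⟩
  simp only [lp.coeFn_sub, Pi.sub_apply, lp.coeFn_smul, Pi.smul_apply, smul_eq_mul, L1.unit_apply]
  norm_num
  field_simp
  ring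

theorem hasDerivAt_rescaled_zero {ν Y : ℝ → ℝ} {g u : ℝ → L1 ℕ} {t n y : ℝ} {g' u' : L1 ℕ}
    (hν : HasDerivAt ν n t) (hY : HasDerivAt Y y t) (hg : HasDerivAt g g' t)
    (hu : HasDerivAt u u' t) :
    HasDerivAt (fun t => rescaled σ (0, ν t, Y t, g t, u t))
      (-n - 8 * Y t * y,
        -24 * (Real.exp σ ^ 2)⁻¹ * (y * u t 0 + Y t * u' 0)
          - 4 * (Real.exp σ ^ 2)⁻¹ * (y * g t 1 + Y t * g' 1) - 108 * Y t ^ 2 * y + y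
          + (Real.exp σ)⁻¹ * g' 0 - 2 * (n * Y t + ν t * y),
        -((2 : ℝ) • g') + (4 * Real.exp σ * y) • (L1.unit 0 : L1 ℕ)
          - (32 * Real.exp σ ^ 2 * Y t * y) • L1.unit 1,
        (8 : ℝ) • u' - (24 * Real.exp σ ^ 2 * Y t * y) • L1.unit 0) t := by
  have h_coord {f : ℝ → L1 ℕ} {f' : L1 ℕ} (hf : HasDerivAt f f' t) (i : ℕ) :
      HasDerivAt (fun t => f t i) (f' i) t := (L1.coord i).hasFDerivAt.comp_hasDerivAt t hf
  have h_sq := (hY.const_mul (Real.exp σ)).pow 2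
  simp only [rescaled_zero]
  refine HasDerivAt.prodMk ?_ (HasDerivAt.prodMk ?_ (HasDerivAt.prodMk ?_ ?_))
  · refine ((hν.const_sub (1 / 2)).sub ((hY.pow 2).const_mul 4)).congr_deriv ?_
    norm_num
    ring
  · refine (((((((hY.const_mul _).mul (h_coord hu 0)).sub ((hY.const_mul _).mul
      (h_coord hg 1))).sub ((hY.pow 3).const_mul 36)).add hY).add
      ((h_coord hg 0).const_mul _)).sub ((hν.const_mul 2).mul hY)).congr_deriv ?_
    norm_num
    ring
  · refine (((hg.const_smul (2 : ℝ)).neg.add ((hY.const_mul _).smul_const _)).sub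
      ((h_sq.const_mul 16).smul_const _)).congr_deriv ?_
    norm_num
    module
  · refine ((hu.const_smul (8 : ℝ)).sub ((h_sq.const_mul 12).smul_const _)).congr_deriv ?_
    norm_num
    module

/-- The derivative of the rescaled equation in the unknowns at `s = 0` and `basePoint σ Y`. -/
def linearized (σ : ℝ≥0) (Y : ℝ) : Unknown → Unknown := fun (n, y, g, u) =>
  (-n - 8 * Y * y,
    -(13 / 2) * y - 24 * (Real.exp σ ^ 2)⁻¹ * Y * u 0 - 4 * (Real.exp σ ^ 2)⁻¹ * Y * g 1
      + (Real.exp σ)⁻¹ * g 0 - 2 * Y * n,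
    -((2 : ℝ) • g) + (4 * Real.exp σ * y) • (L1.unit 0 : L1 ℕ)
      - (32 * Real.exp σ ^ 2 * Y * y) • L1.unit 1,
    (8 : ℝ) • u - (24 * Real.exp σ ^ 2 * Y * y) • L1.unit 0)

/-- The inverse of `linearized σ Y`, found by eliminating `n`, `g` and `u` in favour of `y`. -/
def linearizedInv (σ : ℝ≥0) (Y : ℝ) : Unknown → Unknown := fun (a, b, c, d) =>
  let y : ℝ := -(b + 3 * (Real.exp σ ^ 2)⁻¹ * Y * d 0 - 2 * (Real.exp σ ^ 2)⁻¹ * Y * c 1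
    + (Real.exp σ)⁻¹ / 2 * c 0 - 2 * Y * a) / 4
  (-a - 8 * Y * y, y,
    -((1 / 2 : ℝ) • c) + (2 * Real.exp σ * y) • (L1.unit 0 : L1 ℕ)
      - (16 * Real.exp σ ^ 2 * Y * y) • L1.unit 1,
    (1 / 8 : ℝ) • d + (3 * Real.exp σ ^ 2 * Y * y) • L1.unit 0)

theorem leftInverse_linearizedInv {Y : ℝ} (hY : 16 * Y ^ 2 = 1) :
    Function.LeftInverse (linearizedInv σ Y) (linearized σ Y) := by
  rintro ⟨n, y, g, u⟩
  have hy : (linearizedInv σ Y (linearized σ Y (n, y, g, u))).2.1 = y := by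
    simp only [linearized, linearizedInv, lp.coeFn_add, lp.coeFn_sub, lp.coeFn_neg, lp.coeFn_smul,
      Pi.add_apply, Pi.sub_apply, Pi.neg_apply, Pi.smul_apply, smul_eq_mul, L1.unit_apply]
    norm_num
    field_simp
    linear_combination (-y * Real.exp σ ^ 2) * hY
  have h_eq (z : Unknown) : linearizedInv σ Y z =
      (-z.1 - 8 * Y * (linearizedInv σ Y z).2.1, (linearizedInv σ Y z).2.1,
        -((1 / 2 : ℝ) • z.2.2.1)
          + (2 * Real.exp σ * (linearizedInv σ Y z).2.1) • (L1.unit 0 : L1 ℕ)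
          - (16 * Real.exp σ ^ 2 * Y * (linearizedInv σ Y z).2.1) • L1.unit 1,
        (1 / 8 : ℝ) • z.2.2.2 +
          (3 * Real.exp σ ^ 2 * Y * (linearizedInv σ Y z).2.1) • L1.unit 0) := rfl
  rw [h_eq, hy]
  refine Prod.ext ?_ (Prod.ext rfl (Prod.ext ?_ ?_)) <;> simp only [linearized]
  · ring
  · module
  · module

theorem rightInverse_linearizedInv {Y : ℝ} (hY : 16 * Y ^ 2 = 1) :
    Function.RightInverse (linearizedInv σ Y) (linearized σ Y) := by
  rintro ⟨a, b, c, d⟩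
  obtain ⟨y, hy⟩ : ∃ y, y = (linearizedInv σ Y (a, b, c, d)).2.1 := ⟨_, rfl⟩
  have h_eq : linearizedInv σ Y (a, b, c, d) = (-a - 8 * Y * y, y,
      -((1 / 2 : ℝ) • c) + (2 * Real.exp σ * y) • (L1.unit 0 : L1 ℕ)
        - (16 * Real.exp σ ^ 2 * Y * y) • L1.unit 1,
      (1 / 8 : ℝ) • d + (3 * Real.exp σ ^ 2 * Y * y) • L1.unit 0) := by
    rw [hy]
    rfl
  rw [h_eq, linearized]
  refine Prod.ext ?_ (Prod.ext ?_ (Prod.ext ?_ ?_)) <;> dsimp only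
  · ring
  · simp only [linearizedInv] at hy
    simp only [lp.coeFn_add, lp.coeFn_sub, lp.coeFn_neg, lp.coeFn_smul, Pi.add_apply,
      Pi.sub_apply, Pi.neg_apply, Pi.smul_apply, smul_eq_mul, L1.unit_apply]
    norm_num
    field_simp at hy ⊢
    linear_combination (-8) * hy + (8 * y * Real.exp σ ^ 2) * hY
  · module
  · module

theorem fderiv_rescaled_apply {Y : ℝ} (hY : 16 * Y ^ 2 = 1) (v : Unknown) :
    fderiv ℝ (rescaled σ) (0, basePoint σ Y) (0, v) = linearized σ Y v := by
  obtain ⟨n, y, g, u⟩ := v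
  have h_line {E : Type} [NormedAddCommGroup E] [NormedSpace ℝ E] (a b : E) :
      HasDerivAt (fun t : ℝ => a + t • b) b 0 := by
    simpa using ((hasDerivAt_id (0 : ℝ)).smul_const b).const_add a
  have h_fderiv := ((contDiffAt_rescaled (σ := σ) (basePoint σ Y)).differentiableAt
    one_ne_zero).hasFDerivAt.comp_hasDerivAt_of_eq (0 : ℝ)
      (h_line ((0 : ℝ), basePoint σ Y) (0, n, y, g, u)) (by simp)
  have h_deriv := hasDerivAt_rescaled_zero (σ := σ) (h_line (1 / 4) n) (h_line Y y)
    (h_line (basePoint σ Y).2.2.1 g) (h_line (basePoint σ Y).2.2.2 u)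
  have h_eq : rescaled σ ∘ (fun t : ℝ => ((0 : ℝ), basePoint σ Y) + t • ((0 : ℝ), n, y, g, u)) =
      fun t => rescaled σ (0, 1 / 4 + t • n, Y + t • y, (basePoint σ Y).2.2.1 + t • g,
        (basePoint σ Y).2.2.2 + t • u) := by
    funext t
    simp [basePoint]
  rw [h_eq] at h_fderiv
  rw [h_fderiv.unique h_deriv, linearized]
  simp only [zero_smul, add_zero, basePoint, lp.coeFn_sub, lp.coeFn_smul, Pi.sub_apply,
    Pi.smul_apply, smul_eq_mul, L1.unit_apply, zero_mul, add_zero]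
  refine Prod.ext rfl (Prod.ext ?_ rfl)
  norm_num
  field_simp
  linear_combination (-1728 * Real.exp σ ^ 2 * y) * hY

theorem isInvertible_fderiv_rescaled {Y : ℝ} (hY : 16 * Y ^ 2 = 1) :
    (fderiv ℝ (rescaled σ) (0, basePoint σ Y) ∘L .inr ℝ ℝ Unknown).IsInvertible := by
  have h_coe : ⇑(fderiv ℝ (rescaled σ) (0, basePoint σ Y) ∘L .inr ℝ ℝ Unknown) = linearized σ Y :=
    funext fun v => fderiv_rescaled_apply hY v
  refine ⟨ContinuousLinearEquiv.ofBijective _ (LinearMap.ker_eq_bot.2 ?_)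
    (LinearMap.range_eq_top.2 ?_), ContinuousLinearEquiv.coe_ofBijective _ _ _⟩
  · exact h_coe ▸ (leftInverse_linearizedInv hY).injective
  · exact h_coe ▸ (rightInverse_linearizedInv hY).surjective

theorem exists_branch (σ : ℝ≥0) {Y : ℝ} (hY : 16 * Y ^ 2 = 1) :
    ∃ ψ : ℝ → Unknown, ψ 0 = basePoint σ Y ∧ (∀ᶠ s in 𝓝 0, ContinuousAt ψ s) ∧
      ∀ᶠ s in 𝓝 0, equationLeading (ψ s).1 (ψ s).2.1 (ψ s).2.2.1 (ψ s).2.2.2 +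
        s • equationRemainder s (ψ s).1 (ψ s).2.1 (ψ s).2.2.1 (ψ s).2.2.2 = (0 : Laurent σ) := by
  have h_contDiff := contDiffAt_rescaled (σ := σ) (basePoint σ Y)
  have h_inv := isInvertible_fderiv_rescaled (σ := σ) hY
  refine ⟨h_contDiff.implicitFunction one_ne_zero h_inv,
    h_contDiff.implicitFunction_apply_self one_ne_zero h_inv, ?_, ?_⟩
  · filter_upwards [(h_contDiff.contDiffAt_implicitFunction one_ne_zero h_inv).eventually
      (by simp)] with s hs
    exact hs.continuousAt
  · filter_upwards [h_contDiff.eventually_apply_implicitFunction one_ne_zero h_inv] with s hs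
    rw [rescaled_basePoint hY] at hs
    exact equationLeading_add_equationRemainder_eq_zero hs

/-! ### Cosine series in a strip -/

/-- The `k`-th basis function of `cosSeries`: the restriction to `ξ = e^{2iz}` of
`evenSeries (L1.unit k)`. -/
def cosTerm (σ : ℝ≥0) (k : ℕ) (z : ℂ) : ℂ :=
  ((Real.exp σ ^ (k + 1))⁻¹ : ℝ) * (2 * Complex.cos (2 * (k + 1) * z))

/-- The function of `z` represented by the Laurent series `evenSeries a` in `ξ = e^{2iz}`. -/
def cosSeries (σ : ℝ≥0) (a : L1 ℕ) (z : ℂ) : ℂ := ∑' k, (a k : ℂ) * cosTerm σ k z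

/-- The open strip `|Im z| < σ / 2`, on which `ξ = e^{2iz}` satisfies `e^{-σ} < |ξ| < e^σ`. -/
def openStrip (σ : ℝ≥0) : Set ℂ := {z | |z.im| < σ / 2}

theorem isOpen_openStrip : IsOpen (openStrip σ) :=
  isOpen_lt (continuous_abs.comp Complex.continuous_im) continuous_const

theorem openStrip_subset_strip : openStrip σ ⊆ strip (σ / 2) :=
  fun _ hz => (show |_| < (σ / 2 : ℝ) from hz).le

theorem ofReal_mem_openStrip (hσ : 0 < σ) (θ : ℝ) : (θ : ℂ) ∈ openStrip σ := by
  simpa [openStrip] using hσ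

theorem ofReal_mem_strip (θ : ℝ) : (θ : ℂ) ∈ strip (σ / 2) := by
  have h_nonneg : (0 : ℝ) ≤ σ / 2 := by positivity
  simpa only [strip, mem_ofPred_eq, Complex.ofReal_im, abs_zero] using h_nonneg

theorem norm_cosTerm_le (k : ℕ) {z : ℂ} (hz : z ∈ strip (σ / 2)) : ‖cosTerm σ k z‖ ≤ 2 := by
  have hz : |z.im| ≤ σ / 2 := hz
  have h_exp (w : ℂ) (hw : |w.im| = |z.im|) :
      ‖Complex.exp (2 * (k + 1) * w * Complex.I)‖ ≤ Real.exp σ ^ (k + 1) := by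
    rw [Complex.norm_exp, ← Real.exp_nat_mul, Real.exp_le_exp]
    calc (2 * (k + 1) * w * Complex.I).re = 2 * (k + 1) * -w.im := by simp
      _ ≤ 2 * (k + 1) * (σ / 2) := by gcongr; exact (neg_le_abs _).trans (hw.trans_le hz)
      _ = (k + 1 : ℕ) * σ := by push_cast; ring
  have h_pos := h_exp z rfl
  have h_neg := h_exp (-z) (by rw [Complex.neg_im, abs_neg])
  rw [mul_neg] at h_neg
  rw [cosTerm, Complex.two_cos, norm_mul, Complex.norm_real, norm_inv,
    Real.norm_of_nonneg (by positivity), inv_mul_le_iff₀ (by positivity)]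
  exact (norm_add_le _ _).trans (by linarith)

theorem summable_cosTerm_bound (a : L1 ℕ) : Summable fun k => |a k| * 2 :=
  (L1.hasSum_abs a).summable.mul_right 2

theorem norm_coord_mul_cosTerm_le (a : L1 ℕ) (k : ℕ) {z : ℂ} (hz : z ∈ strip (σ / 2)) :
    ‖(a k : ℂ) * cosTerm σ k z‖ ≤ |a k| * 2 := by
  rw [norm_mul, Complex.norm_real, Real.norm_eq_abs]
  exact mul_le_mul_of_nonneg_left (norm_cosTerm_le k hz) (abs_nonneg _)

theorem hasSum_cosSeries (a : L1 ℕ) {z : ℂ} (hz : z ∈ strip (σ / 2)) :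
    HasSum (fun k => (a k : ℂ) * cosTerm σ k z) (cosSeries σ a z) :=
  (Summable.of_norm_bounded (summable_cosTerm_bound a) fun k =>
    norm_coord_mul_cosTerm_le a k hz).hasSum

theorem norm_cosSeries_le (a : L1 ℕ) {z : ℂ} (hz : z ∈ strip (σ / 2)) :
    ‖cosSeries σ a z‖ ≤ 2 * ‖a‖ := by
  rw [mul_comm]
  exact tsum_of_norm_bounded ((L1.hasSum_abs a).mul_right 2) fun k =>
    norm_coord_mul_cosTerm_le a k hz

theorem cosSeries_sub (a b : L1 ℕ) {z : ℂ} (hz : z ∈ strip (σ / 2)) :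
    cosSeries σ (a - b) z = cosSeries σ a z - cosSeries σ b z := by
  refine (hasSum_cosSeries (a - b) hz).unique ?_
  simpa only [lp.coeFn_sub, Pi.sub_apply, Complex.ofReal_sub, sub_mul] using
    (hasSum_cosSeries a hz).sub (hasSum_cosSeries b hz)

theorem cosSeries_zero : cosSeries σ 0 = 0 := by
  funext z
  simp [cosSeries]

theorem differentiable_cosTerm (k : ℕ) : Differentiable ℂ (cosTerm σ k) := by
  unfold cosTerm
  fun_prop

theorem deriv_cosTerm (k : ℕ) (z : ℂ) : deriv (cosTerm σ k) z =
    -(((Real.exp σ ^ (k + 1))⁻¹ : ℝ) * (4 * (k + 1) * Complex.sin (2 * (k + 1) * z))) := by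
  have h_mul : HasDerivAt (fun z : ℂ => 2 * (k + 1) * z) (2 * (k + 1) : ℂ) z := by
    simpa using (hasDerivAt_id z).const_mul (2 * (k + 1) : ℂ)
  refine ((h_mul.ccos.const_mul 2).const_mul _).deriv.trans ?_
  ring

theorem differentiableOn_cosSeries (a : L1 ℕ) :
    DifferentiableOn ℂ (cosSeries σ a) (openStrip σ) :=
  Complex.differentiableOn_tsum_of_summable_norm (summable_cosTerm_bound a)
    (fun k => ((differentiable_cosTerm k).const_mul _).differentiableOn) isOpen_openStrip
    fun k _ hz => norm_coord_mul_cosTerm_le a k (openStrip_subset_strip hz)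

theorem hasSum_deriv_cosSeries (a : L1 ℕ) {z : ℂ} (hz : z ∈ openStrip σ) :
    HasSum (fun k => (a k : ℂ) * deriv (cosTerm σ k) z) (deriv (cosSeries σ a) z) := by
  have h_sum := Complex.hasSum_deriv_of_summable_norm (summable_cosTerm_bound a)
    (fun k => ((differentiable_cosTerm k).const_mul (a k : ℂ)).differentiableOn) isOpen_openStrip
    (fun k _ hz => norm_coord_mul_cosTerm_le a k (openStrip_subset_strip hz)) hz
  simp only [deriv_const_mul_field] at h_sum
  exact h_sum

theorem cosTerm_ofReal (k : ℕ) (θ : ℝ) :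
    cosTerm σ k θ = (((Real.exp σ ^ (k + 1))⁻¹ * (2 * Real.cos (2 * (k + 1) * θ)) : ℝ) : ℂ) := by
  rw [cosTerm]
  push_cast
  rfl

theorem hasSum_cosSeries_ofReal (a : L1 ℕ) (θ : ℝ) :
    HasSum (fun k : ℕ =>
        ((a k * (Real.exp σ ^ (k + 1))⁻¹ * 2 * Real.cos (2 * (k + 1) * θ) : ℝ) : ℂ))
      (cosSeries σ a θ) := by
  convert hasSum_cosSeries a (ofReal_mem_strip (σ := σ) θ) using 2 with k
  rw [cosTerm_ofReal]
  push_cast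
  ring

theorem hasSum_onReal_cosSeries (a : L1 ℕ) (θ : ℝ) :
    HasSum (fun k : ℕ => a k * (Real.exp σ ^ (k + 1))⁻¹ * 2 * Real.cos (2 * (k + 1) * θ))
      (onReal (cosSeries σ a) θ) :=
  Complex.hasSum_re (hasSum_cosSeries_ofReal a θ)

theorem cosSeries_ofReal (a : L1 ℕ) (θ : ℝ) :
    cosSeries σ a θ = (onReal (cosSeries σ a) θ : ℂ) :=
  (hasSum_cosSeries_ofReal a θ).unique (Complex.hasSum_ofReal.2 (hasSum_onReal_cosSeries a θ))

theorem abs_onReal_cosSeries_le (a : L1 ℕ) (θ : ℝ) : |onReal (cosSeries σ a) θ| ≤ 2 * ‖a‖ :=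
  (Complex.abs_re_le_norm _).trans (norm_cosSeries_le a (ofReal_mem_strip θ))

theorem hasDerivAt_onReal_cosSeries (hσ : 0 < σ) (a : L1 ℕ) (θ : ℝ) :
    HasDerivAt (onReal (cosSeries σ a)) (deriv (cosSeries σ a) θ).re θ :=
  ((differentiableOn_cosSeries a).differentiableAt
    (isOpen_openStrip.mem_nhds (ofReal_mem_openStrip hσ θ))).hasDerivAt.real_of_complex

theorem deriv_cosSeries_ofReal (hσ : 0 < σ) (a : L1 ℕ) (θ : ℝ) :
    deriv (cosSeries σ a) θ = ((deriv (onReal (cosSeries σ a)) θ : ℝ) : ℂ) := by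
  have h_sum := hasSum_deriv_cosSeries a (ofReal_mem_openStrip hσ θ)
  have h_real (k : ℕ) : (a k : ℂ) * deriv (cosTerm σ k) θ =
      ((a k * -((Real.exp σ ^ (k + 1))⁻¹ *
        (4 * (k + 1) * Real.sin (2 * (k + 1) * θ))) : ℝ) : ℂ) := by
    rw [deriv_cosTerm]
    push_cast
    rfl
  simp only [h_real] at h_sum
  rw [(hasDerivAt_onReal_cosSeries hσ a θ).deriv]
  exact h_sum.unique (Complex.hasSum_ofReal.2 (Complex.hasSum_re h_sum))

theorem integral_cos_int_mul {n : ℤ} (hn : n ≠ 0) :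
    ∫ θ in (-Real.pi)..Real.pi, Real.cos (n * θ) = 0 := by
  have hn : (n : ℝ) ≠ 0 := by exact_mod_cast hn
  rw [intervalIntegral.integral_comp_mul_left (fun x => Real.cos x) hn, integral_cos]
  simp [Real.sin_int_mul_pi]

theorem integral_cos_mul_cos_two (k : ℕ) :
    ∫ θ in (-Real.pi)..Real.pi, Real.cos (2 * (k + 1) * θ) * Real.cos (2 * θ) =
      if k = 0 then Real.pi else 0 := by
  have h_prod (θ : ℝ) : Real.cos (2 * (k + 1) * θ) * Real.cos (2 * θ) =
      (1 / 2) * (Real.cos (((2 * k + 4 : ℤ) : ℝ) * θ) + Real.cos (((2 * k : ℤ) : ℝ) * θ)) := by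
    have h_add := Real.cos_add (2 * (k + 1) * θ) (2 * θ)
    have h_sub := Real.cos_sub (2 * (k + 1) * θ) (2 * θ)
    push_cast
    rw [show 2 * (k + 1) * θ + 2 * θ = (2 * k + 4) * θ by ring] at h_add
    rw [show 2 * (k + 1) * θ - 2 * θ = (2 * k) * θ by ring] at h_sub
    linarith
  simp only [h_prod]
  rw [intervalIntegral.integral_const_mul, intervalIntegral.integral_add
    (Continuous.intervalIntegrable (by fun_prop) _ _)
    (Continuous.intervalIntegrable (by fun_prop) _ _), integral_cos_int_mul (by omega)]
  split_ifs with hk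
  · subst hk
    simp
    ring
  · rw [integral_cos_int_mul (by omega)]
    simp

theorem hasSum_intervalIntegral_of_norm_le {ι E : Type*} [Countable ι] [NormedAddCommGroup E]
    [NormedSpace ℝ E] {F : ι → ℝ → E} {f : ℝ → E} {u : ι → ℝ} (hF : ∀ i, Continuous (F i))
    (hu : Summable u) (hle : ∀ i t, ‖F i t‖ ≤ u i) (hf : ∀ t, HasSum (fun i => F i t) (f t))
    (a b : ℝ) : HasSum (fun i => ∫ t in a..b, F i t) (∫ t in a..b, f t) :=
  intervalIntegral.hasSum_integral_of_dominated_convergence (fun i _ => u i)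
    (fun i => (hF i).aestronglyMeasurable) (fun i => .of_forall fun t _ => hle i t)
    (.of_forall fun _ _ => hu) intervalIntegrable_const (.of_forall fun t _ => hf t)

theorem modeTwo_cosSeries (a : L1 ℕ) :
    modeTwo (onReal (cosSeries σ a)) = (Real.exp σ)⁻¹ * (2 * a 0) := by
  have h_sum := hasSum_intervalIntegral_of_norm_le
    (F := fun (k : ℕ) θ => a k * (Real.exp σ ^ (k + 1))⁻¹ * 2 * (Real.cos (2 * (k + 1) * θ)
      * Real.cos (2 * θ))) (f := fun θ => onReal (cosSeries σ a) θ * Real.cos (2 * θ))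
    (fun k => by fun_prop) (summable_cosTerm_bound a) (fun k θ => ?_) (fun θ => ?_)
    (-Real.pi) Real.pi
  · simp only [intervalIntegral.integral_const_mul, integral_cos_mul_cos_two] at h_sum
    rw [modeTwo, h_sum.unique (hasSum_single 0 fun k hk => by simp [hk])]
    have := Real.pi_ne_zero
    simp only [zero_add, pow_one, if_true]
    field_simp
  · have h_inv : (Real.exp σ ^ (k + 1))⁻¹ ≤ 1 :=
      inv_le_one_of_one_le₀ (one_le_pow₀ (Real.one_le_exp σ.2))
    rw [Real.norm_eq_abs, abs_mul, abs_mul, abs_mul, abs_mul, abs_two,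
      abs_of_nonneg (a := (Real.exp σ ^ (k + 1))⁻¹) (by positivity)]
    calc |a k| * (Real.exp σ ^ (k + 1))⁻¹ * 2 *
          (|Real.cos (2 * (k + 1) * θ)| * |Real.cos (2 * θ)|)
        ≤ |a k| * 1 * 2 * (1 * 1) := by gcongr <;> exact Real.abs_cos_le_one _
      _ = |a k| * 2 := by ring
  · simpa only [mul_assoc] using (hasSum_onReal_cosSeries a θ).mul_right (Real.cos (2 * θ))

/-! ### Membership in `X k c` and norm estimates -/

theorem strip_subset_openStrip {c : ℝ} (hc : c < σ / 2) : strip c ⊆ openStrip σ :=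
  fun _ hz => lt_of_le_of_lt hz hc

theorem ofReal_add_mem_strip {c y : ℝ} (hy : |y| ≤ c) (θ : ℝ) :
    (θ + y * Complex.I : ℂ) ∈ strip c := by
  simpa [strip] using hy

theorem continuous_energyDensity {f : ℂ → ℂ} (hf : DifferentiableOn ℂ f (openStrip σ)) {y : ℝ}
    (hy : |y| < σ / 2) (k : ℕ) : Continuous (energyDensity k f y) := by
  have h_analytic : AnalyticOnNhd ℂ f (openStrip σ) := hf.analyticOnNhd isOpen_openStrip
  have h_line : Continuous fun θ : ℝ => (θ + y * Complex.I : ℂ) := by fun_prop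
  have h_mem (θ : ℝ) : (θ + y * Complex.I : ℂ) ∈ openStrip σ :=
    strip_subset_openStrip hy (ofReal_add_mem_strip le_rfl θ)
  have h_deriv : Continuous fun θ : ℝ => iteratedDeriv k f (θ + y * Complex.I) := by
    rw [iteratedDeriv_eq_iterate]
    exact (h_analytic.iterated_deriv k).continuousOn.comp_continuous h_line h_mem
  exact ((h_analytic.continuousOn.comp_continuous h_line h_mem).norm.pow 2).add (h_deriv.norm.pow 2)

theorem cosSeries_mem_X (a : L1 ℕ) (k : ℕ) {c : ℝ} (hc₀ : 0 < c) (hc : c < σ / 2) :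
    cosSeries σ a ∈ X k c := by
  have h_diff := differentiableOn_cosSeries (σ := σ) a
  have h_integrable {y : ℝ} (hy : |y| = c) :=
    (continuous_energyDensity h_diff (hy.trans_lt hc) k).intervalIntegrable
      (μ := MeasureTheory.volume) (-Real.pi) Real.pi
  exact ⟨(h_diff.analyticOnNhd isOpen_openStrip).mono (strip_subset_openStrip hc),
    ⟨fun n => a n * (Real.exp σ ^ (n + 1))⁻¹ * 2, hasSum_cosSeries_ofReal a⟩,
    h_integrable (abs_of_pos hc₀), h_integrable (by rw [abs_neg, abs_of_pos hc₀])⟩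

theorem norm_iteratedDeriv_le_of_forall_openStrip {f : ℂ → ℂ}
    (hf : DifferentiableOn ℂ f (openStrip σ)) {M : ℝ} (hM : ∀ z ∈ openStrip σ, ‖f z‖ ≤ M) {z : ℂ}
    {ρ : ℝ} (hρ : 0 < ρ) (hz : |z.im| + ρ < σ / 2) (k : ℕ) :
    ‖iteratedDeriv k f z‖ ≤ k.factorial * M / ρ ^ k := by
  have h_ball : Metric.closedBall z ρ ⊆ openStrip σ := fun w hw => by
    have h_dist : |w.im - z.im| ≤ ρ := by
      rw [← Complex.sub_im]
      exact (Complex.abs_im_le_norm _).trans (mem_closedBall_iff_norm.1 hw)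
    have h_le := abs_sub_abs_le_abs_sub w.im z.im
    change |w.im| < σ / 2
    linarith
  refine Complex.norm_iteratedDeriv_le_of_forall_mem_sphere_norm_le k hρ ?_ fun w hw =>
    hM w (h_ball (Metric.sphere_subset_closedBall hw))
  refine DifferentiableOn.diffContOnCl ?_
  rw [closure_ball z hρ.ne']
  exact hf.mono h_ball

theorem energyDensity_le {f : ℂ → ℂ} (hf : DifferentiableOn ℂ f (openStrip σ)) {M : ℝ}
    (hM : ∀ z ∈ openStrip σ, ‖f z‖ ≤ M) {ρ y : ℝ} (hρ : 0 < ρ) (hy : |y| + ρ < σ / 2)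
    (k : ℕ) (θ : ℝ) :
    energyDensity k f y θ ≤ (1 + (k.factorial / ρ ^ k) ^ 2) * M ^ 2 := by
  have h_im : (θ + y * Complex.I : ℂ).im = y := by simp
  have h_zero : ‖f (θ + y * Complex.I)‖ ≤ M :=
    hM _ (strip_subset_openStrip (by linarith) (ofReal_add_mem_strip le_rfl θ))
  have h_deriv : ‖iteratedDeriv k f (θ + y * Complex.I)‖ ≤ k.factorial * M / ρ ^ k :=
    norm_iteratedDeriv_le_of_forall_openStrip hf hM hρ (by rwa [h_im]) k
  calc energyDensity k f y θ ≤ M ^ 2 + (k.factorial * M / ρ ^ k) ^ 2 := by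
        rw [energyDensity]
        gcongr
    _ = _ := by ring

theorem stripNormSq_le {f : ℂ → ℂ} (hf : DifferentiableOn ℂ f (openStrip σ)) {M : ℝ}
    (hM : ∀ z ∈ openStrip σ, ‖f z‖ ≤ M) {ρ c : ℝ} (hρ : 0 < ρ) (hc : |c| + ρ < σ / 2) (k : ℕ) :
    stripNormSq k c f ≤ 4 * Real.pi * ((1 + (k.factorial / ρ ^ k) ^ 2) * M ^ 2) := by
  have h_line {y : ℝ} (hy : |y| + ρ < σ / 2) :
      ∫ θ in (-Real.pi)..Real.pi, energyDensity k f y θ ≤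
        2 * Real.pi * ((1 + (k.factorial / ρ ^ k) ^ 2) * M ^ 2) := by
    refine (intervalIntegral.integral_mono_on (by linarith [Real.pi_pos])
      ((continuous_energyDensity hf (by linarith) k).intervalIntegrable _ _)
      intervalIntegrable_const fun θ _ => energyDensity_le hf hM hρ hy k θ).trans_eq ?_
    rw [intervalIntegral.integral_const, smul_eq_mul]
    ring
  have h_upper := h_line hc
  have h_lower := h_line (y := -c) (by rwa [abs_neg])
  rw [stripNormSq]
  linarith

theorem stripNormSq_nonneg (k : ℕ) (c : ℝ) (f : ℂ → ℂ) : 0 ≤ stripNormSq k c f := by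
  have h_line (y : ℝ) : 0 ≤ ∫ θ in (-Real.pi)..Real.pi, energyDensity k f y θ :=
    intervalIntegral.integral_nonneg (by linarith [Real.pi_pos]) fun θ _ => by
      unfold energyDensity
      positivity
  exact add_nonneg (h_line c) (h_line (-c))

theorem tendsto_stripNormSq_cosSeries {a : ℝ → L1 ℕ} {x : ℝ} (ha : ContinuousAt a x) (k : ℕ)
    {c : ℝ} (hc : |c| < σ / 2) :
    Tendsto (fun y => stripNormSq k c (cosSeries σ (a y) - cosSeries σ (a x))) (𝓝 x) (𝓝 0) := by
  obtain ⟨ρ, hρ, hcρ⟩ : ∃ ρ > 0, |c| + ρ < σ / 2 :=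
    ⟨(σ / 2 - |c|) / 2, by linarith, by linarith⟩
  have h_le (y : ℝ) : stripNormSq k c (cosSeries σ (a y) - cosSeries σ (a x)) ≤
      4 * Real.pi * ((1 + (k.factorial / ρ ^ k) ^ 2) * (2 * ‖a y - a x‖) ^ 2) := by
    refine stripNormSq_le ((differentiableOn_cosSeries _).sub (differentiableOn_cosSeries _))
      (fun z hz => ?_) hρ hcρ k
    rw [Pi.sub_apply, ← cosSeries_sub _ _ (openStrip_subset_strip hz)]
    exact norm_cosSeries_le _ (openStrip_subset_strip hz)
  refine squeeze_zero (fun y => stripNormSq_nonneg k c _) h_le ?_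
  have h_norm : Tendsto (fun y => ‖a y - a x‖) (𝓝 x) (𝓝 0) := by
    simpa using (ha.sub (continuousAt_const (y := a x))).norm.tendsto
  simpa using (((h_norm.const_mul 2).pow 2).const_mul
    (1 + (k.factorial / ρ ^ k) ^ 2)).const_mul (4 * Real.pi)

/-! ### Evaluation of series on the circle -/

/-- Evaluation of a Laurent series in `ξ = ζ²` at a point of the unit circle. -/
def eval (ζ : Circle) : Laurent σ →L[ℝ] ℂ :=
  Wiener.lift (fun k => (ζ : ℂ) ^ (2 * k)) 1 fun k => by
    rw [norm_zpow, Circle.norm_coe, one_zpow, one_mul]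
    exact one_le_expWeight k

theorem norm_zpow_mul_zpow (ζ t : Circle) (k j : ℤ) : ‖(ζ : ℂ) ^ k * (t : ℂ) ^ j‖ = 1 := by
  rw [norm_mul, norm_zpow, norm_zpow, Circle.norm_coe, Circle.norm_coe, one_zpow, one_zpow, one_mul]

/-- Evaluation of a Laurent series in `ξ = ζ²` and `t` at points of the unit circle. -/
def eval₂ (ζ t : Circle) : Laurent₂ σ →L[ℝ] ℂ :=
  Wiener.lift (fun k => (ζ : ℂ) ^ (2 * k.1) * (t : ℂ) ^ k.2) 1 fun k => by
    rw [norm_zpow_mul_zpow, one_mul]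
    exact one_le_expWeight₂ k

theorem eval_ξpow (ζ : Circle) (k : ℤ) : eval ζ (ξpow k : Laurent σ) = (ζ : ℂ) ^ (2 * k) :=
  Wiener.lift_monomial _ _

theorem eval₂_monomial (ζ t : Circle) (k : ℤ × ℤ) :
    eval₂ ζ t (Wiener.monomial (expWeight₂ σ) k) = (ζ : ℂ) ^ (2 * k.1) * (t : ℂ) ^ k.2 :=
  Wiener.lift_monomial _ _

theorem eval₂_ξtpow (ζ t : Circle) (k j : ℤ) :
    eval₂ ζ t (ξtpow k j : Laurent₂ σ) = (ζ : ℂ) ^ (2 * k) * (t : ℂ) ^ j :=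
  eval₂_monomial ζ t (k, j)

theorem eval_mul (ζ : Circle) (a b : Laurent σ) : eval ζ (a * b) = eval ζ a * eval ζ b := by
  refine Wiener.map_mul_of_monomial _ (fun k l => ?_) a b
  rw [eval_ξpow, eval_ξpow, eval_ξpow, mul_add, zpow_add₀ (Circle.coe_ne_zero ζ)]

theorem eval_one (ζ : Circle) : eval ζ (1 : Laurent σ) = 1 := by
  rw [Wiener.one_def, eval_ξpow, mul_zero, zpow_zero]

theorem eval₂_mul (ζ t : Circle) (a b : Laurent₂ σ) :
    eval₂ ζ t (a * b) = eval₂ ζ t a * eval₂ ζ t b := by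
  refine Wiener.map_mul_of_monomial _ (fun k l => ?_) a b
  rw [eval₂_monomial, eval₂_monomial, eval₂_monomial, Prod.fst_add, Prod.snd_add, mul_add,
    zpow_add₀ (Circle.coe_ne_zero ζ), zpow_add₀ (Circle.coe_ne_zero t)]
  ring

theorem eval₂_one (ζ t : Circle) : eval₂ ζ t (1 : Laurent₂ σ) = 1 :=
  (eval₂_ξtpow ζ t 0 0).trans (by simp)

theorem norm_eval₂_le (ζ t : Circle) (a : Laurent₂ σ) : ‖eval₂ ζ t a‖ ≤ ‖a‖ := by
  simpa using Wiener.norm_apply_le (eval₂ ζ t) (C := 1) (fun k => by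
    rw [eval₂_monomial, norm_zpow_mul_zpow, one_mul]
    exact one_le_expWeight₂ k) a

theorem eval₂_subst (ζ t : Circle) (a : Laurent σ) : eval₂ ζ t (subst a) = eval (ζ * t) a := by
  have h : eval₂ ζ t ∘L (subst : Laurent σ →L[ℝ] Laurent₂ σ) = eval (ζ * t) := by
    refine Wiener.clm_ext fun k => ?_
    rw [ContinuousLinearMap.comp_apply, subst_ξpow, eval₂_ξtpow, eval_ξpow, Circle.coe_mul,
      mul_zpow]
  exact congr($h a)

theorem eval_evenMode (ζ : Circle) (n : ℕ) :
    eval ζ (evenMode n : Laurent σ) = (ζ : ℂ) ^ (2 * n) + ((ζ : ℂ) ^ (2 * n))⁻¹ := by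
  rw [evenMode, map_add, eval_ξpow, eval_ξpow, mul_neg, zpow_neg]
  norm_cast

theorem eval_oddMode (ζ : Circle) (n : ℕ) :
    eval ζ (oddMode n : Laurent σ) = (ζ : ℂ) ^ (2 * n) - ((ζ : ℂ) ^ (2 * n))⁻¹ := by
  rw [oddMode, map_sub, eval_ξpow, eval_ξpow, mul_neg, zpow_neg]
  norm_cast

theorem eval₂_divDiffMode (ζ t : Circle) (n : ℕ) : eval₂ ζ t (divDiffMode n : Laurent₂ σ) =
    (ζ : ℂ) ^ (2 * (n + 1)) * ∑ j ∈ Finset.range (2 * n + 3), (t : ℂ) ^ j -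
      ((ζ : ℂ) ^ (2 * (n + 1)))⁻¹ * ∑ j ∈ Finset.range (2 * n + 1), ((t : ℂ)⁻¹) ^ (j + 1) := by
  rw [divDiffMode, map_sub, map_sum, map_sum, Finset.mul_sum, Finset.mul_sum]
  congr 1
  · refine Finset.sum_congr rfl fun j _ => ?_
    rw [eval₂_ξtpow]
    norm_cast
  · refine Finset.sum_congr rfl fun j _ => ?_
    rw [eval₂_ξtpow, mul_neg, zpow_neg, zpow_neg, inv_pow]
    norm_cast

theorem one_sub_mul_sum_inv (t : Circle) (N : ℕ) :
    (1 - t : ℂ) * ∑ j ∈ Finset.range N, ((t : ℂ)⁻¹) ^ (j + 1) = ((t : ℂ)⁻¹) ^ N - 1 := by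
  have ht := Circle.coe_ne_zero t
  have h_factor : (1 - t : ℂ) * (t : ℂ)⁻¹ = -(1 - (t : ℂ)⁻¹) := by
    field_simp
    ring
  simp only [pow_succ', ← Finset.mul_sum]
  rw [← mul_assoc, h_factor, neg_mul, mul_neg_geom_sum, neg_sub]

theorem one_sub_mul_eval₂_divDiffMode (ζ t : Circle) (n : ℕ) :
    (1 - t : ℂ) * eval₂ ζ t (divDiffMode n : Laurent₂ σ) =
      eval ζ (evenMode (n + 1) : Laurent σ) -
        t * eval (ζ * t) (evenMode (n + 1) : Laurent σ) := by
  have ht := Circle.coe_ne_zero t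
  have hζ := Circle.coe_ne_zero ζ
  rw [eval₂_divDiffMode, mul_sub, mul_left_comm, mul_neg_geom_sum, mul_left_comm,
    one_sub_mul_sum_inv, eval_evenMode, eval_evenMode, Circle.coe_mul, inv_pow]
  field_simp
  ring

theorem eval₂_one_divDiffMode (ζ : Circle) (n : ℕ) : eval₂ ζ 1 (divDiffMode n : Laurent₂ σ) =
    eval ζ (evenMode (n + 1) : Laurent σ) +
      (2 * (n + 1) : ℝ) • eval ζ (oddMode (n + 1) : Laurent σ) := by
  rw [eval₂_divDiffMode, eval_evenMode, eval_oddMode]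
  simp
  ring

theorem norm_pow_sub_one_le (t : Circle) (n : ℕ) : ‖(t : ℂ) ^ n - 1‖ ≤ n * ‖(t : ℂ) - 1‖ := by
  rw [← mul_geom_sum, norm_mul, mul_comm]
  gcongr
  refine (norm_sum_le_of_le _ (n := fun _ => (1 : ℝ)) fun i _ => ?_).trans (by simp)
  rw [norm_pow, Circle.norm_coe, one_pow]

theorem norm_inv_sub_one (t : Circle) : ‖(t : ℂ)⁻¹ - 1‖ = ‖(t : ℂ) - 1‖ := by
  rw [← Circle.coe_inv, Circle.coe_inv_eq_conj, ← RCLike.norm_conj, map_sub, map_one,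
    starRingEnd_self_apply]

theorem norm_mul_pow_sub_pow_le (ζ t : Circle) (n : ℕ) :
    ‖((ζ * t : Circle) : ℂ) ^ n - (ζ : ℂ) ^ n‖ ≤ n * ‖(t : ℂ) - 1‖ := by
  rw [Circle.coe_mul, mul_pow, ← mul_sub_one, norm_mul, norm_pow, Circle.norm_coe, one_pow, one_mul]
  exact norm_pow_sub_one_le t n

theorem norm_eval_mul_evenMode_sub_le (ζ t : Circle) (n : ℕ) :
    ‖eval (ζ * t) (evenMode n : Laurent σ) - eval ζ (evenMode n : Laurent σ)‖ ≤
      4 * n * ‖(t : ℂ) - 1‖ := by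
  have h_pos := norm_mul_pow_sub_pow_le ζ t (2 * n)
  have h_neg := norm_mul_pow_sub_pow_le ζ⁻¹ t⁻¹ (2 * n)
  rw [← mul_inv, Circle.coe_inv, Circle.coe_inv, Circle.coe_inv, norm_inv_sub_one, inv_pow,
    inv_pow] at h_neg
  push_cast at h_pos h_neg
  rw [eval_evenMode, eval_evenMode, add_sub_add_comm, Circle.coe_mul]
  linarith [norm_add_le_of_le h_pos h_neg]

theorem norm_sum_pow_sub_one_le (t : Circle) (N m : ℕ) :
    ‖∑ j ∈ Finset.range N, ((t : ℂ) ^ (j + m) - 1)‖ ≤ (N + m) ^ 2 * ‖(t : ℂ) - 1‖ := by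
  calc ‖∑ j ∈ Finset.range N, ((t : ℂ) ^ (j + m) - 1)‖
      ≤ ∑ _j ∈ Finset.range N, (N + m) * ‖(t : ℂ) - 1‖ := by
        refine norm_sum_le_of_le _ fun j hj => (norm_pow_sub_one_le t _).trans ?_
        gcongr
        exact_mod_cast (by grind : j + m ≤ N + m)
    _ = N * ((N + m) * ‖(t : ℂ) - 1‖) := by
        rw [Finset.sum_const, Finset.card_range, nsmul_eq_mul]
    _ ≤ (N + m) * ((N + m) * ‖(t : ℂ) - 1‖) := by
        gcongr
        linarith [m.cast_nonneg (α := ℝ)]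
    _ = (N + m) ^ 2 * ‖(t : ℂ) - 1‖ := by ring

theorem norm_eval₂_divDiffMode_sub_le (ζ t : Circle) (n : ℕ) :
    ‖eval₂ ζ t (divDiffMode n : Laurent₂ σ) - eval₂ ζ 1 (divDiffMode n : Laurent₂ σ)‖ ≤
      2 * (2 * n + 3) ^ 2 * ‖(t : ℂ) - 1‖ := by
  have h_pos := norm_sum_pow_sub_one_le t (2 * n + 3) 0
  have h_neg : ‖∑ j ∈ Finset.range (2 * n + 1), (((t : ℂ)⁻¹) ^ (j + 1) - 1)‖ ≤
      (2 * n + 3) ^ 2 * ‖(t : ℂ) - 1‖ := by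
    refine (norm_inv_sub_one t ▸ Circle.coe_inv t ▸
      norm_sum_pow_sub_one_le t⁻¹ (2 * n + 1) 1).trans ?_
    refine mul_le_mul_of_nonneg_right (pow_le_pow_left₀ (by positivity) ?_ 2) (norm_nonneg _)
    push_cast
    linarith
  have h_diff : eval₂ ζ t (divDiffMode n : Laurent₂ σ) - eval₂ ζ 1 (divDiffMode n : Laurent₂ σ) =
      (ζ : ℂ) ^ (2 * (n + 1)) * ∑ j ∈ Finset.range (2 * n + 3), ((t : ℂ) ^ j - 1) -
      ((ζ : ℂ) ^ (2 * (n + 1)))⁻¹ *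
        ∑ j ∈ Finset.range (2 * n + 1), (((t : ℂ)⁻¹) ^ (j + 1) - 1) := by
    simp only [eval₂_divDiffMode, Finset.sum_sub_distrib, Circle.coe_one, one_pow, inv_one]
    ring
  rw [h_diff]
  refine (norm_sub_le _ _).trans ?_
  rw [norm_mul, norm_mul, norm_inv, norm_pow, Circle.norm_coe, one_pow, inv_one, one_mul, one_mul]
  push_cast [add_zero] at h_pos
  linarith

theorem natCast_le_inv_mul_exp_pow (hσ : 0 < σ) (n : ℕ) :
    (n : ℝ) ≤ (σ : ℝ)⁻¹ * Real.exp σ ^ n := by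
  have hσ : (0 : ℝ) < σ := hσ
  rw [← Real.exp_nat_mul, le_inv_mul_iff₀ hσ, mul_comm]
  linarith [Real.add_one_le_exp ((n : ℝ) * σ)]

theorem norm_eval_mul_evenSeries_sub_le (hσ : 0 < σ) (ζ t : Circle) (a : L1 ℕ) :
    ‖eval (ζ * t) (evenSeries a : Laurent σ) - eval ζ (evenSeries a : Laurent σ)‖ ≤
      4 * (σ : ℝ)⁻¹ * ‖(t : ℂ) - 1‖ * ‖a‖ := by
  refine L1.norm_apply_le ((eval (ζ * t) - eval ζ) ∘L (evenSeries : L1 ℕ →L[ℝ] Laurent σ))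
    (fun k => ?_) a
  rw [ContinuousLinearMap.comp_apply, evenSeries_unit, map_smul]
  refine norm_inv_exp_pow_smul_le ((norm_eval_mul_evenMode_sub_le ζ t (k + 1)).trans ?_)
  calc 4 * (k + 1 : ℕ) * ‖(t : ℂ) - 1‖
      ≤ 4 * ((σ : ℝ)⁻¹ * Real.exp σ ^ (k + 1)) * ‖(t : ℂ) - 1‖ := by
        gcongr
        exact natCast_le_inv_mul_exp_pow hσ _
    _ = 4 * (σ : ℝ)⁻¹ * ‖(t : ℂ) - 1‖ * Real.exp σ ^ (k + 1) := by ring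

theorem norm_eval₂_divDiffTail_sub_le (hσ : 0 < σ) (ζ t : Circle) (u : L1 ℕ) :
    ‖eval₂ ζ t (divDiffTail u : Laurent₂ σ) - eval₂ ζ 1 (divDiffTail u : Laurent₂ σ)‖ ≤
      50 * (σ : ℝ)⁻¹ * ‖(t : ℂ) - 1‖ * ‖u‖ := by
  refine L1.norm_apply_le ((eval₂ ζ t - eval₂ ζ 1) ∘L (divDiffTail : L1 ℕ →L[ℝ] Laurent₂ σ))
    (fun k => ?_) u
  rw [ContinuousLinearMap.comp_apply, divDiffTail_unit, map_smul]
  refine norm_inv_exp_pow_smul_le ?_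
  rw [map_smul, norm_smul, norm_inv, Real.norm_of_nonneg (by positivity),
    inv_mul_le_iff₀ (by positivity), sub_apply]
  calc _ ≤ 2 * (2 * (k + 1 : ℕ) + 3) ^ 2 * ‖(t : ℂ) - 1‖ :=
        norm_eval₂_divDiffMode_sub_le ζ t (k + 1)
    _ ≤ 2 * (5 * (k + 1 : ℝ)) ^ 2 * ‖(t : ℂ) - 1‖ := by
        gcongr
        push_cast
        linarith [k.cast_nonneg (α := ℝ)]
    _ = (k + 1) * (50 * (k + 1) * ‖(t : ℂ) - 1‖) := by ring
    _ ≤ (k + 1) * (50 * ((σ : ℝ)⁻¹ * Real.exp σ ^ (k + 2)) * ‖(t : ℂ) - 1‖) := by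
        gcongr
        refine le_trans ?_ (natCast_le_inv_mul_exp_pow hσ (k + 2))
        push_cast
        linarith
    _ = (k + 1) * (50 * (σ : ℝ)⁻¹ * ‖(t : ℂ) - 1‖ * Real.exp σ ^ (k + 2)) := by ring

open MeasureTheory

/-! ### The principal value of a series divided by `1 - t` -/

theorem integral_circleExp_zpow (j : ℤ) :
    ∫ τ in (-Real.pi)..Real.pi, (Circle.exp τ : ℂ) ^ j =
      if j = 0 then 2 * (Real.pi : ℂ) else 0 := by
  have h_exp (τ : ℝ) : (Circle.exp τ : ℂ) ^ j = Complex.exp ((j * Complex.I) * τ) := by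
    rw [Circle.coe_exp, ← Complex.exp_int_mul]
    ring_nf
  simp only [h_exp]
  split_ifs with hj
  · subst hj
    simp
    ring
  · have hc : (j * Complex.I : ℂ) ≠ 0 := mul_ne_zero (by exact_mod_cast hj) Complex.I_ne_zero
    rw [integral_exp_mul_complex hc, div_eq_zero_iff, sub_eq_zero]
    left
    rw [Complex.exp_eq_exp_iff_exists_int]
    exact ⟨j, by push_cast; ring⟩

theorem continuous_circleExp_zpow (j : ℤ) : Continuous fun τ : ℝ => (Circle.exp τ : ℂ) ^ j :=
  (continuous_subtype_val.comp Circle.exp.continuous).zpow₀ j fun _ =>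
    Or.inl (Circle.coe_ne_zero _)

/-- The partial sum `t⁻¹ + ⋯ + t⁻ᴺ` of the expansion of `-1 / (1 - t)`. -/
def invGeomSum (N : ℕ) (t : Circle) : ℂ := ∑ j ∈ Finset.range N, ((t : ℂ)⁻¹) ^ (j + 1)

theorem continuous_invGeomSum (N : ℕ) : Continuous fun τ : ℝ => invGeomSum N (Circle.exp τ) :=
  continuous_finsetSum _ fun j _ => by
    simpa only [zpow_neg, zpow_natCast, inv_pow] using continuous_circleExp_zpow (-(j + 1 : ℕ))

theorem norm_invGeomSum_le (N : ℕ) (t : Circle) : ‖invGeomSum N t‖ ≤ N := by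
  refine (norm_sum_le_of_le _ (n := fun _ => (1 : ℝ)) fun i _ => ?_).trans (by simp)
  rw [norm_pow, norm_inv, Circle.norm_coe, inv_one, one_pow]

theorem integral_zpow_mul_invGeomSum (j : ℤ) (N : ℕ) :
    ∫ τ in (-Real.pi)..Real.pi, (Circle.exp τ : ℂ) ^ j * invGeomSum N (Circle.exp τ) =
      if 1 ≤ j ∧ j ≤ N then 2 * (Real.pi : ℂ) else 0 := by
  have h_sum (τ : ℝ) : (Circle.exp τ : ℂ) ^ j * invGeomSum N (Circle.exp τ) =
      ∑ n ∈ Finset.range N, (Circle.exp τ : ℂ) ^ (j - (n + 1)) := by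
    rw [invGeomSum, Finset.mul_sum]
    refine Finset.sum_congr rfl fun n _ => ?_
    rw [zpow_sub₀ (Circle.coe_ne_zero _), inv_pow, div_eq_mul_inv]
    norm_cast
  simp only [h_sum]
  rw [intervalIntegral.integral_finsetSum fun n _ =>
    (continuous_circleExp_zpow _).intervalIntegrable _ _]
  simp only [integral_circleExp_zpow]
  split_ifs with hj
  · rw [Finset.sum_eq_single (j - 1).toNat (fun n _ hn => if_neg (by omega)) (by grind),
      if_pos (by omega)]
  · exact Finset.sum_eq_zero fun n hn => if_neg (by grind)

theorem summable_abs_coeff₂ (h : Laurent₂ σ) : Summable fun k => |coeff k h| :=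
  Wiener.summable_abs_coeff one_le_expWeight₂ h

theorem hasSum_eval₂ (ζ t : Circle) (h : Laurent₂ σ) :
    HasSum (fun k : ℤ × ℤ => coeff k h * (ζ : ℂ) ^ (2 * k.1) * (t : ℂ) ^ k.2) (eval₂ ζ t h) := by
  simpa only [eval₂_monomial, Complex.real_smul, mul_assoc] using Wiener.hasSum_apply (eval₂ ζ t) h

theorem norm_coeff_mul_zpow (ζ : Circle) (h : Laurent₂ σ) (k : ℤ × ℤ) :
    ‖(coeff k h : ℂ) * (ζ : ℂ) ^ (2 * k.1)‖ = |coeff k h| := by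
  rw [norm_mul, norm_zpow, Circle.norm_coe, one_zpow, mul_one, Complex.norm_real, Real.norm_eq_abs]

theorem continuous_eval₂_circleExp (ζ : Circle) (h : Laurent₂ σ) :
    Continuous fun τ : ℝ => eval₂ ζ (Circle.exp τ) h := by
  simp only [← (hasSum_eval₂ ζ _ h).tsum_eq]
  refine continuous_tsum (fun k => continuous_const.mul (continuous_circleExp_zpow k.2))
    (summable_abs_coeff₂ h) fun k τ => ?_
  rw [norm_mul, norm_coeff_mul_zpow, norm_zpow, Circle.norm_coe, one_zpow, mul_one]

theorem hasSum_integral_eval₂_mul_invGeomSum (ζ : Circle) (h : Laurent₂ σ) (N : ℕ) :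
    HasSum (fun k : ℤ × ℤ => coeff k h * (ζ : ℂ) ^ (2 * k.1) *
        if 1 ≤ k.2 ∧ k.2 ≤ N then 2 * (Real.pi : ℂ) else 0)
      (∫ τ in (-Real.pi)..Real.pi, eval₂ ζ (Circle.exp τ) h * invGeomSum N (Circle.exp τ)) := by
  simp only [← integral_zpow_mul_invGeomSum, ← intervalIntegral.integral_const_mul]
  refine hasSum_intervalIntegral_of_norm_le
    (F := fun (k : ℤ × ℤ) τ => coeff k h * (ζ : ℂ) ^ (2 * k.1) *
      ((Circle.exp τ : ℂ) ^ k.2 * invGeomSum N (Circle.exp τ)))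
    (fun k => continuous_const.mul ((continuous_circleExp_zpow _).mul (continuous_invGeomSum N)))
    ((summable_abs_coeff₂ h).mul_right (N : ℝ)) (fun k τ => ?_) (fun τ => ?_) _ _
  · rw [norm_mul, norm_coeff_mul_zpow, norm_mul, norm_zpow, Circle.norm_coe, one_zpow, one_mul]
    gcongr
    exact norm_invGeomSum_le N _
  · simpa only [mul_assoc] using (hasSum_eval₂ ζ (Circle.exp τ) h).mul_right
      (invGeomSum N (Circle.exp τ))

theorem hasSum_eval_pvCauchy (ζ : Circle) (h : Laurent₂ σ) :
    HasSum (fun k : ℤ × ℤ => coeff k h * (ζ : ℂ) ^ (2 * k.1) *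
      (if 1 ≤ k.2 then -1 / 2 else 1 / 2)) (eval ζ (pvCauchy h)) := by
  refine (Wiener.hasSum_apply (eval ζ ∘L pvCauchy) h).congr_fun fun k => ?_
  have h_monomial : pvCauchy (Wiener.monomial (expWeight₂ σ) k) =
      (if 1 ≤ k.2 then -1 / 2 else 1 / 2 : ℝ) • ξpow k.1 :=
    pvCauchy_ξtpow k.1 k.2
  rw [ContinuousLinearMap.comp_apply, h_monomial, map_smul, eval_ξpow, Complex.real_smul,
    Complex.real_smul]
  split_ifs <;> · push_cast; ring

theorem tendsto_integral_eval₂_mul_invGeomSum (ζ : Circle) (h : Laurent₂ σ) :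
    Tendsto (fun N => ∫ τ in (-Real.pi)..Real.pi,
        eval₂ ζ (Circle.exp τ) h * invGeomSum N (Circle.exp τ)) atTop
      (𝓝 (2 * Real.pi * (eval₂ ζ 1 h / 2 - eval ζ (pvCauchy h)))) := by
  have h_limit : HasSum (fun k : ℤ × ℤ => coeff k h * (ζ : ℂ) ^ (2 * k.1) *
      if 1 ≤ k.2 then 2 * (Real.pi : ℂ) else 0)
      (2 * Real.pi * (eval₂ ζ 1 h / 2 - eval ζ (pvCauchy h))) := by
    refine ((((hasSum_eval₂ ζ 1 h).div_const 2).sub (hasSum_eval_pvCauchy ζ h)).mul_left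
      (2 * Real.pi : ℂ)).congr_fun fun k => ?_
    split_ifs <;> · simp only [Circle.coe_one, one_zpow]; ring
  simp only [← (hasSum_integral_eval₂_mul_invGeomSum ζ h _).tsum_eq, ← h_limit.tsum_eq]
  refine tendsto_tsum_of_dominated_convergence (bound := fun k => |coeff k h| * (2 * Real.pi))
    ((summable_abs_coeff₂ h).mul_right _) (fun k => tendsto_const_nhds.congr' ?_)
    (.of_forall fun N k => ?_)
  · filter_upwards [eventually_ge_atTop k.2.toNat] with N hN
    congr 1
    exact if_congr (by omega) rfl rfl
  · rw [norm_mul, norm_coeff_mul_zpow]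
    gcongr
    split_ifs
    · simp [abs_of_pos Real.pi_pos]
    · simp [Real.pi_pos.le]

/-- Riemann–Lebesgue lemma on a period. -/
theorem tendsto_integral_mul_circleExp_inv_pow (φ : ℝ → ℂ) :
    Tendsto (fun N : ℕ => ∫ τ in (-Real.pi)..Real.pi, φ τ * ((Circle.exp τ : ℂ)⁻¹) ^ N)
      atTop (𝓝 0) := by
  have h_fourier :=
    Real.tendsto_integral_exp_smul_cocompact ((Ioc (-Real.pi) Real.pi).indicator φ)
  have h_freq : Tendsto (fun N : ℕ => (N : ℝ) / (2 * Real.pi)) atTop (cocompact ℝ) :=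
    (tendsto_natCast_atTop_atTop.atTop_div_const (by positivity)).mono_right atTop_le_cocompact
  refine (h_fourier.comp h_freq).congr fun N => ?_
  rw [Function.comp_apply, intervalIntegral.integral_of_le (by linarith [Real.pi_pos]),
    ← integral_indicator measurableSet_Ioc]
  refine integral_congr_ae (.of_forall fun τ => ?_)
  by_cases hτ : τ ∈ Ioc (-Real.pi) Real.pi
  · simp only [indicator_of_mem hτ]
    rw [Circle.smul_def, smul_eq_mul, mul_comm, Real.fourierChar_apply, Circle.coe_exp,
      ← Complex.exp_neg, ← Complex.exp_nat_mul]
    congr 2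
    have := Complex.ofReal_ne_zero.2 Real.pi_ne_zero
    push_cast
    field_simp
  · simp [indicator_of_notMem hτ]

theorem div_sub_div_mul_inv_pow (x y : ℂ) (t : Circle) (hxy : (t : ℂ) = 1 → x = y) (N : ℕ) :
    (x - y) / (1 - t) - (x - y) / (1 - t) * ((t : ℂ)⁻¹) ^ N =
      y * invGeomSum N t - x * invGeomSum N t := by
  by_cases ht : (t : ℂ) = 1
  · simp [hxy ht]
  · have h_ne : (1 - t : ℂ) ≠ 0 := sub_ne_zero.2 (Ne.symm ht)
    have h_geom : (1 - t : ℂ) * invGeomSum N t = ((t : ℂ)⁻¹) ^ N - 1 := one_sub_mul_sum_inv t N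
    linear_combination (x - y) / (1 - t) * h_geom - invGeomSum N t * div_mul_cancel₀ (x - y) h_ne

/-- The Cauchy kernel `h/(1 - t)` at `t = e^{iτ}` with its singularity at `t = 1` subtracted. -/
def regularKernel (ζ : Circle) (h : Laurent₂ σ) (τ : ℝ) : ℂ :=
  (eval₂ ζ (Circle.exp τ) h - eval₂ ζ 1 h) / (1 - Circle.exp τ)

theorem integral_regularKernel (ζ : Circle) (h : Laurent₂ σ)
    (h_int : IntervalIntegrable (regularKernel ζ h) volume (-Real.pi) Real.pi) :
    (2 * Real.pi : ℂ)⁻¹ * (∫ τ in (-Real.pi)..Real.pi, regularKernel ζ h τ) + eval₂ ζ 1 h / 2 =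
      eval ζ (pvCauchy h) := by
  have h_pow (N : ℕ) : Continuous fun τ : ℝ => ((Circle.exp τ : ℂ)⁻¹) ^ N := by
    simpa only [zpow_neg, zpow_natCast, inv_pow] using continuous_circleExp_zpow (-N)
  have h_sum_zero (N : ℕ) : ∫ τ in (-Real.pi)..Real.pi, invGeomSum N (Circle.exp τ) = 0 := by
    simpa using integral_zpow_mul_invGeomSum 0 N
  have h_partial (N : ℕ) : (∫ τ in (-Real.pi)..Real.pi, regularKernel ζ h τ) -
      (∫ τ in (-Real.pi)..Real.pi, regularKernel ζ h τ * ((Circle.exp τ : ℂ)⁻¹) ^ N) =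
      -∫ τ in (-Real.pi)..Real.pi,
        eval₂ ζ (Circle.exp τ) h * invGeomSum N (Circle.exp τ) := by
    have h_telescope (τ : ℝ) :
        regularKernel ζ h τ - regularKernel ζ h τ * ((Circle.exp τ : ℂ)⁻¹) ^ N =
        eval₂ ζ 1 h * invGeomSum N (Circle.exp τ) -
          eval₂ ζ (Circle.exp τ) h * invGeomSum N (Circle.exp τ) :=
      div_sub_div_mul_inv_pow _ _ _ (fun ht => by rw [Circle.coe_eq_one.1 ht]) N
    have h_cont : Continuous fun τ : ℝ =>
        eval₂ ζ (Circle.exp τ) h * invGeomSum N (Circle.exp τ) :=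
      (continuous_eval₂_circleExp ζ h).mul (continuous_invGeomSum N)
    rw [← intervalIntegral.integral_sub h_int (h_int.mul_continuousOn (h_pow N).continuousOn)]
    simp only [h_telescope]
    rw [intervalIntegral.integral_sub
      (((continuous_invGeomSum N).intervalIntegrable _ _).const_mul _)
      (h_cont.intervalIntegrable _ _), intervalIntegral.integral_const_mul, h_sum_zero, mul_zero,
      zero_sub]
  have h_integral : ∫ τ in (-Real.pi)..Real.pi, regularKernel ζ h τ =
      -(2 * Real.pi * (eval₂ ζ 1 h / 2 - eval ζ (pvCauchy h))) := by
    have h_lim := (tendsto_const_nhds (x := ∫ τ in (-Real.pi)..Real.pi, regularKernel ζ h τ)).sub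
      (tendsto_integral_mul_circleExp_inv_pow (regularKernel ζ h))
    simp only [h_partial, sub_zero] at h_lim
    exact tendsto_nhds_unique h_lim (tendsto_integral_eval₂_mul_invGeomSum ζ h).neg
  have hπ := Complex.ofReal_ne_zero.2 Real.pi_ne_zero
  rw [h_integral]
  field_simp
  ring

theorem circleExp_ne_one {τ : ℝ} (h₀ : τ ≠ 0) (hτ : |τ| ≤ Real.pi) : (Circle.exp τ : ℂ) ≠ 1 := by
  rw [Ne, Circle.coe_eq_one, Circle.exp_eq_one]
  rintro ⟨n, hn⟩
  have hn₀ : n ≠ 0 := by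
    rintro rfl
    exact h₀ (by simpa using hn)
  have h_one : (1 : ℝ) ≤ |(n : ℝ)| := by exact_mod_cast Int.one_le_abs hn₀
  rw [hn, abs_mul, abs_of_pos (show 0 < 2 * Real.pi by positivity)] at hτ
  nlinarith [Real.pi_pos]

theorem ae_circleExp_ne_one :
    ∀ᵐ τ : ℝ, τ ∈ uIoc (-Real.pi) Real.pi → (Circle.exp τ : ℂ) ≠ 1 := by
  filter_upwards [Measure.ae_ne volume (0 : ℝ)] with τ hτ hmem
  rw [uIoc_of_le (by linarith [Real.pi_pos])] at hmem
  exact circleExp_ne_one hτ (abs_le.2 ⟨hmem.1.le, hmem.2⟩)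

theorem inv_one_sub_re {t : Circle} (ht : (t : ℂ) ≠ 1) : ((1 - t : ℂ)⁻¹).re = 1 / 2 := by
  have h_circle : (t : ℂ).re * (t : ℂ).re + (t : ℂ).im * (t : ℂ).im = 1 := Circle.normSq_coe t
  have h_normSq : Complex.normSq (1 - t : ℂ) = 2 * (1 - (t : ℂ).re) := by
    rw [Complex.normSq_apply, Complex.sub_re, Complex.sub_im, Complex.one_re, Complex.one_im]
    linarith
  rw [Complex.inv_re, div_eq_iff (Complex.normSq_eq_zero.not.2 (sub_ne_zero.2 ht.symm)), h_normSq,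
    Complex.sub_re, Complex.one_re]
  ring

theorem inv_one_sub_circleExp_neg_im (τ : ℝ) :
    ((1 - Circle.exp (-τ) : ℂ)⁻¹).im = -((1 - Circle.exp τ : ℂ)⁻¹).im := by
  have h_conj : (1 - Circle.exp (-τ) : ℂ) = (starRingEnd ℂ) (1 - Circle.exp τ) := by
    rw [map_sub, map_one, Circle.exp_neg, Circle.coe_inv_eq_conj]
  rw [h_conj, ← map_inv₀, Complex.conj_im]

theorem measurableSet_puncturedPeriod (θ ε : ℝ) : MeasurableSet (puncturedPeriod θ ε) :=
  (measurableSet_lt measurable_const (measurable_id.sub_const θ).norm).inter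
    (measurableSet_le (measurable_id.sub_const θ).norm measurable_const)

theorem mem_puncturedPeriod_zero {τ ε : ℝ} :
    τ ∈ puncturedPeriod 0 ε ↔ ε < |τ| ∧ |τ| ≤ Real.pi := by
  simp [puncturedPeriod]

theorem puncturedPeriod_zero_subset (ε : ℝ) : puncturedPeriod 0 ε ⊆ Icc (-Real.pi) Real.pi :=
  fun _ hτ => abs_le.1 (mem_puncturedPeriod_zero.1 hτ).2

theorem preimage_sub_puncturedPeriod_zero (θ ε : ℝ) :
    (· - θ) ⁻¹' puncturedPeriod 0 ε = puncturedPeriod θ ε := by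
  simp [puncturedPeriod]

theorem integrableOn_puncturedPeriod_comp_sub {f : ℝ → ℝ} {θ ε : ℝ} :
    IntegrableOn (fun η => f (η - θ)) (puncturedPeriod θ ε) ↔
      IntegrableOn f (puncturedPeriod 0 ε) := by
  rw [← preimage_sub_puncturedPeriod_zero θ]
  exact (measurePreserving_sub_right volume θ).integrableOn_comp_preimage
    (MeasurableEquiv.subRight θ).measurableEmbedding

theorem truncMean_comp_sub (f : ℝ → ℝ) (θ ε : ℝ) :
    truncMean (fun η => f (η - θ)) θ ε = truncMean f 0 ε := by
  rw [truncMean, truncMean, ← preimage_sub_puncturedPeriod_zero θ,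
    (measurePreserving_sub_right volume θ).setIntegral_preimage_emb
      (MeasurableEquiv.subRight θ).measurableEmbedding]

theorem mean_comp_sub {f : ℝ → ℝ} (hf : Function.Periodic f (2 * Real.pi)) (θ : ℝ) :
    mean (fun η => f (η - θ)) = mean f := by
  have h_period := hf.intervalIntegral_add_eq (-Real.pi - θ) (-Real.pi)
  rw [show -Real.pi - θ + 2 * Real.pi = Real.pi - θ by ring,
    show -Real.pi + 2 * Real.pi = Real.pi by ring] at h_period
  rw [mean, mean, intervalIntegral.integral_comp_sub_right, h_period]

theorem intervalIntegrable_comp_sub {f : ℝ → ℝ} (hf : Function.Periodic f (2 * Real.pi))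
    (hf_int : IntervalIntegrable f volume (-Real.pi) Real.pi) (θ : ℝ) :
    IntervalIntegrable (fun η => f (η - θ)) volume (-Real.pi) Real.pi := by
  have h_period : IntervalIntegrable f volume (-Real.pi) (-Real.pi + 2 * Real.pi) := by
    rwa [show -Real.pi + 2 * Real.pi = Real.pi by ring]
  simpa using (hf.intervalIntegrable (by positivity) h_period (-Real.pi - θ)
    (Real.pi - θ)).comp_sub_right θ

theorem tendsto_truncMean_zero {f : ℝ → ℝ} (hf : IntegrableOn f (Icc (-Real.pi) Real.pi)) :
    Tendsto (truncMean f 0) (𝓝[>] 0) (𝓝 (mean f)) := by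
  refine Tendsto.const_mul _ ?_
  rw [intervalIntegral.integral_of_le (by linarith [Real.pi_pos]), ← integral_Icc_eq_integral_Ioc,
    ← integral_indicator measurableSet_Icc]
  simp only [← integral_indicator (measurableSet_puncturedPeriod _ _)]
  refine tendsto_integral_filter_of_dominated_convergence
    (fun τ => ‖(Icc (-Real.pi) Real.pi).indicator f τ‖) (.of_forall fun ε => ?_)
    (.of_forall fun ε => .of_forall fun τ => ?_)
    ((integrable_indicator_iff measurableSet_Icc).2 hf).norm ?_
  · exact ((integrable_indicator_iff (measurableSet_puncturedPeriod 0 ε)).2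
      (hf.mono_set (puncturedPeriod_zero_subset ε))).aestronglyMeasurable
  · exact norm_indicator_le_of_subset (puncturedPeriod_zero_subset ε) f τ
  · filter_upwards [Measure.ae_ne volume 0] with τ hτ
    refine tendsto_const_nhds.congr' ?_
    filter_upwards [Ioo_mem_nhdsGT (abs_pos.2 hτ)] with ε hε
    by_cases h : τ ∈ Icc (-Real.pi) Real.pi
    · rw [indicator_of_mem h, indicator_of_mem (mem_puncturedPeriod_zero.2 ⟨hε.2, abs_le.2 h⟩)]
    · rw [indicator_of_notMem h,
        indicator_of_notMem fun h_mem => h (puncturedPeriod_zero_subset ε h_mem)]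

theorem truncMean_zero_of_odd {f : ℝ → ℝ} (hf : ∀ τ, f (-τ) = -f τ) (ε : ℝ) :
    truncMean f 0 ε = 0 := by
  have h_odd (τ : ℝ) : (puncturedPeriod 0 ε).indicator f (-τ) =
      -(puncturedPeriod 0 ε).indicator f τ := by
    have h_mem : -τ ∈ puncturedPeriod 0 ε ↔ τ ∈ puncturedPeriod 0 ε := by
      rw [mem_puncturedPeriod_zero, mem_puncturedPeriod_zero, abs_neg]
    by_cases hτ : τ ∈ puncturedPeriod 0 ε
    · rw [indicator_of_mem hτ, indicator_of_mem (h_mem.2 hτ), hf]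
    · rw [indicator_of_notMem hτ, indicator_of_notMem (h_mem.not.2 hτ), neg_zero]
  have h_neg := integral_neg_eq_self ((puncturedPeriod 0 ε).indicator f) volume
  simp only [h_odd, integral_neg] at h_neg
  rw [truncMean, ← integral_indicator (measurableSet_puncturedPeriod 0 ε),
    neg_eq_self.1 h_neg, mul_zero]

theorem integrableOn_inv_one_sub_im {ε : ℝ} (hε : 0 < ε) :
    IntegrableOn (fun τ => ((1 - Circle.exp τ : ℂ)⁻¹).im) (puncturedPeriod 0 ε) := by
  have h_compact : IsCompact (Icc (-Real.pi) Real.pi ∩ {τ : ℝ | ε ≤ |τ|}) :=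
    isCompact_Icc.inter_right (isClosed_le continuous_const continuous_abs)
  refine IntegrableOn.mono_set (ContinuousOn.integrableOn_compact h_compact ?_) fun τ hτ =>
    ⟨puncturedPeriod_zero_subset ε hτ, (mem_puncturedPeriod_zero.1 hτ).1.le⟩
  refine Complex.continuous_im.comp_continuousOn (ContinuousOn.inv₀ (continuous_const.sub
    (continuous_subtype_val.comp Circle.exp.continuous)).continuousOn fun τ hτ => ?_)
  have hτ₀ : τ ≠ 0 := abs_pos.1 (hε.trans_le hτ.2)
  exact sub_ne_zero.2 (circleExp_ne_one hτ₀ (abs_le.2 hτ.1)).symm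

/-- The Cauchy kernel `h/(1 - t)` at `t = e^{iτ}`. -/
def cauchyKernel (ζ : Circle) (h : Laurent₂ σ) (τ : ℝ) : ℂ :=
  eval₂ ζ (Circle.exp τ) h / (1 - Circle.exp τ)

theorem periodic_cauchyKernel (ζ : Circle) (h : Laurent₂ σ) :
    Function.Periodic (cauchyKernel ζ h) (2 * Real.pi) := fun τ => by
  rw [cauchyKernel, cauchyKernel, Circle.exp_add, Circle.exp_two_pi, mul_one]

/-- Lipschitz continuity at `t = 1` of `t ↦ h(ζ, t)` on the unit circle, which makes the
regularised kernel of `h` bounded. -/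
def LipschitzAtOne (ζ : Circle) (h : Laurent₂ σ) : Prop :=
  (fun t : Circle => eval₂ ζ t h - eval₂ ζ 1 h) =O[⊤] fun t => (t : ℂ) - 1

theorem isBigO_eval₂_one (ζ : Circle) (h : Laurent₂ σ) :
    (fun t => eval₂ ζ t h) =O[⊤] fun _ => (1 : ℂ) :=
  Asymptotics.isBigO_top.2 ⟨‖h‖, fun t => by simpa using norm_eval₂_le ζ t h⟩

theorem eval₂_ringInverse {h : Laurent₂ σ} (hh : IsUnit h) (ζ t : Circle) :
    eval₂ ζ t (Ring.inverse h) = (eval₂ ζ t h)⁻¹ := by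
  refine eq_inv_of_mul_eq_one_right ?_
  rw [← eval₂_mul, Ring.mul_inverse_cancel _ hh, eval₂_one]

theorem eval₂_ne_zero {h : Laurent₂ σ} (hh : IsUnit h) (ζ t : Circle) : eval₂ ζ t h ≠ 0 := by
  refine left_ne_zero_of_mul_eq_one (b := eval₂ ζ t (Ring.inverse h)) ?_
  rw [← eval₂_mul, Ring.mul_inverse_cancel _ hh, eval₂_one]

namespace LipschitzAtOne

variable {ζ : Circle} {h h₁ h₂ : Laurent₂ σ}

theorem one (ζ : Circle) : LipschitzAtOne ζ (1 : Laurent₂ σ) := by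
  simp only [LipschitzAtOne, eval₂_one, sub_self]
  exact Asymptotics.isBigO_zero _ _

theorem add (hh₁ : LipschitzAtOne ζ h₁) (hh₂ : LipschitzAtOne ζ h₂) :
    LipschitzAtOne ζ (h₁ + h₂) :=
  (Asymptotics.IsBigO.add hh₁ hh₂).congr_left fun t => by
    rw [map_add, map_add, add_sub_add_comm]

theorem const_smul (hh : LipschitzAtOne ζ h) (c : ℝ) : LipschitzAtOne ζ (c • h) :=
  (Asymptotics.IsBigO.const_smul_left hh c).congr_left fun t => by
    rw [Pi.smul_apply, map_smul, map_smul, smul_sub]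

theorem mul (hh₁ : LipschitzAtOne ζ h₁) (hh₂ : LipschitzAtOne ζ h₂) :
    LipschitzAtOne ζ (h₁ * h₂) := by
  have h_left := Asymptotics.IsBigO.mul hh₁ (isBigO_eval₂_one ζ h₂)
  have h_right := Asymptotics.IsBigO.const_mul_left hh₂ (eval₂ ζ 1 h₁)
  simp only [mul_one] at h_left
  refine (h_left.add h_right).congr_left fun t => ?_
  rw [eval₂_mul, eval₂_mul]
  ring

theorem ringInverse (hh : LipschitzAtOne ζ h) (h_unit : IsUnit h) :
    LipschitzAtOne ζ (Ring.inverse h) := by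
  have h_mul := (Asymptotics.IsBigO.mul hh (isBigO_eval₂_one ζ (Ring.inverse h))).const_mul_left
    (-(eval₂ ζ 1 h)⁻¹)
  simp only [mul_one] at h_mul
  refine h_mul.congr_left fun t => ?_
  have h_ne_one := eval₂_ne_zero h_unit ζ 1
  have h_ne := eval₂_ne_zero h_unit ζ t
  rw [eval₂_ringInverse h_unit, eval₂_ringInverse h_unit]
  field_simp
  ring

theorem integrableOn_regularKernel (hh : LipschitzAtOne ζ h) :
    IntegrableOn (regularKernel ζ h) (Icc (-Real.pi) Real.pi) := by
  obtain ⟨C, hC, h_lip⟩ := Asymptotics.IsBigO.exists_nonneg hh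
  refine Measure.integrableOn_of_bounded (M := C) (by simp) ?_ (.of_forall fun τ => ?_)
  · exact (((continuous_eval₂_circleExp ζ h).sub continuous_const).measurable.div
      (continuous_const.sub
        (continuous_subtype_val.comp Circle.exp.continuous)).measurable).aestronglyMeasurable
  · rw [regularKernel, norm_div, norm_sub_rev (1 : ℂ)]
    exact div_le_of_le_mul₀ (norm_nonneg _) hC
      (Asymptotics.isBigOWith_top.1 h_lip (Circle.exp τ))

end LipschitzAtOne

section

variable {ζ : Circle} {h : Laurent₂ σ} {κ : ℂ} {γ : ℝ}

theorem mul_cauchyKernel_eq (hκ : κ * eval₂ ζ 1 h = Complex.I * γ) (τ : ℝ) :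
    κ * cauchyKernel ζ h τ =
      κ * regularKernel ζ h τ + Complex.I * (γ * (1 - Circle.exp τ : ℂ)⁻¹) := by
  rw [cauchyKernel, regularKernel, ← mul_assoc Complex.I, ← hκ]
  ring

theorem mul_cauchyKernel_re (hκ : κ * eval₂ ζ 1 h = Complex.I * γ) (τ : ℝ) :
    (κ * cauchyKernel ζ h τ).re =
      (κ * regularKernel ζ h τ).re - γ * ((1 - Circle.exp τ : ℂ)⁻¹).im := by
  rw [mul_cauchyKernel_eq hκ, Complex.add_re, Complex.I_mul_re, Complex.im_ofReal_mul,
    ← sub_eq_add_neg]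

theorem mul_cauchyKernel_im (hκ : κ * eval₂ ζ 1 h = Complex.I * γ) {τ : ℝ}
    (hτ : (Circle.exp τ : ℂ) ≠ 1) :
    (κ * cauchyKernel ζ h τ).im = (κ * regularKernel ζ h τ).im + γ / 2 := by
  rw [mul_cauchyKernel_eq hκ, Complex.add_im, Complex.I_mul_im, Complex.re_ofReal_mul,
    inv_one_sub_re hτ, mul_one_div]

theorem mul_eval_pvCauchy (hκ : κ * eval₂ ζ 1 h = Complex.I * γ)
    (h_int : IntegrableOn (regularKernel ζ h) (Icc (-Real.pi) Real.pi)) :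
    κ * eval ζ (pvCauchy h) =
      ((2 * Real.pi)⁻¹ : ℝ) * (∫ τ in (-Real.pi)..Real.pi, κ * regularKernel ζ h τ) +
        Complex.I * ((γ / 2 : ℝ) : ℂ) := by
  rw [← integral_regularKernel ζ h ((intervalIntegrable_iff_integrableOn_Icc_of_le
    (by linarith [Real.pi_pos])).2 h_int), intervalIntegral.integral_const_mul]
  push_cast
  linear_combination (1 / 2) * hκ

theorem mul_eval_pvCauchy_re (hκ : κ * eval₂ ζ 1 h = Complex.I * γ)
    (h_int : IntegrableOn (regularKernel ζ h) (Icc (-Real.pi) Real.pi)) :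
    (κ * eval ζ (pvCauchy h)).re = mean fun τ => (κ * regularKernel ζ h τ).re := by
  have h_re := Complex.reCLM.intervalIntegral_comp_comm
    (((intervalIntegrable_iff_integrableOn_Icc_of_le (by linarith [Real.pi_pos])).2
      h_int).const_mul κ)
  simp only [Complex.reCLM_apply] at h_re
  rw [mul_eval_pvCauchy hκ h_int, mean, h_re, Complex.add_re, Complex.re_ofReal_mul,
    Complex.I_mul_re, Complex.ofReal_im, neg_zero, add_zero]

theorem mul_eval_pvCauchy_im (hκ : κ * eval₂ ζ 1 h = Complex.I * γ)
    (h_int : IntegrableOn (regularKernel ζ h) (Icc (-Real.pi) Real.pi)) :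
    (κ * eval ζ (pvCauchy h)).im = mean (fun τ => (κ * regularKernel ζ h τ).im) + γ / 2 := by
  have h_im := Complex.imCLM.intervalIntegral_comp_comm
    (((intervalIntegrable_iff_integrableOn_Icc_of_le (by linarith [Real.pi_pos])).2
      h_int).const_mul κ)
  simp only [Complex.imCLM_apply] at h_im
  rw [mul_eval_pvCauchy hκ h_int, mean, h_im, Complex.add_im, Complex.im_ofReal_mul,
    Complex.I_mul_im, Complex.ofReal_re]

theorem integrableOn_mul_cauchyKernel_re (hκ : κ * eval₂ ζ 1 h = Complex.I * γ)
    (h_int : IntegrableOn (regularKernel ζ h) (Icc (-Real.pi) Real.pi)) {ε : ℝ} (hε : 0 < ε) :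
    IntegrableOn (fun τ => (κ * cauchyKernel ζ h τ).re) (puncturedPeriod 0 ε) := by
  simp only [mul_cauchyKernel_re hκ]
  exact ((h_int.mono_set (puncturedPeriod_zero_subset ε)).const_mul κ).re.sub
    ((integrableOn_inv_one_sub_im hε).const_mul γ)

theorem tendsto_truncMean_mul_cauchyKernel_re (hκ : κ * eval₂ ζ 1 h = Complex.I * γ)
    (h_int : IntegrableOn (regularKernel ζ h) (Icc (-Real.pi) Real.pi)) :
    Tendsto (truncMean (fun τ => (κ * cauchyKernel ζ h τ).re) 0) (𝓝[>] 0)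
      (𝓝 (κ * eval ζ (pvCauchy h)).re) := by
  have h_re : IntegrableOn (fun τ => (κ * regularKernel ζ h τ).re) (Icc (-Real.pi) Real.pi) :=
    (h_int.const_mul κ).re
  rw [mul_eval_pvCauchy_re hκ h_int]
  refine (tendsto_truncMean_zero h_re).congr' ?_
  filter_upwards [self_mem_nhdsWithin] with ε hε
  have h_odd := truncMean_zero_of_odd (f := fun τ => ((1 - Circle.exp τ : ℂ)⁻¹).im)
    inv_one_sub_circleExp_neg_im ε
  simp only [truncMean, mul_cauchyKernel_re hκ] at h_odd ⊢
  rw [integral_sub (h_re.mono_set (puncturedPeriod_zero_subset ε))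
    ((integrableOn_inv_one_sub_im hε).const_mul γ), integral_const_mul, mul_sub, mul_left_comm,
    h_odd, mul_zero, sub_zero]

theorem intervalIntegrable_mul_cauchyKernel_im (hκ : κ * eval₂ ζ 1 h = Complex.I * γ)
    (h_int : IntegrableOn (regularKernel ζ h) (Icc (-Real.pi) Real.pi)) :
    IntervalIntegrable (fun τ => (κ * cauchyKernel ζ h τ).im) volume (-Real.pi) Real.pi := by
  have h_im : IntervalIntegrable (fun τ => (κ * regularKernel ζ h τ).im + γ / 2) volume
      (-Real.pi) Real.pi :=
    ((intervalIntegrable_iff_integrableOn_Icc_of_le (by linarith [Real.pi_pos])).2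
      (h_int.const_mul κ).im).add intervalIntegrable_const
  refine h_im.congr_ae ?_
  rw [EventuallyEq, ae_restrict_iff' measurableSet_uIoc]
  filter_upwards [ae_circleExp_ne_one] with τ hτ hmem
  exact (mul_cauchyKernel_im hκ (hτ hmem)).symm

theorem mean_mul_cauchyKernel_im (hκ : κ * eval₂ ζ 1 h = Complex.I * γ)
    (h_int : IntegrableOn (regularKernel ζ h) (Icc (-Real.pi) Real.pi)) :
    mean (fun τ => (κ * cauchyKernel ζ h τ).im) = (κ * eval ζ (pvCauchy h)).im := by
  have h_im : IntervalIntegrable (fun τ => (κ * regularKernel ζ h τ).im) volume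
      (-Real.pi) Real.pi :=
    (intervalIntegrable_iff_integrableOn_Icc_of_le (by linarith [Real.pi_pos])).2
      (h_int.const_mul κ).im
  have h_congr : ∫ τ in (-Real.pi)..Real.pi, (κ * cauchyKernel ζ h τ).im =
      ∫ τ in (-Real.pi)..Real.pi, ((κ * regularKernel ζ h τ).im + γ / 2) := by
    refine intervalIntegral.integral_congr_ae ?_
    filter_upwards [ae_circleExp_ne_one] with τ hτ hmem
    exact mul_cauchyKernel_im hκ (hτ hmem)
  have hπ := Real.pi_ne_zero
  rw [mul_eval_pvCauchy_im hκ h_int, mean, mean, h_congr,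
    intervalIntegral.integral_add h_im intervalIntegrable_const, intervalIntegral.integral_const,
    smul_eq_mul]
  field_simp
  ring

end

/-! ### The functions defined by the unknowns of the rescaled equation -/

theorem circleExp_pow_add_inv (n : ℕ) (θ : ℝ) :
    (Circle.exp θ : ℂ) ^ (2 * n) + ((Circle.exp θ : ℂ) ^ (2 * n))⁻¹ =
      2 * Complex.cos (2 * n * θ) := by
  rw [Circle.coe_exp, ← Complex.exp_nat_mul, ← Complex.exp_neg, Complex.two_cos]
  push_cast
  congr 2 <;> ring

theorem circleExp_pow_sub_inv (n : ℕ) (θ : ℝ) :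
    (Circle.exp θ : ℂ) ^ (2 * n) - ((Circle.exp θ : ℂ) ^ (2 * n))⁻¹ =
      2 * Complex.I * Complex.sin (2 * n * θ) := by
  rw [Circle.coe_exp, ← Complex.exp_nat_mul, ← Complex.exp_neg, mul_right_comm, Complex.two_sin,
    mul_assoc, Complex.I_mul_I, show (((2 * n : ℕ) : ℂ) * (θ * Complex.I)) =
      2 * n * θ * Complex.I by push_cast; ring, neg_mul]
  ring

theorem eval_evenSeries (a : L1 ℕ) (θ : ℝ) :
    eval (Circle.exp θ) (evenSeries a : Laurent σ) = (onReal (cosSeries σ a) θ : ℂ) := by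
  rw [← cosSeries_ofReal]
  have h_sum := L1.hasSum_apply
    (eval (Circle.exp θ) ∘L (evenSeries : L1 ℕ →L[ℝ] Laurent σ)) a
  refine HasSum.unique (h_sum.congr_fun fun k => ?_)
    (hasSum_cosSeries a (ofReal_mem_strip θ))
  rw [ContinuousLinearMap.comp_apply, evenSeries_unit, map_smul, eval_evenMode,
    circleExp_pow_add_inv, Complex.real_smul, Complex.real_smul, cosTerm]
  push_cast
  ring

theorem norm_deriv_cosTerm_ofReal_le (hσ : 0 < σ) (k : ℕ) (θ : ℝ) :
    ‖deriv (cosTerm σ k) θ‖ ≤ 4 * (σ : ℝ)⁻¹ := by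
  have h_arg : (4 * (k + 1) * Complex.sin (2 * (k + 1) * θ) : ℂ) =
      ((4 * (k + 1) * Real.sin (2 * (k + 1) * θ) : ℝ) : ℂ) := by
    push_cast
    rfl
  have h_le := natCast_le_inv_mul_exp_pow hσ (k + 1)
  push_cast at h_le
  rw [deriv_cosTerm, h_arg, norm_neg, norm_mul, Complex.norm_real, Complex.norm_real, norm_inv,
    Real.norm_of_nonneg (by positivity : (0 : ℝ) ≤ Real.exp σ ^ (k + 1)),
    inv_mul_le_iff₀ (by positivity), norm_mul,
    Real.norm_of_nonneg (by positivity : (0 : ℝ) ≤ 4 * (k + 1))]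
  calc (4 * (k + 1) : ℝ) * ‖Real.sin (2 * (k + 1) * θ)‖
      ≤ 4 * ((σ : ℝ)⁻¹ * Real.exp σ ^ (k + 1)) * 1 := by
        gcongr
        exact Real.abs_sin_le_one _
    _ = Real.exp σ ^ (k + 1) * (4 * (σ : ℝ)⁻¹) := by ring

/-- The derivative at the real point `θ` of the cosine series with given coefficients. -/
def derivAt (hσ : 0 < σ) (θ : ℝ) : L1 ℕ →L[ℝ] ℂ :=
  L1.lift (fun k => deriv (cosTerm σ k) θ) (4 * (σ : ℝ)⁻¹) fun k =>
    norm_deriv_cosTerm_ofReal_le hσ k θ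

theorem derivAt_unit (hσ : 0 < σ) (θ : ℝ) (k : ℕ) :
    derivAt hσ θ (L1.unit k) = deriv (cosTerm σ k) θ :=
  L1.lift_unit _ _

theorem derivAt_eq (hσ : 0 < σ) (θ : ℝ) (a : L1 ℕ) :
    derivAt hσ θ a = (deriv (onReal (cosSeries σ a)) θ : ℝ) := by
  rw [← deriv_cosSeries_ofReal hσ]
  have h_sum : HasSum (fun k => a k • deriv (cosTerm σ k) θ) (derivAt hσ θ a) :=
    L1.hasSum_lift _ a
  refine HasSum.unique (h_sum.congr_fun fun k => ?_)
    (hasSum_deriv_cosSeries a (ofReal_mem_openStrip hσ θ))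
  rw [Complex.real_smul]

theorem eval_derivTail (hσ : 0 < σ) (u : L1 ℕ) (θ : ℝ) :
    eval (Circle.exp θ) (derivTail u : Laurent σ) =
      -Complex.I * derivAt hσ θ (shiftDiv u) := by
  have h : eval (Circle.exp θ) ∘L (derivTail : L1 ℕ →L[ℝ] Laurent σ) =
      ContinuousLinearMap.mul ℝ ℂ (-Complex.I) ∘L derivAt hσ θ ∘L shiftDiv := by
    refine L1.clm_ext fun k => ?_
    rw [ContinuousLinearMap.comp_apply, ContinuousLinearMap.comp_apply,
      ContinuousLinearMap.comp_apply, derivTail_unit, shiftDiv_unit, map_smul, map_smul, map_smul,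
      eval_oddMode, circleExp_pow_sub_inv, derivAt_unit, deriv_cosTerm,
      ContinuousLinearMap.mul_apply']
    simp only [Complex.real_smul]
    have : (k + 1 : ℂ) ≠ 0 := by exact_mod_cast Nat.succ_ne_zero k
    push_cast
    rw [show (k + 1 + 1 : ℂ) = k + 2 by ring]
    field_simp
    ring
  exact congrArg (fun T => T u) h

variable (σ) in
/-- The cosine coefficients of the perturbation `r` of the radius. -/
def radiusCoeff (s Y : ℝ) (u : L1 ℕ) : L1 ℕ :=
  s • ((Real.exp σ * Y) • (L1.unit 0 : L1 ℕ) + s • shiftDiv u)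

variable (σ) in
/-- The perturbation `r` of the radius. -/
def radiusFun (s Y : ℝ) (u : L1 ℕ) : ℝ → ℝ := onReal (cosSeries σ (radiusCoeff σ s Y u))

variable (σ) in
/-- The perturbation `g` of the constant strength. -/
def strengthFun (s : ℝ) (g : L1 ℕ) : ℝ → ℝ := onReal (cosSeries σ (s ^ 2 • g))

theorem smul_radius (s Y : ℝ) (u : L1 ℕ) :
    s • (radius s Y u : Laurent σ) = evenSeries (radiusCoeff σ s Y u) := by
  rw [radiusCoeff, radius, map_smul, map_add, map_smul, map_smul, evenSeries_unit, cosTwo,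
    smul_smul, zero_add, pow_one, mul_right_comm, mul_inv_cancel₀ (Real.exp_ne_zero _), one_mul]

theorem eval_radius (s Y : ℝ) (u : L1 ℕ) (θ : ℝ) :
    eval (Circle.exp θ) (s • radius s Y u : Laurent σ) = (radiusFun σ s Y u θ : ℂ) := by
  rw [smul_radius, eval_evenSeries, radiusFun]

theorem eval_radiusDeriv (hσ : 0 < σ) (s Y : ℝ) (u : L1 ℕ) (θ : ℝ) :
    eval (Circle.exp θ) (s • radiusDeriv s Y u : Laurent σ) =
      -Complex.I * (deriv (radiusFun σ s Y u) θ : ℝ) := by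
  have h_exp : (Complex.exp σ : ℂ) ≠ 0 := Complex.exp_ne_zero _
  rw [radiusFun, ← derivAt_eq hσ, radiusCoeff, radiusDeriv]
  simp only [map_smul, map_add, eval_derivTail hσ, derivAt_unit, deriv_cosTerm, eval_oddMode,
    circleExp_pow_sub_inv, Complex.real_smul]
  push_cast
  field_simp
  ring_nf

theorem eval_smul_evenSeries (s : ℝ) (g : L1 ℕ) (θ : ℝ) :
    eval (Circle.exp θ) (s ^ 2 • evenSeries g : Laurent σ) = (strengthFun σ s g θ : ℂ) := by
  rw [← map_smul evenSeries, eval_evenSeries, strengthFun]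

theorem eval₂_strength (s : ℝ) (g : L1 ℕ) (θ τ : ℝ) :
    eval₂ (Circle.exp θ) (Circle.exp τ) (strength s g : Laurent₂ σ) =
      ((2 + s + strengthFun σ s g (θ + τ) : ℝ) : ℂ) := by
  rw [strength, map_add, map_smul, ← map_smul subst, eval₂_one, eval₂_subst,
    ← Circle.exp_add, eval_smul_evenSeries, Complex.real_smul]
  push_cast
  ring

theorem one_sub_mul_eval₂_divDiffTail (ζ t : Circle) (u : L1 ℕ) :
    (1 - t : ℂ) * eval₂ ζ t (divDiffTail u : Laurent₂ σ) =
      eval ζ (evenSeries (shiftDiv u) : Laurent σ) -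
        t * eval (ζ * t) (evenSeries (shiftDiv u) : Laurent σ) := by
  have h : ContinuousLinearMap.mul ℝ ℂ (1 - t : ℂ) ∘L eval₂ ζ t ∘L
        (divDiffTail : L1 ℕ →L[ℝ] Laurent₂ σ) =
      (eval ζ - ContinuousLinearMap.mul ℝ ℂ (t : ℂ) ∘L eval (ζ * t)) ∘L
        (evenSeries : L1 ℕ →L[ℝ] Laurent σ) ∘L shiftDiv := by
    refine L1.clm_ext fun k => ?_
    simp only [ContinuousLinearMap.comp_apply, divDiffTail_unit, shiftDiv_unit, map_smul,
      evenSeries_unit, ContinuousLinearMap.mul_apply', one_sub_mul_eval₂_divDiffMode, sub_apply]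
    module
  exact congrArg (fun T => T u) h

theorem eval₂_one_divDiffTail (ζ : Circle) (u : L1 ℕ) :
    eval₂ ζ 1 (divDiffTail u : Laurent₂ σ) =
      eval ζ (evenSeries (shiftDiv u) : Laurent σ) + eval ζ (derivTail u : Laurent σ) := by
  have h : eval₂ ζ 1 ∘L (divDiffTail : L1 ℕ →L[ℝ] Laurent₂ σ) =
      eval ζ ∘L (evenSeries ∘L shiftDiv + derivTail : L1 ℕ →L[ℝ] Laurent σ) := by
    refine L1.clm_ext fun k => ?_
    have : (k + 1 : ℝ) ≠ 0 := by positivity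
    simp only [ContinuousLinearMap.comp_apply, divDiffTail_unit, shiftDiv_unit, map_smul, map_add,
      evenSeries_unit, derivTail_unit, add_apply, eval₂_one_divDiffMode]
    push_cast
    match_scalars
    · field_simp
    · field_simp
      ring
  simpa only [ContinuousLinearMap.comp_apply, add_apply, map_add] using congrArg (fun T => T u) h

theorem one_sub_mul_eval₂_divDiff (s Y : ℝ) (u : L1 ℕ) (θ τ : ℝ) :
    (1 - Circle.exp τ : ℂ) *
        eval₂ (Circle.exp θ) (Circle.exp τ) (1 + s • divDiff s Y u : Laurent₂ σ) =
      (1 + radiusFun σ s Y u θ) - Circle.exp τ * (1 + radiusFun σ s Y u (θ + τ)) := by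
  rw [← eval_radius, ← eval_radius, Circle.exp_add, divDiff, radius, cosTwo, map_add, eval₂_one]
  simp only [map_smul, map_add, Complex.real_smul]
  linear_combination
    (s * Y : ℂ) * one_sub_mul_eval₂_divDiffMode (σ := σ) (Circle.exp θ) (Circle.exp τ) 0 +
      (s * s : ℂ) * one_sub_mul_eval₂_divDiffTail (σ := σ) (Circle.exp θ) (Circle.exp τ) u

theorem eval₂_one_divDiff (hσ : 0 < σ) (s Y : ℝ) (u : L1 ℕ) (θ : ℝ) :
    eval₂ (Circle.exp θ) 1 (1 + s • divDiff s Y u : Laurent₂ σ) =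
      1 + radiusFun σ s Y u θ - Complex.I * (deriv (radiusFun σ s Y u) θ : ℝ) := by
  have h_deriv := eval_radiusDeriv hσ s Y u θ
  rw [neg_mul] at h_deriv
  rw [sub_eq_add_neg, ← h_deriv, ← eval_radius, divDiff, radius, radiusDeriv, cosTwo, map_add,
    eval₂_one]
  simp only [map_smul, map_add, Complex.real_smul, eval₂_one_divDiffTail, eval₂_one_divDiffMode]
  push_cast
  ring

theorem lipschitzAtOne_strength (hσ : 0 < σ) (ζ : Circle) (s : ℝ) (g : L1 ℕ) :
    LipschitzAtOne ζ (strength s g : Laurent₂ σ) := by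
  have h_subst : LipschitzAtOne ζ (subst (evenSeries g) : Laurent₂ σ) := by
    refine Asymptotics.isBigO_top.2 ⟨4 * (σ : ℝ)⁻¹ * ‖g‖, fun t => ?_⟩
    rw [eval₂_subst, eval₂_subst, mul_one, mul_right_comm]
    exact norm_eval_mul_evenSeries_sub_le hσ ζ t g
  exact ((LipschitzAtOne.one ζ).const_smul _).add (h_subst.const_smul _)

theorem lipschitzAtOne_divDiff (hσ : 0 < σ) (ζ : Circle) (s Y : ℝ) (u : L1 ℕ) :
    LipschitzAtOne ζ (divDiff s Y u : Laurent₂ σ) := by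
  have h_mode : LipschitzAtOne ζ (divDiffMode 0 : Laurent₂ σ) :=
    Asymptotics.isBigO_top.2 ⟨_, fun t => norm_eval₂_divDiffMode_sub_le ζ t 0⟩
  have h_tail : LipschitzAtOne ζ (divDiffTail u : Laurent₂ σ) := by
    refine Asymptotics.isBigO_top.2 ⟨50 * (σ : ℝ)⁻¹ * ‖u‖, fun t => ?_⟩
    rw [mul_right_comm]
    exact norm_eval₂_divDiffTail_sub_le hσ ζ t u
  exact (h_mode.const_smul _).add (h_tail.const_smul _)

theorem lipschitzAtOne_density (hσ : 0 < σ) {s Y : ℝ} {u : L1 ℕ}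
    (hu : IsUnit (1 + s • divDiff s Y u : Laurent₂ σ)) (ζ : Circle) (g : L1 ℕ) :
    LipschitzAtOne ζ (density s Y g u : Laurent₂ σ) :=
  (lipschitzAtOne_strength hσ ζ s g).mul
    (((LipschitzAtOne.one ζ).add ((lipschitzAtOne_divDiff hσ ζ s Y u).const_smul s)).ringInverse hu)

/-! ### Solutions of the rescaled equation solve the vortex sheet equations -/

/-- The factor `r'(θ) + i (1 + r(θ))`, which turns the complex velocity at the point with angle `θ`
into its normal and tangential components along the curve. -/
def tangent (r : ℝ → ℝ) (θ : ℝ) : ℂ := (deriv r θ : ℝ) + Complex.I * (1 + r θ : ℝ)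

theorem normSq_sub_circleExp_mul (R S τ : ℝ) :
    Complex.normSq (R - Circle.exp τ * S) = R ^ 2 + S ^ 2 - 2 * R * S * Real.cos τ := by
  have h_re_im : (R - Circle.exp τ * S : ℂ) =
      ((R - S * Real.cos τ : ℝ) : ℂ) + ((-(S * Real.sin τ) : ℝ) : ℂ) * Complex.I := by
    rw [Circle.coe_exp, Complex.exp_mul_I]
    push_cast
    ring
  rw [h_re_im, Complex.normSq_add_mul_I]
  linear_combination S ^ 2 * Real.sin_sq_add_cos_sq τ

theorem tangent_mul_div_eq_kernel (b : ℝ) (g r : ℝ → ℝ) (θ τ : ℝ) :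
    tangent r θ * ((b + g (θ + τ) : ℝ) /
        ((1 + r θ : ℝ) - Circle.exp τ * (1 + r (θ + τ) : ℝ))) =
      (-kernel₁ b g r θ (θ + τ) : ℝ) + (kernel₂ b g r θ (θ + τ) : ℝ) * Complex.I := by
  have h_angle : θ - (θ + τ) = -τ := by ring
  rw [kernel₁, kernel₂, distSq, tangent, h_angle, Real.cos_neg, Real.sin_neg, div_eq_mul_inv,
    Complex.inv_def, normSq_sub_circleExp_mul, map_sub, map_mul, Complex.conj_ofReal,
    Complex.conj_ofReal, ← Circle.coe_inv_eq_conj, ← Circle.exp_neg, Circle.coe_exp,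
    Complex.exp_mul_I]
  push_cast
  rw [Complex.cos_neg, Complex.sin_neg, div_eq_mul_inv, div_eq_mul_inv]
  linear_combination ((1 + r θ) * (1 + r (θ + τ)) * Complex.sin τ * (b + g (θ + τ)) *
    ((1 + r θ) ^ 2 + (1 + r (θ + τ)) ^ 2 -
      2 * (1 + r θ) * (1 + r (θ + τ)) * Complex.cos τ : ℂ)⁻¹) * Complex.I_sq

section

variable {s ν Y : ℝ} {g u : L1 ℕ}

theorem cauchyKernel_density (hu : IsUnit (1 + s • divDiff s Y u : Laurent₂ σ)) (θ τ : ℝ) :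
    cauchyKernel (Circle.exp θ) (density s Y g u : Laurent₂ σ) τ =
      (2 + s + strengthFun σ s g (θ + τ) : ℝ) /
        ((1 + radiusFun σ s Y u θ : ℝ) -
          Circle.exp τ * (1 + radiusFun σ s Y u (θ + τ) : ℝ)) := by
  have h_divDiff := one_sub_mul_eval₂_divDiff (σ := σ) s Y u θ τ
  rw [cauchyKernel, density, eval₂_mul, divDiffInv, eval₂_ringInverse hu, eval₂_strength,
    ← div_eq_mul_inv, div_div, mul_comm (eval₂ _ _ _), h_divDiff]
  push_cast
  rfl

theorem kernel₁_eq (hu : IsUnit (1 + s • divDiff s Y u : Laurent₂ σ)) (θ : ℝ) :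
    kernel₁ (2 + s) (strengthFun σ s g) (radiusFun σ s Y u) θ = fun η =>
      -(tangent (radiusFun σ s Y u) θ *
        cauchyKernel (Circle.exp θ) (density s Y g u : Laurent₂ σ) (η - θ)).re := by
  funext η
  rw [cauchyKernel_density hu, tangent_mul_div_eq_kernel, add_sub_cancel, Complex.add_re,
    Complex.re_ofReal_mul, Complex.ofReal_re, Complex.I_re, mul_zero, add_zero, neg_neg]

theorem kernel₂_eq (hu : IsUnit (1 + s • divDiff s Y u : Laurent₂ σ)) (θ : ℝ) :
    kernel₂ (2 + s) (strengthFun σ s g) (radiusFun σ s Y u) θ = fun η =>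
      (tangent (radiusFun σ s Y u) θ *
        cauchyKernel (Circle.exp θ) (density s Y g u : Laurent₂ σ) (η - θ)).im := by
  funext η
  rw [cauchyKernel_density hu, tangent_mul_div_eq_kernel, add_sub_cancel, Complex.add_im,
    Complex.im_ofReal_mul, Complex.ofReal_im, Complex.I_im, mul_one, zero_add]

theorem tangent_mul_eval₂_density (hσ : 0 < σ)
    (hu : IsUnit (1 + s • divDiff s Y u : Laurent₂ σ)) (θ : ℝ) :
    tangent (radiusFun σ s Y u) θ *
        eval₂ (Circle.exp θ) 1 (density s Y g u : Laurent₂ σ) =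
      Complex.I * (2 + s + strengthFun σ s g θ : ℝ) := by
  have h_strength := eval₂_strength (σ := σ) s g θ 0
  rw [Circle.exp_zero, add_zero] at h_strength
  have h_tangent : tangent (radiusFun σ s Y u) θ =
      Complex.I * eval₂ (Circle.exp θ) 1 (1 + s • divDiff s Y u : Laurent₂ σ) := by
    rw [eval₂_one_divDiff hσ, tangent]
    push_cast
    linear_combination ((deriv (radiusFun σ s Y u) θ : ℝ) : ℂ) * Complex.I_sq
  rw [density, eval₂_mul, divDiffInv, eval₂_ringInverse hu, h_strength, h_tangent]
  have h_ne := eval₂_ne_zero hu (Circle.exp θ) 1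
  rw [mul_comm _ (_ : ℂ)⁻¹, mul_assoc, mul_inv_cancel_left₀ h_ne]

theorem tendsto_truncMean_kernel₁ (hσ : 0 < σ)
    (hu : IsUnit (1 + s • divDiff s Y u : Laurent₂ σ)) (θ : ℝ) :
    Tendsto (truncMean (kernel₁ (2 + s) (strengthFun σ s g) (radiusFun σ s Y u) θ) θ) (𝓝[>] 0)
      (𝓝 (-(tangent (radiusFun σ s Y u) θ *
        eval (Circle.exp θ) (pvCauchy (density s Y g u : Laurent₂ σ))).re)) := by
  refine (tendsto_truncMean_mul_cauchyKernel_re (tangent_mul_eval₂_density hσ hu θ)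
    (lipschitzAtOne_density hσ hu _ g).integrableOn_regularKernel).neg.congr fun ε => ?_
  rw [kernel₁_eq hu, truncMean_comp_sub fun τ => -(tangent (radiusFun σ s Y u) θ *
    cauchyKernel (Circle.exp θ) (density s Y g u : Laurent₂ σ) τ).re, truncMean, truncMean,
    integral_neg, mul_neg]

theorem pvExists_kernel₁ (hσ : 0 < σ)
    (hu : IsUnit (1 + s • divDiff s Y u : Laurent₂ σ)) (θ : ℝ) :
    PVExists (kernel₁ (2 + s) (strengthFun σ s g) (radiusFun σ s Y u) θ) θ := by
  refine ⟨fun ε hε => ?_, _, tendsto_truncMean_kernel₁ hσ hu θ⟩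
  rw [kernel₁_eq hu]
  exact (integrableOn_puncturedPeriod_comp_sub.2 (integrableOn_mul_cauchyKernel_re
    (tangent_mul_eval₂_density hσ hu θ)
    (lipschitzAtOne_density hσ hu _ g).integrableOn_regularKernel hε)).neg

theorem periodic_tangent_mul_cauchyKernel_im (θ : ℝ) :
    Function.Periodic (fun τ => (tangent (radiusFun σ s Y u) θ *
      cauchyKernel (Circle.exp θ) (density s Y g u : Laurent₂ σ) τ).im) (2 * Real.pi) := fun τ =>
  congrArg (fun z => (tangent (radiusFun σ s Y u) θ * z).im) (periodic_cauchyKernel _ _ τ)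

theorem intervalIntegrable_kernel₂ (hσ : 0 < σ)
    (hu : IsUnit (1 + s • divDiff s Y u : Laurent₂ σ)) (θ : ℝ) :
    IntervalIntegrable (kernel₂ (2 + s) (strengthFun σ s g) (radiusFun σ s Y u) θ) volume
      (-Real.pi) Real.pi := by
  rw [kernel₂_eq hu]
  exact intervalIntegrable_comp_sub (periodic_tangent_mul_cauchyKernel_im θ)
    (intervalIntegrable_mul_cauchyKernel_im (tangent_mul_eval₂_density hσ hu θ)
      (lipschitzAtOne_density hσ hu _ g).integrableOn_regularKernel) θ

theorem mean_kernel₂ (hσ : 0 < σ)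
    (hu : IsUnit (1 + s • divDiff s Y u : Laurent₂ σ)) (θ : ℝ) :
    mean (kernel₂ (2 + s) (strengthFun σ s g) (radiusFun σ s Y u) θ) =
      (tangent (radiusFun σ s Y u) θ *
        eval (Circle.exp θ) (pvCauchy (density s Y g u : Laurent₂ σ))).im := by
  rw [kernel₂_eq hu, mean_comp_sub (periodic_tangent_mul_cauchyKernel_im θ),
    mean_mul_cauchyKernel_im (tangent_mul_eval₂_density hσ hu θ)
      (lipschitzAtOne_density hσ hu _ g).integrableOn_regularKernel]

theorem eval_equation (hσ : 0 < σ) (hu : IsUnit (1 + s • divDiff s Y u : Laurent₂ σ))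
    (h_eq : (equationLeading ν Y g u + s • equationRemainder s ν Y g u : Laurent σ) = 0) (θ : ℝ) :
    ((2 + s + strengthFun σ s g θ : ℝ) : ℂ) *
        (eval (Circle.exp θ) (pvCauchy (density s Y g u : Laurent₂ σ)) -
          (1 + radiusFun σ s Y u θ : ℝ)) =
      (s * (1 + s * ν) : ℝ) * ((1 + radiusFun σ s Y u θ : ℝ) +
        Complex.I * (deriv (radiusFun σ s Y u) θ : ℝ)) := by
  have h_eval := congrArg (eval (Circle.exp θ)) (equation_expansion (ν := ν) (g := g) hu)
  rw [h_eq, smul_zero, map_zero, map_sub, eval_mul, map_add, eval_smul_evenSeries, map_sub,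
    map_smul, map_smul, map_sub, map_add, eval_one, eval_radius, eval_radiusDeriv hσ,
    Complex.real_smul, Complex.real_smul] at h_eval
  push_cast at h_eval ⊢
  linear_combination h_eval

theorem tangent_mul_eval_pvCauchy_density (hσ : 0 < σ)
    (hu : IsUnit (1 + s • divDiff s Y u : Laurent₂ σ))
    (h_eq : (equationLeading ν Y g u + s • equationRemainder s ν Y g u : Laurent σ) = 0) {θ : ℝ}
    (hg : 2 + s + strengthFun σ s g θ ≠ 0) :
    tangent (radiusFun σ s Y u) θ *
        eval (Circle.exp θ) (pvCauchy (density s Y g u : Laurent₂ σ)) =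
      (deriv (radiusFun σ s Y u) θ * (1 + radiusFun σ s Y u θ) : ℝ) +
        ((1 + radiusFun σ s Y u θ) ^ 2 + s * (1 + s * ν) *
          (deriv (radiusFun σ s Y u) θ ^ 2 + (1 + radiusFun σ s Y u θ) ^ 2) /
            (2 + s + strengthFun σ s g θ) : ℝ) * Complex.I := by
  have h_eval := eval_equation hσ hu h_eq θ
  have hg : (2 + s + strengthFun σ s g θ : ℂ) ≠ 0 := by exact_mod_cast hg
  rw [tangent]
  push_cast at h_eval ⊢
  refine mul_left_cancel₀ hg ?_
  field_simp
  linear_combination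
    ((deriv (radiusFun σ s Y u) θ : ℝ) + Complex.I * (1 + radiusFun σ s Y u θ)) * h_eval +
      s * (1 + s * ν) * ((deriv (radiusFun σ s Y u) θ : ℝ) * (1 + radiusFun σ s Y u θ)) *
        Complex.I_sq

theorem isSolution (hσ : 0 < σ) (hu : IsUnit (1 + s • divDiff s Y u : Laurent₂ σ))
    (h_eq : (equationLeading ν Y g u + s • equationRemainder s ν Y g u : Laurent σ) = 0)
    (hr : ∀ θ, 0 < 1 + radiusFun σ s Y u θ) (hg : ∀ θ, 0 < 2 + s + strengthFun σ s g θ) :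
    IsSolution 1 (2 + s) (strengthFun σ s g) (radiusFun σ s Y u) := by
  have h_pvMean (θ : ℝ) :
      pvMean (kernel₁ (2 + s) (strengthFun σ s g) (radiusFun σ s Y u) θ) θ =
        -(deriv (radiusFun σ s Y u) θ * (1 + radiusFun σ s Y u θ)) := by
    rw [pvMean, (tendsto_truncMean_kernel₁ hσ hu θ).limUnder_eq,
      tangent_mul_eval_pvCauchy_density hσ hu h_eq (hg θ).ne', Complex.add_re,
      Complex.re_ofReal_mul, Complex.ofReal_re, Complex.I_re, mul_zero, add_zero]
  have h_tilde : F₂tilde 1 (2 + s) (strengthFun σ s g) (radiusFun σ s Y u) =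
      fun _ => s * (1 + s * ν) := by
    funext θ
    have hr := hr θ
    have hg := hg θ
    rw [F₂tilde, mean_kernel₂ hσ hu,
      tangent_mul_eval_pvCauchy_density hσ hu h_eq hg.ne', Complex.add_im, Complex.im_ofReal_mul,
      Complex.ofReal_im, Complex.I_im, mul_one, zero_add]
    have : deriv (radiusFun σ s Y u) θ ^ 2 + (1 + radiusFun σ s Y u θ) ^ 2 ≠ 0 := by positivity
    field_simp
    ring
  refine ⟨hr, pvExists_kernel₁ hσ hu, intervalIntegrable_kernel₂ hσ hu, ?_, fun θ => ?_,
    fun θ => ?_⟩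
  · rw [h_tilde]
    exact intervalIntegrable_const
  · rw [F₁, h_pvMean]
    ring
  · rw [F₂, h_tilde, mean, intervalIntegral.integral_const, smul_eq_mul]
    have := Real.pi_ne_zero
    field_simp
    ring

end

/-! ### The branches of solutions -/

theorem radiusFun_pos {s Y : ℝ} {u : L1 ℕ} (h : 2 * ‖radiusCoeff σ s Y u‖ < 1) (θ : ℝ) :
    0 < 1 + radiusFun σ s Y u θ := by
  have := (abs_le.1 (abs_onReal_cosSeries_le (σ := σ) (radiusCoeff σ s Y u) θ)).1
  rw [radiusFun]
  linarith

theorem strengthFun_pos {s : ℝ} {g : L1 ℕ} (hs : -1 < s) (h : 2 * ‖s ^ 2 • g‖ < 1) (θ : ℝ) :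
    0 < 2 + s + strengthFun σ s g θ := by
  have := (abs_le.1 (abs_onReal_cosSeries_le (σ := σ) (s ^ 2 • g) θ)).1
  rw [strengthFun]
  linarith

theorem modeTwo_radiusFun (s Y : ℝ) (u : L1 ℕ) : modeTwo (radiusFun σ s Y u) = s * (2 * Y) := by
  have h_zero : radiusCoeff σ s Y u 0 = s * (Real.exp σ * Y) := by
    simp only [radiusCoeff, lp.coeFn_add, lp.coeFn_smul, Pi.add_apply, Pi.smul_apply, smul_eq_mul,
      L1.unit_apply, shiftDiv_apply_zero, if_true, mul_one, mul_zero, add_zero]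
  rw [radiusFun, modeTwo_cosSeries, h_zero]
  field_simp

theorem continuousAt_radiusCoeff {Y : ℝ → ℝ} {u : ℝ → L1 ℕ} {x : ℝ} (hY : ContinuousAt Y x)
    (hu : ContinuousAt u x) : ContinuousAt (fun s => radiusCoeff σ s (Y s) (u s)) x := by
  have := shiftDiv.continuous.continuousAt.comp' hu
  unfold radiusCoeff
  fun_prop

theorem eventually_isUnit {Y : ℝ → ℝ} {u : ℝ → L1 ℕ} (hY : ContinuousAt Y 0)
    (hu : ContinuousAt u 0) :
    ∀ᶠ s in 𝓝 (0 : ℝ), IsUnit (1 + s • divDiff s (Y s) (u s) : Laurent₂ σ) := by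
  have := (divDiffTail (σ := σ)).continuous.continuousAt.comp' hu
  have h_cont : ContinuousAt (fun s => (1 + s • divDiff s (Y s) (u s) : Laurent₂ σ)) 0 := by
    unfold divDiff
    fun_prop
  refine h_cont.eventually (Units.isOpen.mem_nhds ?_)
  simp

theorem eventually_isSolution (hσ : 0 < σ) {ν Y : ℝ → ℝ} {g u : ℝ → L1 ℕ}
    (hY : ContinuousAt Y 0) (hg : ContinuousAt g 0) (hu : ContinuousAt u 0)
    (h_eq : ∀ᶠ s in 𝓝 0, (equationLeading (ν s) (Y s) (g s) (u s) +
      s • equationRemainder s (ν s) (Y s) (g s) (u s) : Laurent σ) = 0) :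
    ∀ᶠ s in 𝓝 0, IsSolution 1 (2 + s) (strengthFun σ s (g s)) (radiusFun σ s (Y s) (u s)) := by
  have hg_cont : ContinuousAt (fun s => 2 * ‖s ^ 2 • g s‖) 0 := by fun_prop
  have hg_small : ∀ᶠ s in 𝓝 (0 : ℝ), 2 * ‖s ^ 2 • g s‖ < 1 :=
    hg_cont.eventually_lt_const (by simp)
  have hr_small : ∀ᶠ s in 𝓝 (0 : ℝ), 2 * ‖radiusCoeff σ s (Y s) (u s)‖ < 1 :=
    ((continuousAt_radiusCoeff hY hu).norm.const_mul 2).eventually_lt_const (by simp [radiusCoeff])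
  filter_upwards [h_eq, eventually_isUnit hY hu, hg_small, hr_small,
    eventually_gt_nhds (show (-1 : ℝ) < 0 by norm_num)] with s hs_eq hs_unit hs_g hs_r hs
  exact isSolution hσ hs_unit hs_eq (radiusFun_pos hs_r) (strengthFun_pos hs hs_g)

theorem exists_coeff_branch (hσ : 0 < σ) {m : ℝ} (hm : 1 - 4 * m ^ 2 = 0) :
    ∃ a b : ℝ → L1 ℕ, a 0 = 0 ∧ b 0 = 0 ∧
      (∀ᶠ x in 𝓝 0, ContinuousAt a x ∧ ContinuousAt b x) ∧
      (∀ᶠ x in 𝓝 0,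
        IsSolution 1 (2 + x) (onReal (cosSeries σ (a x))) (onReal (cosSeries σ (b x)))) ∧
      Tendsto (fun x => modeTwo (onReal (cosSeries σ (b x))) / x) (𝓝[≠] 0) (𝓝 m) := by
  obtain ⟨ψ, h_zero, h_cont, h_eq⟩ := exists_branch σ (Y := m / 2) (by linarith)
  have hψ : ContinuousAt ψ 0 := h_cont.self_of_nhds
  have hY₀ : (ψ 0).2.1 = m / 2 := by rw [h_zero, basePoint]
  refine ⟨fun x => x ^ 2 • (ψ x).2.2.1, fun x => radiusCoeff σ x (ψ x).2.1 (ψ x).2.2.2,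
    by simp, by simp [radiusCoeff], ?_,
    eventually_isSolution hσ hψ.snd.fst hψ.snd.snd.fst hψ.snd.snd.snd h_eq, ?_⟩
  · filter_upwards [h_cont] with x hx
    exact ⟨((continuous_pow 2).continuousAt).smul hx.snd.snd.fst,
      continuousAt_radiusCoeff hx.snd.fst hx.snd.snd.snd⟩
  · have h_lim : Tendsto (fun x => 2 * (ψ x).2.1) (𝓝[≠] 0) (𝓝 m) := by
      have := (hψ.snd.fst.tendsto.const_mul 2).mono_left (nhdsWithin_le_nhds (s := {0}ᶜ))
      rwa [hY₀, mul_div_cancel₀ _ two_ne_zero] at this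
    refine h_lim.congr' ?_
    filter_upwards [self_mem_nhdsWithin] with x hx
    exact (mul_div_cancel_left₀ _ hx).symm.trans
      (congrArg (· / x) (modeTwo_radiusFun (σ := σ) x _ _).symm)

end VortexSheet

end

open VortexSheet

theorem theorem2p2_general {c m : ℝ} (hc : 0 < c) (hm : 1 - 4 * m ^ 2 = 0) :
    ∃ (δ : ℝ) (g r : ℝ → ℂ → ℂ), 0 < δ ∧ g 0 = 0 ∧ r 0 = 0 ∧
      (∀ x ∈ Ioo (-δ) δ, (∀ k, g x ∈ X k c ∧ r x ∈ X k c) ∧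
        IsSolution 1 (2 + x) (onReal (g x)) (onReal (r x))) ∧
      (∀ x ∈ Ioo (-δ) δ, ∀ k,
        Tendsto (fun y => stripNormSq k c (g y - g x)) (𝓝 x) (𝓝 0) ∧
        Tendsto (fun y => stripNormSq k c (r y - r x)) (𝓝 x) (𝓝 0)) ∧
      (∀ x ∈ Ioo (-δ) δ, x ≠ 0 → onReal (r x) ≠ 0) ∧
      Tendsto (fun x => modeTwo (onReal (r x)) / x) (𝓝[≠] 0) (𝓝 m) := by
  obtain ⟨σ, hσ⟩ : ∃ σ : NNReal, c < σ / 2 :=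
    ⟨Real.toNNReal (4 * c), by rw [Real.coe_toNNReal _ (by positivity)]; linarith⟩
  have hσ_pos : 0 < σ := by
    rw [← NNReal.coe_pos]
    linarith
  obtain ⟨a, b, ha, hb, h_cont, h_sol, h_mode⟩ := exists_coeff_branch hσ_pos hm
  have hm₀ : m ≠ 0 := by
    rintro rfl
    norm_num at hm
  have h_ne : ∀ᶠ x in 𝓝 0, x ≠ 0 → onReal (cosSeries σ (b x)) ≠ 0 :=
    eventually_nhdsWithin_iff.1 <| (h_mode.eventually_ne hm₀).mono fun x hx h => hx <| by
      simp [h, modeTwo]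
  obtain ⟨δ, hδ, h_ball⟩ := Metric.eventually_nhds_iff_ball.1 (h_cont.and (h_sol.and h_ne))
  simp only [Real.ball_eq_Ioo, zero_sub, zero_add] at h_ball
  refine ⟨δ, fun x => cosSeries σ (a x), fun x => cosSeries σ (b x), hδ, by
    simp only [ha, cosSeries_zero], by simp only [hb, cosSeries_zero], fun x hx => ⟨fun k =>
      ⟨cosSeries_mem_X _ k hc hσ, cosSeries_mem_X _ k hc hσ⟩, (h_ball x hx).2.1⟩,
    fun x hx k => ?_, fun x hx => (h_ball x hx).2.2, h_mode⟩
  have hc_abs : |c| < σ / 2 := by rwa [abs_of_pos hc]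
  exact ⟨tendsto_stripNormSq_cosSeries (h_ball x hx).1.1 k hc_abs,
    tendsto_stripNormSq_cosSeries (h_ball x hx).1.2 k hc_abs⟩

theorem theorem2p2 :
    ∃ c₀ : ℝ, 0 < c₀ ∧ ∀ k : ℕ, 3 ≤ k → ∀ c : ℝ, 0 < c → c < c₀ →
      ∀ m : ℝ, 1 - 4 * m ^ 2 = 0 →
        ∃ (δ : ℝ) (g r : ℝ → ℂ → ℂ), 0 < δ ∧
          g 0 = 0 ∧ r 0 = 0 ∧
          (∀ x ∈ Set.Ioo (-δ) δ,
            g x ∈ VortexSheet.X k c ∧ r x ∈ VortexSheet.X (k + 1) c ∧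
            VortexSheet.IsSolution 1 (2 + x)
              (VortexSheet.onReal (g x)) (VortexSheet.onReal (r x))) ∧
          (∀ x ∈ Set.Ioo (-δ) δ,
            Filter.Tendsto (fun y => VortexSheet.stripNormSq k c (g y - g x))
              (nhds x) (nhds 0) ∧
            Filter.Tendsto (fun y => VortexSheet.stripNormSq (k + 1) c (r y - r x))
              (nhds x) (nhds 0)) ∧
          (∀ x ∈ Set.Ioo (-δ) δ, x ≠ 0 →
            VortexSheet.onReal (g x) ≠ 0 ∨ VortexSheet.onReal (r x) ≠ 0) ∧
          Filter.Tendsto (fun x => VortexSheet.modeTwo (VortexSheet.onReal (r x)) / x)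
            (nhdsWithin 0 {0}ᶜ) (nhds m) := by
  refine ⟨1, one_pos, fun k _ c hc _ m hm => ?_⟩
  obtain ⟨δ, g, r, hδ, hg, hr, h_sol, h_cont, h_ne, h_mode⟩ := theorem2p2_general hc hm
  exact ⟨δ, g, r, hδ, hg, hr,
    fun x hx => ⟨((h_sol x hx).1 k).1, ((h_sol x hx).1 (k + 1)).2, (h_sol x hx).2⟩,
    fun x hx => ⟨(h_cont x hx k).1, (h_cont x hx (k + 1)).2⟩,
    fun x hx hx₀ => Or.inr (h_ne x hx hx₀), h_mode⟩
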